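/- Let $\mathbb T=\mathbb R/\mathbb Z$. Let $\mu:\mathbb R\to\mathbb R$ be an $S$-stable profile with centre $\bar v\in\mathbb R$: $\mu$ is continuous, $\int_{\mathbb R}\mu\,dv=1$, $\int\mu(v)v^2\,dv<\infty$, $\mu$ is strictly increasing on $(-\infty,\bar v]$ and strictly decreasing on $[\bar v,\infty)$, and $\mu(2\bar v-v)=\mu(v)$ for all $v$. Let $\varphi:(-\infty,0]\to\mathbb R^+$ be the continuous increasing function with $\mu(v)=\varphi(-|v-\bar v|^2/2)$. Let $Q:[0,\infty)\to\mathbb R$ be any admissible function: $Q(0)=0$, $Q$ is continuous on $[0,\infty)$ and $C^1$ on $(0,\infty)$, $Q'$ is nondecreasing on $(0,\infty)$, and $Q'=\varphi^{-1}$ on the range of $\varphi$. For measurable $g\ge0$ on $\mathbb T\times\mathbb R$ put $$H_Q[g]=\int\bigl(Q(g)-Q(\mu)-Q'(\mu)(g-\mu)\bigr)\,dv\,dx\in[0,\infty].$$ Assume that $\int\mu(v)(1+|v|^{2+\eta})\,dv<\infty$ for some $\eta>0$. For $\varepsilon>0$, a global strong solution of the Vlasov–Poisson system $$\partial_tf_\varepsilon+v\,\partial_xf_\varepsilon-\partial_xV_\varepsilon\,\partial_vf_\varepsilon=0,\qquad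 -\varepsilon^2\partial_x^2V_\varepsilon=\int f_\varepsilon\,dv-1$$ with initial datum $f_{0,\varepsilon}\in L^1(\mathbb T\times\mathbb R)$, $f_{0,\varepsilon}\ge0$, $\int f_{0,\varepsilon}\,dv\,dx=1$, is a pair $(f_\varepsilon,V_\varepsilon)$ such that: $f_\varepsilon\ge0$, $f_\varepsilon(t)\in L^1(\mathbb T\times\mathbb R)$ for all $t\ge0$, $f_\varepsilon$ is locally Lipschitz on $(0,\infty)\times\mathbb T\times\mathbb R$ and satisfies the Vlasov equation almost everywhere, $f_\varepsilon(t)\to f_\varepsilon(0)=f_{0,\varepsilon}$ in $L^1$ as $t\to0^+$, and for every $t\ge0$ the function $V_\varepsilon(t)$ is $C^1$ on $\mathbb T$, $\partial_xV_\varepsilon(t)$ is absolutely continuous, and the Poisson equation holds for almost every $x$. Then there is a function $K:\mathbb R\times\mathbb R\to(0,\infty)$, not depending on $\mu$, $\bar v$, $\eta$, $Q$ or on anything that follows, such that for every potential $V_0\in C^3(\mathbb T)$, every $\varepsilon>0$ and every global strong solution $(f_\varepsilon,V_\varepsilon)$, the filtered modulated energy $$\mathcal L^O_\varepsilon(t)=H_Q\Bigl[f_\varepsilon\bigl(t,x,v-\partial_xV_0(x-\bar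 vt)\sin\tfrac t\varepsilon\bigr)\Bigr]+\frac12\int_{\mathbb T}\Bigl[\varepsilon\,\partial_xV_\varepsilon(t,x)-\partial_xV_0(x-\bar vt)\cos\tfrac t\varepsilon\Bigr]^2dx$$ satisfies, for all $t\ge0$, $$\mathcal L^O_\varepsilon(t)\le e^{2\|\partial_{xx}V_0\|_\infty t}\Bigl[\mathcal L^O_\varepsilon(0)+K\bigl(\|\partial_{xx}V_0\|_\infty,\|\partial_{xxx}V_0\|_\infty\bigr)\,\varepsilon\,\bigl(1+\mathcal E_{\varepsilon,0}+\mathcal Q_{\varepsilon,0}\bigr)\Bigr],$$ where $$\mathcal E_{\varepsilon,0}=\frac12\int f_{0,\varepsilon}v^2\,dv\,dx+\frac{\varepsilon^2}2\int_{\mathbb T}|\partial_xV_\varepsilon(0,x)|^2dx,\qquad \mathcal Q_{\varepsilon,0}=\int\Bigl(|Q(f_{0,\varepsilon})|+\frac{Q(f_{0,\varepsilon})^2}{f_{0,\varepsilon}}\Bigr)dv\,dx,$$ the quotient being $0$ where $f_{0,\varepsilon}=0$. All these quantities take values in $[0,\infty]$. -/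

import Mathlib

open MeasureTheory Set Filter Topology

noncomputable section

namespace VlasovPoisson

/-- The phase space `𝕋 × ℝ`, `𝕋 = ℝ/ℤ`: functions on `𝕋` are `1`-periodic functions on `ℝ`, and
integrals over `𝕋` are integrals over the period `(0, 1]`. -/
def phaseMeasure : Measure (ℝ × ℝ) := (volume.restrict (Ioc (0 : ℝ) 1)).prod volume

/-- The density `ρ = ∫ g dv` of a distribution function `g(x, v)`. -/
def density (g : ℝ → ℝ → ℝ) (x : ℝ) : ℝ := ∫ v, g x v

/-- `(f, V)` is a global strong solution of the Vlasov-Poisson system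
`∂ₜf + v ∂ₓf - ∂ₓV ∂ᵥf = 0`, `-ε² ∂ₓ²V = ∫ f dv - 1` on `[0, ∞) × 𝕋 × ℝ`, with initial datum `f 0`:
`f` is nonnegative, locally Lipschitz for positive times (so that its first derivatives exist almost
everywhere and are locally bounded), both equations hold almost everywhere, and the datum is attained
in `L¹`. -/
structure IsStrongSolution (ε : ℝ) (f : ℝ → ℝ → ℝ → ℝ) (V : ℝ → ℝ → ℝ) : Prop where
  periodic : ∀ t, 0 ≤ t → ∀ v, Function.Periodic (fun x => f t x v) 1
  nonneg : ∀ t, 0 ≤ t → ∀ x v, 0 ≤ f t x v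
  integrable : ∀ t, 0 ≤ t → Integrable (fun z : ℝ × ℝ => f t z.1 z.2) phaseMeasure
  mass : ∫ z, f 0 z.1 z.2 ∂phaseMeasure = 1
  locallyLipschitz : LocallyLipschitzOn (Ioi (0 : ℝ) ×ˢ (univ : Set (ℝ × ℝ)))
    (fun z : ℝ × ℝ × ℝ => f z.1 z.2.1 z.2.2)
  initial : Tendsto (fun t => ∫ z, |f t z.1 z.2 - f 0 z.1 z.2| ∂phaseMeasure) (𝓝[>] 0) (𝓝 0)
  potential_periodic : ∀ t, 0 ≤ t → Function.Periodic (V t) 1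
  potential_contDiff : ∀ t, 0 ≤ t → ContDiff ℝ 1 (V t)
  field_absolutelyContinuous : ∀ t, 0 ≤ t → ∀ a b,
    AbsolutelyContinuousOnInterval (deriv (V t)) a b
  poisson : ∀ t, 0 ≤ t → ∀ᵐ x : ℝ, -ε ^ 2 * deriv (deriv (V t)) x = density (f t) x - 1
  vlasov : ∀ᵐ z : ℝ × ℝ × ℝ, 0 < z.1 →
    deriv (fun s => f s z.2.1 z.2.2) z.1 + z.2.2 * deriv (fun y => f z.1 y z.2.2) z.2.1
      - deriv (V z.1) z.2.1 * deriv (fun w => f z.1 z.2.1 w) z.2.2 = 0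

/-- `S`-stable profiles `μ`, with symmetry center `vbar`. -/
structure IsSStable (μ : ℝ → ℝ) (vbar : ℝ) : Prop where
  integral_eq_one : ∫ v, μ v = 1
  continuous : Continuous μ
  finite_energy : Integrable (fun v => μ v * v ^ 2)
  strictMonoOn : StrictMonoOn μ (Iic vbar)
  strictAntiOn : StrictAntiOn μ (Ici vbar)
  symmetric : ∀ v, μ (2 * vbar - v) = μ v

/-- The function `φ` on `(-∞, 0]` with `μ v = φ (-(v - vbar)² / 2)`. -/
def profileFun (μ : ℝ → ℝ) (vbar u : ℝ) : ℝ := μ (vbar + √(-2 * u))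

theorem IsSStable.eq_profileFun {μ : ℝ → ℝ} {vbar : ℝ} (h : IsSStable μ vbar) (v : ℝ) :
    μ v = profileFun μ vbar (-(v - vbar) ^ 2 / 2) := by
  have e : -2 * (-(v - vbar) ^ 2 / 2) = (v - vbar) ^ 2 := by ring
  unfold profileFun
  rw [e, Real.sqrt_sq_eq_abs]
  rcases abs_cases (v - vbar) with ⟨h1, _⟩ | ⟨h1, _⟩
  · rw [h1]; congr 1; ring
  · rw [h1, ← h.symmetric v]; congr 1; ring

/-- Admissible functions `Q : [0, ∞) → ℝ`: `Q 0 = 0`, `Q' = φ⁻¹` on the range of `φ`, and `Q'` is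
continuous and increasing. As `φ⁻¹ → -∞` at `0`, the derivative is only considered on `(0, ∞)`, and
`Q` is continuous at `0`. -/
structure IsAdmissible (μ : ℝ → ℝ) (vbar : ℝ) (Q : ℝ → ℝ) : Prop where
  zero : Q 0 = 0
  continuousOn : ContinuousOn Q (Ici 0)
  differentiableOn : DifferentiableOn ℝ Q (Ioi 0)
  deriv_continuousOn : ContinuousOn (deriv Q) (Ioi 0)
  deriv_monotoneOn : MonotoneOn (deriv Q) (Ioi 0)
  deriv_profileFun : ∀ u, u ≤ 0 → deriv Q (profileFun μ vbar u) = u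

open scoped ENNReal

/-- The Casimir functional `H_Q(g) = ∫ (Q(g) - Q(μ) - Q'(μ)(g - μ)) dv dx ∈ [0, ∞]`, the integrand
being nonnegative by convexity of `Q`. -/
def casimir (Q μ : ℝ → ℝ) (g : ℝ → ℝ → ℝ) : ℝ≥0∞ :=
  ∫⁻ z, ENNReal.ofReal
    (Q (g z.1 z.2) - Q (μ z.2) - deriv Q (μ z.2) * (g z.1 z.2 - μ z.2)) ∂phaseMeasure

/-- The filtered modulated energy at time `t`. -/
def filteredEnergy (Q μ : ℝ → ℝ) (vbar : ℝ) (V₀ : ℝ → ℝ) (ε : ℝ)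
    (f : ℝ → ℝ → ℝ → ℝ) (V : ℝ → ℝ → ℝ) (t : ℝ) : ℝ≥0∞ :=
  casimir Q μ (fun x v => f t x (v - deriv V₀ (x - vbar * t) * Real.sin (t / ε)))
    + 2⁻¹ * ∫⁻ x in Ioc (0 : ℝ) 1, ENNReal.ofReal
        ((ε * deriv (V t) x - deriv V₀ (x - vbar * t) * Real.cos (t / ε)) ^ 2)

/-- The energy `½ ∫ g v² dv dx + (ε²/2) ∫ (∂ₓU)² dx ∈ [0, ∞]`. -/
def energy (ε : ℝ) (g : ℝ → ℝ → ℝ) (U : ℝ → ℝ) : ℝ≥0∞ :=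
  2⁻¹ * (∫⁻ z, ENNReal.ofReal (g z.1 z.2 * z.2 ^ 2) ∂phaseMeasure)
    + ENNReal.ofReal (ε ^ 2 / 2) * ∫⁻ x in Ioc (0 : ℝ) 1, ENNReal.ofReal (deriv U x ^ 2)

/-- `∫ (|Q(g)| + Q(g)²/g) dv dx ∈ [0, ∞]`, the quotient being `0` where `g = 0`. -/
def casimirBound (Q : ℝ → ℝ) (g : ℝ → ℝ → ℝ) : ℝ≥0∞ :=
  ∫⁻ z, ENNReal.ofReal (|Q (g z.1 z.2)| + Q (g z.1 z.2) ^ 2 / g z.1 z.2) ∂phaseMeasure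

/-- The sup norm of a bounded function. -/
def supNorm (g : ℝ → ℝ) : ℝ := ⨆ x, |g x|

end VlasovPoisson

end

/-! ### Locally Lipschitz solutions of the transport equation and their renormalisation -/

open scoped ENNReal NNReal
noncomputable section
namespace VlasovPoisson

/-! Write W for ∂ₓV₀, F for ∂ₓV, L for the modulated energy, s and c for the sine and cosine of t/ε,
and λ for the sup norm of V₀''.

Since Q'(μ(v)) = -(v-v̄)²/2, the density of H_Q is Q(g) + (v-v̄)²g/2 + κ(v), where κ ≥ 0 does not
involve g. The shear v ↦ v + W(x-v̄t)s turns L into a functional of f itself. Expanding the squares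
leaves ∫Q(f), ∫κ and the total energy in the frame of v̄, which are all constant in time, and in
addition current, charge and field terms tested against W(x-v̄t) and its square (`realEnergy_eq`).
Differentiating these with the moment equations, all terms of order 1/ε cancel, because the phases s
and c follow the plasma oscillation; this gives `slope`.

The part of `slope` quadratic in v and F is rewritten through the modulated densities weighted by
W', at the cost of 2λ|s|L (`slope_le`). Three terms remain: s∫Q(f)W', s times `rotated`, and s³∫f
W²W'. In the first two an oscillating factor multiplies a quantity whose time derivative is bounded
uniformly in ε, so integration by parts in time against ε(1 - cos(t/ε)) gains a factor ε. For Q(f)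
the derivative is a flux, controlled by |Q(f)||v-v̄| ≤ (Q(f)²/f + f(v-v̄)²)/2; this is the role of
the quotient in the Casimir bound q. The third term is of order ε by the Poisson equation, because
∫W²W' = 0.

The errors contain the conserved energy, which is at most a multiple of L(0) + q + λ². Terms of size
εtL(0) therefore appear, while L(0) must keep the coefficient 1. Room comes from averaging: the rate
2λ|s| accumulates to at most (9/5)λt, and the spare factor exp(λt/5) absorbs L(0)(1 + λt/10) and 1 +
t. This needs ε small in terms of λ; for larger ε the inequality without integration by parts
suffices, its error being itself at most a multiple of ε (`le_of_energy_inequalities`).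

Solutions are only locally Lipschitz for t > 0 and attain the datum in L¹, so every identity comes
from a weak formulation (`WeakOn`), proved for compactly supported tests and extended by cutoffs. As
C¹ functions of f are transported too, the distribution of values of f is conserved, and cutting Q
near 0 gives the equation for Q(f). The field is bounded by 2/ε² and controlled in time by the L¹
distance of f; this propagates second moments and yields conservation of energy without a time
derivative of V. -/

/-- `g` is a locally Lipschitz, `x`-periodic solution of `∂ₜg + v ∂ₓg - F ∂ᵥg = 0` for positive
times. -/
structure IsTransported (F : ℝ → ℝ → ℝ) (g : ℝ → ℝ → ℝ → ℝ) : Prop where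
  locallyLipschitz : LocallyLipschitzOn (Ioi (0 : ℝ) ×ˢ (univ : Set (ℝ × ℝ)))
    (fun z : ℝ × ℝ × ℝ => g z.1 z.2.1 z.2.2)
  periodic : ∀ t, 0 < t → ∀ v, Function.Periodic (fun x => g t x v) 1
  eqn : ∀ᵐ z : ℝ × ℝ × ℝ, 0 < z.1 →
    deriv (fun s => g s z.2.1 z.2.2) z.1 + z.2.2 * deriv (fun y => g z.1 y z.2.2) z.2.1
      - F z.1 z.2.1 * deriv (fun w => g z.1 z.2.1 w) z.2.2 = 0

/-- On a compact box local Lipschitz continuity is uniform, and a real Lipschitz function extends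
with the same constant. Global extensions have bounded difference quotients and are absolutely
continuous on every line. -/
theorem exists_lipschitz_extension {g : ℝ × ℝ × ℝ → ℝ}
    (hg : LocallyLipschitzOn (Ioi (0 : ℝ) ×ˢ (univ : Set (ℝ × ℝ))) g) {a : ℝ} (ha : 0 < a)
    (b R : ℝ) : ∃ (K : ℝ≥0) (G : ℝ × ℝ × ℝ → ℝ), LipschitzWith K G ∧
      EqOn g G (Icc a b ×ˢ Icc (-R) R ×ˢ Icc (-R) R) := by
  obtain ⟨K, hK⟩ := LocallyLipschitzOn.exists_lipschitzOnWith_of_compact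
    (s := Icc a b ×ˢ Icc (-R) R ×ˢ Icc (-R) R) (f := g)
    (isCompact_Icc.prod (isCompact_Icc.prod isCompact_Icc))
    (hg.mono (prod_mono (fun x hx => lt_of_lt_of_le ha hx.1) (subset_univ _)))
  obtain ⟨G, hG, hE⟩ := hK.extend_real
  exact ⟨K, G, hG, hE⟩

/-- Rademacher's theorem applies to the extensions from countably many boxes exhausting the half
space of positive times; each such point is interior to some box. -/
theorem ae_differentiableAt_of_locallyLipschitzOn {g : ℝ × ℝ × ℝ → ℝ}
    (hg : LocallyLipschitzOn (Ioi (0 : ℝ) ×ˢ (univ : Set (ℝ × ℝ))) g) :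
    ∀ᵐ z : ℝ × ℝ × ℝ, 0 < z.1 → DifferentiableAt ℝ g z := by
  have h : ∀ n : ℕ, ∃ (K : ℝ≥0) (G : ℝ × ℝ × ℝ → ℝ), LipschitzWith K G ∧
      EqOn g G (Icc (1 / ((n : ℝ) + 1)) n ×ˢ Icc (-(n : ℝ)) n ×ˢ Icc (-(n : ℝ)) n) :=
    fun n => exists_lipschitz_extension hg (by positivity) n n
  choose K G hG hE using h
  have : (volume : Measure (ℝ × ℝ)).IsAddHaarMeasure :=
    inferInstanceAs ((volume : Measure ℝ).prod (volume : Measure ℝ)).IsAddHaarMeasure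
  have : (volume : Measure (ℝ × ℝ × ℝ)).IsAddHaarMeasure :=
    inferInstanceAs ((volume : Measure ℝ).prod (volume : Measure (ℝ × ℝ))).IsAddHaarMeasure
  have hd : ∀ᵐ z : ℝ × ℝ × ℝ, ∀ n, DifferentiableAt ℝ (G n) z :=
    ae_all_iff.2 fun n => (hG n).ae_differentiableAt
  filter_upwards [hd] with z hz h0
  obtain ⟨n, hn⟩ := exists_nat_gt (max (max z.1 (1 / z.1)) (max |z.2.1| |z.2.2|))
  simp only [max_lt_iff] at hn
  obtain ⟨⟨h1, h2⟩, h3, h4⟩ := hn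
  refine (hz n).congr_of_eventuallyEq ?_
  have hmem : (Icc (1 / ((n : ℝ) + 1)) n ×ˢ Icc (-(n : ℝ)) n ×ˢ Icc (-(n : ℝ)) n) ∈ 𝓝 z := by
    refine prod_mem_nhds (Icc_mem_nhds ?_ h1)
      (prod_mem_nhds (Icc_mem_nhds (abs_lt.1 h3).1 (abs_lt.1 h3).2)
        (Icc_mem_nhds (abs_lt.1 h4).1 (abs_lt.1 h4).2))
    rw [div_lt_iff₀ (by positivity)]
    rw [div_lt_iff₀ h0] at h2
    nlinarith
  filter_upwards [hmem] with y hy using hE n hy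

theorem differentiableAt_slices {g : ℝ × ℝ × ℝ → ℝ} {z : ℝ × ℝ × ℝ} (h : DifferentiableAt ℝ g z) :
    DifferentiableAt ℝ (fun s => g (s, z.2.1, z.2.2)) z.1 ∧
      DifferentiableAt ℝ (fun y => g (z.1, y, z.2.2)) z.2.1 ∧
      DifferentiableAt ℝ (fun w => g (z.1, z.2.1, w)) z.2.2 := by
  refine ⟨?_, ?_, ?_⟩
  · exact DifferentiableAt.comp (f := fun s => (s, z.2.1, z.2.2)) z.1 h (by fun_prop)
  · exact DifferentiableAt.comp (f := fun s => (z.1, s, z.2.2)) z.2.1 h (by fun_prop)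
  · exact DifferentiableAt.comp (f := fun s => (z.1, z.2.1, s)) z.2.2 h (by fun_prop)

/-- Renormalisation: almost everywhere the chain rule is valid in each variable, and the equation
for β(g) is β'(g) times that for g. -/
theorem IsTransported.comp {F : ℝ → ℝ → ℝ} {g : ℝ → ℝ → ℝ → ℝ} (hg : IsTransported F g)
    {β : ℝ → ℝ} (hβ : ContDiff ℝ 1 β) : IsTransported F (fun t x v => β (g t x v)) where
  locallyLipschitz := by
    intro z hz
    obtain ⟨K, s, hs, hK⟩ := hg.locallyLipschitz hz
    obtain ⟨K', s', hs', hK'⟩ := hβ.locallyLipschitz (g z.1 z.2.1 z.2.2)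
    have hc : ContinuousWithinAt (fun z : ℝ × ℝ × ℝ => g z.1 z.2.1 z.2.2)
      (Ioi (0 : ℝ) ×ˢ (univ : Set (ℝ × ℝ))) z := hg.locallyLipschitz.continuousOn z hz
    refine ⟨K' * K, _, inter_mem hs (hc hs'), ?_⟩
    exact hK'.comp (hK.mono inter_subset_left) (fun y hy => hy.2)
  periodic t ht v x := congrArg β (hg.periodic t ht v x)
  eqn := by
    filter_upwards [hg.eqn, ae_differentiableAt_of_locallyLipschitzOn hg.locallyLipschitz]
      with z h1 h2 h0
    obtain ⟨d1, d2, d3⟩ := differentiableAt_slices (h2 h0)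
    have hd : Differentiable ℝ β := hβ.differentiable (by norm_num)
    have e1 := ((hd _).hasDerivAt.comp z.1 d1.hasDerivAt).deriv
    have e2 := ((hd _).hasDerivAt.comp z.2.1 d2.hasDerivAt).deriv
    have e3 := ((hd _).hasDerivAt.comp z.2.2 d3.hasDerivAt).deriv
    simp only [Function.comp_def] at e1 e2 e3
    rw [e1, e2, e3]
    have := h1 h0
    linear_combination (deriv β (g z.1 z.2.1 z.2.2)) * this

/-- The test function `θ(t) p(x - ct) r(v)`. -/
def testFn (c : ℝ) (θ p r : ℝ → ℝ) (t : ℝ) (z : ℝ × ℝ) : ℝ := θ t * p (z.1 - c * t) * r z.2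

/-- The derivative of `θ(t) p(x - ct) r(v)` along the flow of `∂ₜ + v ∂ₓ - F ∂ᵥ`. -/
def testFlow (F : ℝ → ℝ → ℝ) (c : ℝ) (θ p r : ℝ → ℝ) (t : ℝ) (z : ℝ × ℝ) : ℝ :=
  deriv θ t * p (z.1 - c * t) * r z.2 + θ t * ((z.2 - c) * deriv p (z.1 - c * t) * r z.2)
    - θ t * (F t z.1 * p (z.1 - c * t) * deriv r z.2)

/-- The weak formulation of the transport equation between the times `a` and `b`. -/
def WeakOn (F : ℝ → ℝ → ℝ) (g : ℝ → ℝ → ℝ → ℝ) (c : ℝ) (θ p r : ℝ → ℝ) (a b : ℝ) : Prop :=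
  ∫ z, g b z.1 z.2 * testFn c θ p r b z ∂phaseMeasure
    - ∫ z, g a z.1 z.2 * testFn c θ p r a z ∂phaseMeasure
    = ∫ τ in a..b, ∫ z, g τ z.1 z.2 * testFlow F c θ p r τ z ∂phaseMeasure

/-- Fubini reduces the claim to integration by parts on each line, which holds because Lipschitz
functions are absolutely continuous. -/
theorem integral_prod_deriv_mul_eq {Y : Type*} [MeasurableSpace Y] (ν : Measure Y) [SFinite ν]
    {G P P' : Y → ℝ → ℝ} {a b : ℝ} (hab : a ≤ b) {K : ℝ≥0} (hG : ∀ y, LipschitzWith K (G y))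
    (hP' : ∀ y, Continuous (P' y)) (hP : ∀ y s, HasDerivAt (P y) (P' y s) s)
    (hint : Integrable (fun z : Y × ℝ => deriv (G z.1) z.2 * P z.1 z.2 + G z.1 z.2 * P' z.1 z.2)
      (ν.prod (volume.restrict (Ioc a b)))) :
    ∫ z : Y × ℝ, (deriv (G z.1) z.2 * P z.1 z.2 + G z.1 z.2 * P' z.1 z.2)
      ∂(ν.prod (volume.restrict (Ioc a b))) = ∫ y, (G y b * P y b - G y a * P y a) ∂ν := by
  rw [integral_prod _ hint]
  congr 1
  ext y
  rw [← intervalIntegral.integral_of_le hab]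
  have hd : deriv (P y) = P' y := funext fun s => (hP y s).deriv
  have h1 : AbsolutelyContinuousOnInterval (G y) a b :=
    ((hG y).lipschitzOnWith (s := uIcc a b)).absolutelyContinuousOnInterval
  have h2 : AbsolutelyContinuousOnInterval (P y) a b := by
    refine ContDiffOn.absolutelyContinuousOnInterval (ContDiff.contDiffOn ?_)
    exact contDiff_one_iff_deriv.2 ⟨fun s => (hP y s).differentiableAt, hd ▸ hP' y⟩
  rw [← h1.integral_deriv_mul_eq_sub h2, hd]

theorem integrable_of_continuous_restrict_Ioc {f : ℝ → ℝ} (hf : Continuous f) (a b : ℝ) :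
    Integrable f (volume.restrict (Ioc a b)) :=
  (hf.integrableOn_Icc (a := a) (b := b)).mono_set Ioc_subset_Icc_self

theorem integrable_of_continuous_prod_restrict {f : ℝ × ℝ → ℝ} (hf : Continuous f)
    (a b a' b' : ℝ) :
    Integrable f ((volume.restrict (Ioc a b)).prod (volume.restrict (Ioc a' b'))) := by
  rw [Measure.prod_restrict]
  exact (hf.continuousOn.integrableOn_compact (isCompact_Icc.prod isCompact_Icc)).mono_set
    (prod_mono Ioc_subset_Icc_self Ioc_subset_Icc_self)

theorem integrable_of_continuous_prod_prod_restrict {f : ℝ × ℝ × ℝ → ℝ} (hf : Continuous f)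
    (a b a' b' a'' b'' : ℝ) :
    Integrable f ((volume.restrict (Ioc a b)).prod
      ((volume.restrict (Ioc a' b')).prod (volume.restrict (Ioc a'' b'')))) := by
  rw [Measure.prod_restrict, Measure.prod_restrict]
  exact (hf.continuousOn.integrableOn_compact
    (isCompact_Icc.prod (isCompact_Icc.prod isCompact_Icc))).mono_set
    (prod_mono Ioc_subset_Icc_self (prod_mono Ioc_subset_Icc_self Ioc_subset_Icc_self))

theorem setIntegral_phase_eq {h : ℝ × ℝ → ℝ} {R : ℝ} (hh : ∀ z, R ≤ |z.2| → h z = 0) :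
    ∫ z, h z ∂((volume.restrict (Ioc (0 : ℝ) 1)).prod (volume.restrict (Ioc (-R) R)))
      = ∫ z, h z ∂phaseMeasure := by
  have e : (volume.restrict (Ioc (0 : ℝ) 1)).prod (volume.restrict (Ioc (-R) R))
      = phaseMeasure.restrict (univ ×ˢ Ioc (-R) R) := by
    rw [phaseMeasure, ← Measure.prod_restrict, Measure.restrict_univ]
  rw [e]
  refine setIntegral_eq_integral_of_forall_compl_eq_zero fun z hz => hh z ?_
  by_contra hlt
  rw [not_le, abs_lt] at hlt
  exact hz ⟨mem_univ _, hlt.1, hlt.2.le⟩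

end VlasovPoisson
end
-- Weak formulation against compactly supported tests
open scoped ENNReal NNReal
noncomputable section
namespace VlasovPoisson

/-- The partial derivative of a continuous function is jointly measurable, and here it is bounded by
the Lipschitz constant; this gives integrability on the box. -/
theorem integral_lipschitz_deriv_time {G : ℝ × ℝ × ℝ → ℝ} {K : ℝ≥0} (hG : LipschitzWith K G)
    {P P' : ℝ × ℝ × ℝ → ℝ} (hPc : Continuous P) (hPc' : Continuous P')
    (hP : ∀ z : ℝ × ℝ × ℝ, HasDerivAt (fun s => P (s, z.2)) (P' z) z.1)
    {a b a' b' a'' b'' : ℝ} (hab : a ≤ b) :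
    Integrable (fun z : ℝ × ℝ × ℝ => deriv (fun s => G (s, z.2)) z.1 * P z + G z * P' z)
      ((volume.restrict (Ioc a b)).prod
        ((volume.restrict (Ioc a' b')).prod (volume.restrict (Ioc a'' b'')))) ∧
    ∫ z : ℝ × ℝ × ℝ, (deriv (fun s => G (s, z.2)) z.1 * P z + G z * P' z)
      ∂((volume.restrict (Ioc a b)).prod
        ((volume.restrict (Ioc a' b')).prod (volume.restrict (Ioc a'' b''))))
      = ∫ y : ℝ × ℝ, (G (b, y) * P (b, y) - G (a, y) * P (a, y))
        ∂((volume.restrict (Ioc a' b')).prod (volume.restrict (Ioc a'' b''))) := by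
  have hGy : ∀ y : ℝ × ℝ, LipschitzWith K (fun s => G (s, y)) := fun y => by
    have := hG.comp (LipschitzWith.prodMk_right (α := ℝ) y)
    simpa [Function.comp_def] using this
  have hm : Measurable (fun z : ℝ × ℝ × ℝ => deriv (fun s => G (s, z.2)) z.1) := by
    have h1 : Measurable (fun p : (ℝ × ℝ) × ℝ => deriv (fun s => G (s, p.1)) p.2) :=
      measurable_deriv_with_param (f := fun (y : ℝ × ℝ) s => G (s, y))
        (hG.continuous.comp (by fun_prop))
    exact h1.comp measurable_swap
  have hint : Integrable (fun z : ℝ × ℝ × ℝ => deriv (fun s => G (s, z.2)) z.1 * P z + G z * P' z)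
      ((volume.restrict (Ioc a b)).prod
        ((volume.restrict (Ioc a' b')).prod (volume.restrict (Ioc a'' b'')))) := by
    refine Integrable.add ?_ (integrable_of_continuous_prod_prod_restrict
      (hG.continuous.mul hPc') _ _ _ _ _ _)
    refine (integrable_of_continuous_prod_prod_restrict hPc _ _ _ _ _ _).bdd_mul (c := K)
      hm.aestronglyMeasurable (Eventually.of_forall fun z => ?_)
    exact norm_deriv_le_of_lipschitz (hGy z.2)
  refine ⟨hint, ?_⟩
  rw [← integral_prod_swap]
  refine integral_prod_deriv_mul_eq _ (G := fun y s => G (s, y)) (P := fun y s => P (s, y))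
    (P' := fun y s => P' (s, y)) hab hGy (fun y => by fun_prop) (fun y s => hP (s, y)) ?_
  exact hint.swap

theorem integral_lipschitz_deriv_space {G : ℝ × ℝ → ℝ} {K : ℝ≥0} (hG : LipschitzWith K G)
    {P P' : ℝ × ℝ → ℝ} (hPc' : Continuous P')
    (hP : ∀ z : ℝ × ℝ, HasDerivAt (fun s => P (s, z.2)) (P' z) z.1)
    {a b a' b' : ℝ} (hab : a ≤ b)
    (hint : Integrable (fun z : ℝ × ℝ => deriv (fun s => G (s, z.2)) z.1 * P z + G z * P' z)
      ((volume.restrict (Ioc a b)).prod (volume.restrict (Ioc a' b')))) :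
    ∫ z : ℝ × ℝ, (deriv (fun s => G (s, z.2)) z.1 * P z + G z * P' z)
      ∂((volume.restrict (Ioc a b)).prod (volume.restrict (Ioc a' b')))
      = ∫ y in Ioc a' b', (G (b, y) * P (b, y) - G (a, y) * P (a, y)) := by
  have hGy : ∀ y : ℝ, LipschitzWith K (fun s => G (s, y)) := fun y => by
    have := hG.comp (LipschitzWith.prodMk_right (α := ℝ) y)
    simpa [Function.comp_def] using this
  rw [← integral_prod_swap]
  exact integral_prod_deriv_mul_eq _ (G := fun y s => G (s, y)) (P := fun y s => P (s, y))
    (P' := fun y s => P' (s, y)) hab hGy (fun y => by fun_prop) (fun y s => hP (s, y)) hint.swap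

theorem integral_lipschitz_deriv_velocity {G : ℝ × ℝ → ℝ} {K : ℝ≥0} (hG : LipschitzWith K G)
    {P P' : ℝ × ℝ → ℝ} (hPc' : Continuous P')
    (hP : ∀ z : ℝ × ℝ, HasDerivAt (fun s => P (z.1, s)) (P' z) z.2)
    {a b a' b' : ℝ} (hab : a' ≤ b')
    (hint : Integrable (fun z : ℝ × ℝ => deriv (fun s => G (z.1, s)) z.2 * P z + G z * P' z)
      ((volume.restrict (Ioc a b)).prod (volume.restrict (Ioc a' b')))) :
    ∫ z : ℝ × ℝ, (deriv (fun s => G (z.1, s)) z.2 * P z + G z * P' z)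
      ∂((volume.restrict (Ioc a b)).prod (volume.restrict (Ioc a' b')))
      = ∫ y in Ioc a b, (G (y, b') * P (y, b') - G (y, a') * P (y, a')) := by
  have hGy : ∀ y : ℝ, LipschitzWith K (fun s => G (y, s)) := fun y => by
    have := hG.comp (LipschitzWith.prodMk_left (β := ℝ) y)
    simpa [Function.comp_def] using this
  exact integral_prod_deriv_mul_eq _ (G := fun y s => G (y, s)) (P := fun y s => P (y, s))
    (P' := fun y s => P' (y, s)) hab hGy (fun y => by fun_prop) (fun y s => hP (y, s)) hint

/-- The weak formulation against compactly supported test functions. -/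
theorem IsTransported.weakOn {F : ℝ → ℝ → ℝ} {g : ℝ → ℝ → ℝ → ℝ} (hg : IsTransported F g)
    (hF : Continuous fun z : ℝ × ℝ => F z.1 z.2) {c : ℝ} {θ p r : ℝ → ℝ} (hθ : ContDiff ℝ 1 θ)
    (hp : ContDiff ℝ 1 p) (hpp : Function.Periodic p 1) (hr : ContDiff ℝ 1 r)
    (hrc : HasCompactSupport r) {a b : ℝ} (ha : 0 < a) (hab : a ≤ b) :
    WeakOn F g c θ p r a b := by
  obtain ⟨R, hR1, hR⟩ : ∃ R : ℝ, 1 ≤ R ∧ ∀ v, R ≤ |v| → r v = 0 ∧ deriv r v = 0 := by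
    obtain ⟨R, hR⟩ := hrc.isCompact.isBounded.subset_ball (0 : ℝ)
    have h0 : ∀ v, max R 1 ≤ |v| → v ∉ tsupport r := fun v hv hv' => by
      have := hR hv'
      rw [mem_ball_zero_iff, Real.norm_eq_abs] at this
      exact absurd (le_trans (le_max_left _ _) hv) (not_le.2 this)
    refine ⟨max R 1, le_max_right _ _, fun v hv => ⟨image_eq_zero_of_notMem_tsupport (h0 v hv), ?_⟩⟩
    by_contra hne
    exact h0 v hv (support_deriv_subset hne)
  -- The box exceeds the region of integration on every side, so g and G agree near each of its
  -- points and have the same derivatives there.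
  obtain ⟨K, G, hG, hE⟩ := exists_lipschitz_extension hg.locallyLipschitz
    (half_pos ha) (b + 1) (R + 1)
  have hθc := hθ.continuous
  have hpc := hp.continuous
  have hrc' := hr.continuous
  have hθd : Continuous (deriv θ) := hθ.continuous_deriv le_rfl
  have hpd : Continuous (deriv p) := hp.continuous_deriv le_rfl
  have hrd : Continuous (deriv r) := hr.continuous_deriv le_rfl
  have Hθ : ∀ s, HasDerivAt θ (deriv θ s) s := fun s =>
    (hθ.differentiable (by norm_num) s).hasDerivAt
  have Hp : ∀ s, HasDerivAt p (deriv p s) s := fun s =>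
    (hp.differentiable (by norm_num) s).hasDerivAt
  have Hr : ∀ s, HasDerivAt r (deriv r s) s := fun s =>
    (hr.differentiable (by norm_num) s).hasDerivAt
  have hFz : Continuous fun z : ℝ × ℝ × ℝ => F z.1 z.2.1 :=
    hF.comp (f := fun z : ℝ × ℝ × ℝ => (z.1, z.2.1)) (by fun_prop)
  set Px : Measure (ℝ × ℝ) := (volume.restrict (Ioc (0 : ℝ) 1)).prod (volume.restrict (Ioc (-R) R))
    with hPx
  set B : Measure (ℝ × ℝ × ℝ) := (volume.restrict (Ioc a b)).prod Px with hB
  have hBbox : B = volume.restrict (Ioc a b ×ˢ Ioc (0 : ℝ) 1 ×ˢ Ioc (-R) R) := by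
    rw [hB, hPx, Measure.prod_restrict, Measure.prod_restrict]; rfl
  have hG2 : ∀ y : ℝ × ℝ, LipschitzWith K (fun s => G (y.1, s, y.2)) := fun y => by
    have h1 := (LipschitzWith.prodMk_left (β := ℝ × ℝ) y.1).comp
      (LipschitzWith.prodMk_right (α := ℝ) y.2)
    simpa [Function.comp_def] using hG.comp h1
  have hG3 : ∀ y : ℝ × ℝ, LipschitzWith K (fun s => G (y.1, y.2, s)) := fun y => by
    have h1 := (LipschitzWith.prodMk_left (β := ℝ × ℝ) y.1).comp
      (LipschitzWith.prodMk_left (β := ℝ) y.2)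
    simpa [Function.comp_def] using hG.comp h1
  have hm2 : Measurable (fun z : ℝ × ℝ × ℝ => deriv (fun s => G (z.1, s, z.2.2)) z.2.1) := by
    have h1 : Measurable (fun p : (ℝ × ℝ) × ℝ => deriv (fun s => G (p.1.1, s, p.1.2)) p.2) :=
      measurable_deriv_with_param (f := fun (y : ℝ × ℝ) s => G (y.1, s, y.2))
        (hG.continuous.comp (by fun_prop))
    exact h1.comp (g := fun p : (ℝ × ℝ) × ℝ => deriv (fun s => G (p.1.1, s, p.1.2)) p.2)
      (f := fun z : ℝ × ℝ × ℝ => ((z.1, z.2.2), z.2.1)) (by fun_prop)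
  have hm3 : Measurable (fun z : ℝ × ℝ × ℝ => deriv (fun s => G (z.1, z.2.1, s)) z.2.2) := by
    have h1 : Measurable (fun p : (ℝ × ℝ) × ℝ => deriv (fun s => G (p.1.1, p.1.2, s)) p.2) :=
      measurable_deriv_with_param (f := fun (y : ℝ × ℝ) s => G (y.1, y.2, s))
        (hG.continuous.comp (by fun_prop))
    exact h1.comp (g := fun p : (ℝ × ℝ) × ℝ => deriv (fun s => G (p.1.1, p.1.2, s)) p.2)
      (f := fun z : ℝ × ℝ × ℝ => ((z.1, z.2.1), z.2.2)) (by fun_prop)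
  -- time derivative
  have I1 := integral_lipschitz_deriv_time hG
    (P := fun z => θ z.1 * p (z.2.1 - c * z.1) * r z.2.2)
    (P' := fun z => deriv θ z.1 * p (z.2.1 - c * z.1) * r z.2.2
      - θ z.1 * (c * deriv p (z.2.1 - c * z.1) * r z.2.2)) (by fun_prop) (by fun_prop)
    (fun z => by
      have e1 : HasDerivAt (fun s : ℝ => z.2.1 - c * s) (-c) z.1 := by
        simpa using ((hasDerivAt_id z.1).const_mul c).const_sub z.2.1
      have e2 := (((Hθ z.1).mul ((Hp _).comp z.1 e1)).mul_const (r z.2.2))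
      refine e2.congr_deriv ?_
      simp only [Function.comp_apply]
      ring)
    (a' := 0) (b' := 1) (a'' := -R) (b'' := R) hab
  -- space derivative
  have hi2 : Integrable (fun z : ℝ × ℝ × ℝ => deriv (fun s => G (z.1, s, z.2.2)) z.2.1 *
      (θ z.1 * p (z.2.1 - c * z.1) * (z.2.2 * r z.2.2))
      + G z * (θ z.1 * deriv p (z.2.1 - c * z.1) * (z.2.2 * r z.2.2))) B := by
    refine Integrable.add ?_ (integrable_of_continuous_prod_prod_restrict
      (hG.continuous.mul (by fun_prop)) _ _ _ _ _ _)
    refine (integrable_of_continuous_prod_prod_restrict (by fun_prop) _ _ _ _ _ _).bdd_mul (c := K)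
      hm2.aestronglyMeasurable (Eventually.of_forall fun z => ?_)
    exact norm_deriv_le_of_lipschitz (hG2 (z.1, z.2.2))
  have I2 : ∫ z : ℝ × ℝ × ℝ, (deriv (fun s => G (z.1, s, z.2.2)) z.2.1 *
      (θ z.1 * p (z.2.1 - c * z.1) * (z.2.2 * r z.2.2))
      + G z * (θ z.1 * deriv p (z.2.1 - c * z.1) * (z.2.2 * r z.2.2))) ∂B = 0 := by
    have hsl := hi2.prod_right_ae
    rw [hB, integral_prod _ hi2]
    refine integral_eq_zero_of_ae ?_
    filter_upwards [hsl, ae_restrict_mem measurableSet_Ioc] with t ht htab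
    have hGt : LipschitzWith K (fun z : ℝ × ℝ => G (t, z)) := by
      simpa [Function.comp_def] using hG.comp (LipschitzWith.prodMk_left (β := ℝ × ℝ) t)
    rw [integral_lipschitz_deriv_space hGt
      (P := fun z => θ t * p (z.1 - c * t) * (z.2 * r z.2))
      (P' := fun z => θ t * deriv p (z.1 - c * t) * (z.2 * r z.2)) (by fun_prop)
      (fun z => by
        have e1 : HasDerivAt (fun s : ℝ => s - c * t) 1 z.1 := (hasDerivAt_id z.1).sub_const _
        have e2 := ((((Hp _).comp z.1 e1).const_mul (θ t)).mul_const (z.2 * r z.2))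
        refine e2.congr_deriv ?_
        ring) zero_le_one ht]
    -- The boundary terms at x = 0 and x = 1 cancel, both the solution and p being 1-periodic.
    refine setIntegral_eq_zero_of_forall_eq_zero fun v hv => ?_
    have hbox : ∀ x ∈ Icc (0 : ℝ) 1, G (t, x, v) = g t x v := fun x hx => by
      refine (hE ⟨⟨?_, ?_⟩, ⟨?_, ?_⟩, ⟨?_, ?_⟩⟩).symm <;> dsimp only <;>
        linarith [hx.1, hx.2, hv.1, hv.2, htab.1, htab.2]
    rw [hbox 1 (by simp), hbox 0 (by simp)]
    have e1 := hg.periodic t (ha.trans htab.1) v 0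
    have e2 := hpp (0 - c * t)
    simp only [zero_add] at e1
    rw [show (0 : ℝ) - c * t + 1 = 1 - c * t by ring] at e2
    rw [e1, e2, sub_self]
  -- velocity derivative
  have hi3 : Integrable (fun z : ℝ × ℝ × ℝ => deriv (fun s => G (z.1, z.2.1, s)) z.2.2 *
      (θ z.1 * (F z.1 z.2.1 * p (z.2.1 - c * z.1)) * r z.2.2)
      + G z * (θ z.1 * (F z.1 z.2.1 * p (z.2.1 - c * z.1)) * deriv r z.2.2)) B := by
    refine Integrable.add ?_ (integrable_of_continuous_prod_prod_restrict
      (hG.continuous.mul (by fun_prop)) _ _ _ _ _ _)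
    refine (integrable_of_continuous_prod_prod_restrict (by fun_prop) _ _ _ _ _ _).bdd_mul (c := K)
      hm3.aestronglyMeasurable (Eventually.of_forall fun z => ?_)
    exact norm_deriv_le_of_lipschitz (hG3 (z.1, z.2.1))
  have I3 : ∫ z : ℝ × ℝ × ℝ, (deriv (fun s => G (z.1, z.2.1, s)) z.2.2 *
      (θ z.1 * (F z.1 z.2.1 * p (z.2.1 - c * z.1)) * r z.2.2)
      + G z * (θ z.1 * (F z.1 z.2.1 * p (z.2.1 - c * z.1)) * deriv r z.2.2)) ∂B = 0 := by
    have hsl := hi3.prod_right_ae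
    rw [hB, integral_prod _ hi3]
    refine integral_eq_zero_of_ae ?_
    filter_upwards [hsl] with t ht
    have hGt : LipschitzWith K (fun z : ℝ × ℝ => G (t, z)) := by
      simpa [Function.comp_def] using hG.comp (LipschitzWith.prodMk_left (β := ℝ × ℝ) t)
    have hFt : Continuous fun z : ℝ × ℝ => F t z.1 :=
      hF.comp (f := fun z : ℝ × ℝ => (t, z.1)) (by fun_prop)
    rw [integral_lipschitz_deriv_velocity hGt
      (P := fun z => θ t * (F t z.1 * p (z.1 - c * t)) * r z.2)
      (P' := fun z => θ t * (F t z.1 * p (z.1 - c * t)) * deriv r z.2) (by fun_prop)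
      (fun z => (Hr z.2).const_mul (θ t * (F t z.1 * p (z.1 - c * t)))) (by linarith) ht]
    have z1 : r R = 0 := (hR R (le_abs_self R)).1
    have z2 : r (-R) = 0 := (hR (-R) (by rw [abs_neg]; exact le_abs_self R)).1
    simp [z1, z2]
  -- the equation for the extension
  have heq : ∀ᵐ z ∂B, deriv (fun s => G (s, z.2)) z.1
      + z.2.2 * deriv (fun s => G (z.1, s, z.2.2)) z.2.1
      - F z.1 z.2.1 * deriv (fun s => G (z.1, z.2.1, s)) z.2.2 = 0 := by
    rw [hBbox]
    filter_upwards [ae_restrict_of_ae hg.eqn, ae_restrict_mem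
      (measurableSet_Ioc.prod (measurableSet_Ioc.prod measurableSet_Ioc))] with z hz hzB
    obtain ⟨hz1, hz2, hz3⟩ := hzB
    have n1 : ∀ᶠ s in 𝓝 z.1, s ∈ Icc (a / 2) (b + 1) :=
      Icc_mem_nhds (by linarith [hz1.1]) (by linarith [hz1.2])
    have n2 : ∀ᶠ s in 𝓝 z.2.1, s ∈ Icc (-(R + 1)) (R + 1) :=
      Icc_mem_nhds (by linarith [hz2.1]) (by linarith [hz2.2])
    have n3 : ∀ᶠ s in 𝓝 z.2.2, s ∈ Icc (-(R + 1)) (R + 1) :=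
      Icc_mem_nhds (by linarith [hz3.1]) (by linarith [hz3.2])
    have e1 : (fun s => G (s, z.2)) =ᶠ[𝓝 z.1] fun s => g s z.2.1 z.2.2 := by
      filter_upwards [n1] with s hs using (@hE (s, z.2) ⟨hs, n2.self_of_nhds, n3.self_of_nhds⟩).symm
    have e2 : (fun s => G (z.1, s, z.2.2)) =ᶠ[𝓝 z.2.1] fun s => g z.1 s z.2.2 := by
      filter_upwards [n2] with s hs using (@hE (z.1, s, z.2.2) ⟨n1.self_of_nhds, hs, n3.self_of_nhds⟩).symm
    have e3 : (fun s => G (z.1, z.2.1, s)) =ᶠ[𝓝 z.2.2] fun s => g z.1 z.2.1 s := by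
      filter_upwards [n3] with s hs using (@hE (z.1, z.2.1, s) ⟨n1.self_of_nhds, n2.self_of_nhds, hs⟩).symm
    rw [e1.deriv_eq, e2.deriv_eq, e3.deriv_eq]
    exact hz (ha.trans hz1.1)
  have hGflow : Integrable (fun z : ℝ × ℝ × ℝ => G z * testFlow F c θ p r z.1 z.2) B := by
    refine integrable_of_continuous_prod_prod_restrict (hG.continuous.mul ?_) _ _ _ _ _ _
    unfold testFlow
    fun_prop
  have key : ∫ z, G z * testFlow F c θ p r z.1 z.2 ∂B
      = ∫ y, (G (b, y) * testFn c θ p r b y - G (a, y) * testFn c θ p r a y) ∂Px := by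
    -- Adding the time and space identities and subtracting the velocity one, the derivatives of G
    -- combine into the equation, and what is left is G times the flow derivative of the test
    -- function.
    have e := I1.2
    have e' := integral_sub (I1.1.add hi2) hi3
    simp only [Pi.add_apply] at e'
    rw [integral_add I1.1 hi2, I1.2, I2, I3, add_zero, sub_zero] at e'
    rw [← hPx] at e'
    simp only [testFn]
    rw [← e']
    refine integral_congr_ae ?_
    filter_upwards [heq] with z hz
    simp only [testFlow]
    linear_combination (-(θ z.1 * p (z.2.1 - c * z.1) * r z.2.2)) * hz
  have hGt : ∀ t ∈ Icc a b, ∀ k : ℝ × ℝ → ℝ, (∀ z, R ≤ |z.2| → k z = 0) →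
      ∫ z, G (t, z) * k z ∂Px = ∫ z, g t z.1 z.2 * k z ∂phaseMeasure := by
    intro t ht k hk
    rw [← setIntegral_phase_eq (R := R) (h := fun z => g t z.1 z.2 * k z)
      (fun z hz => by rw [hk z hz, mul_zero]), ← hPx]
    refine integral_congr_ae ?_
    rw [hPx, Measure.prod_restrict]
    filter_upwards [ae_restrict_mem (measurableSet_Ioc.prod measurableSet_Ioc)] with z hz
    have : G (t, z) = g t z.1 z.2 := by
      refine (hE ⟨⟨?_, ?_⟩, ⟨?_, ?_⟩, ⟨?_, ?_⟩⟩).symm <;> dsimp only <;>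
        linarith [hz.1.1, hz.1.2, hz.2.1, hz.2.2, ht.1, ht.2]
    rw [this]
  have htest : ∀ t z, R ≤ |(z : ℝ × ℝ).2| → testFn c θ p r t z = 0 := fun t z hz => by
    simp [testFn, (hR _ hz).1]
  have hflow : ∀ t z, R ≤ |(z : ℝ × ℝ).2| → testFlow F c θ p r t z = 0 := fun t z hz => by
    simp [testFlow, (hR _ hz).1, (hR _ hz).2]
  have hbd : ∀ t, Integrable (fun z => G (t, z) * testFn c θ p r t z) Px := fun t => by
    refine integrable_of_continuous_prod_restrict ((hG.continuous.comp (by fun_prop)).mul ?_) _ _ _ _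
    unfold testFn
    fun_prop
  rw [WeakOn, ← hGt b ⟨hab, le_rfl⟩ _ (htest b), ← hGt a ⟨le_rfl, hab⟩ _ (htest a),
    ← integral_sub (hbd b) (hbd a), ← key, hB, integral_prod _ hGflow,
    intervalIntegral.integral_of_le hab]
  refine setIntegral_congr_fun measurableSet_Ioc fun t ht => ?_
  exact hGt t ⟨ht.1.le, ht.2⟩ _ (hflow t)

end VlasovPoisson
end
-- Limits in the weak formulation and removal of compact support
open scoped ENNReal NNReal
noncomputable section
namespace VlasovPoisson

instance : SFinite phaseMeasure := by unfold phaseMeasure; infer_instance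

theorem testFn_continuous {c : ℝ} {θ p r : ℝ → ℝ} (hp : ContDiff ℝ 1 p) (hr : ContDiff ℝ 1 r)
    (t : ℝ) : Continuous (testFn c θ p r t) := by
  have := hp.continuous
  have := hr.continuous
  unfold testFn
  fun_prop

theorem testFlow_continuous_uncurry {F : ℝ → ℝ → ℝ} (hF : Continuous fun z : ℝ × ℝ => F z.1 z.2)
    {c : ℝ} {θ p r : ℝ → ℝ} (hθ : ContDiff ℝ 1 θ) (hp : ContDiff ℝ 1 p) (hr : ContDiff ℝ 1 r) :
    Continuous fun z : ℝ × ℝ × ℝ => testFlow F c θ p r z.1 z.2 := by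
  have := hθ.continuous
  have := hp.continuous
  have := hr.continuous
  have : Continuous (deriv θ) := hθ.continuous_deriv le_rfl
  have : Continuous (deriv p) := hp.continuous_deriv le_rfl
  have : Continuous (deriv r) := hr.continuous_deriv le_rfl
  have hFz : Continuous fun z : ℝ × ℝ × ℝ => F z.1 z.2.1 :=
    hF.comp (f := fun z : ℝ × ℝ × ℝ => (z.1, z.2.1)) (by fun_prop)
  unfold testFlow
  fun_prop

theorem testFlow_continuous {F : ℝ → ℝ → ℝ} (hF : Continuous fun z : ℝ × ℝ => F z.1 z.2)
    {c : ℝ} {θ p r : ℝ → ℝ} (hθ : ContDiff ℝ 1 θ) (hp : ContDiff ℝ 1 p) (hr : ContDiff ℝ 1 r)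
    (t : ℝ) : Continuous (testFlow F c θ p r t) :=
  (testFlow_continuous_uncurry hF hθ hp hr).comp (Continuous.prodMk_right t)

/-- Dominated convergence twice: in phase space at each fixed time, then in time with the constant
B. The cutoff in v uses the freedom in `r'`, the approximation of Q(f) the freedom in `g'`. -/
theorem weakOn_of_tendsto {F : ℝ → ℝ → ℝ} (hF : Continuous fun z : ℝ × ℝ => F z.1 z.2)
    {g' : ℕ → ℝ → ℝ → ℝ → ℝ} {g : ℝ → ℝ → ℝ → ℝ} {c : ℝ} {θ p : ℝ → ℝ} {r' : ℕ → ℝ → ℝ}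
    {r : ℝ → ℝ} {a b B : ℝ} {D : ℝ → ℝ × ℝ → ℝ} (hab : a ≤ b) (hθ : ContDiff ℝ 1 θ)
    (hp : ContDiff ℝ 1 p) (hr : ∀ n, ContDiff ℝ 1 (r' n))
    (hW : ∀ n, WeakOn F (g' n) c θ p (r' n) a b)
    (hm : ∀ n, AEStronglyMeasurable (fun τ => ∫ z, g' n τ z.1 z.2 * testFlow F c θ p (r' n) τ z
      ∂phaseMeasure) (volume.restrict (Ioc a b)))
    (hs : ∀ n, ∀ τ ∈ Icc a b, AEStronglyMeasurable (fun z : ℝ × ℝ => g' n τ z.1 z.2) phaseMeasure)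
    (hD : ∀ τ ∈ Icc a b, Integrable (D τ) phaseMeasure)
    (hB : ∀ τ ∈ Icc a b, ∫ z, D τ z ∂phaseMeasure ≤ B)
    (b1 : ∀ n, ∀ τ ∈ Icc a b, ∀ z : ℝ × ℝ, |g' n τ z.1 z.2 * testFn c θ p (r' n) τ z| ≤ D τ z)
    (b2 : ∀ n, ∀ τ ∈ Icc a b, ∀ z : ℝ × ℝ, |g' n τ z.1 z.2 * testFlow F c θ p (r' n) τ z| ≤ D τ z)
    (l1 : ∀ τ ∈ Icc a b, ∀ z : ℝ × ℝ, Tendsto (fun n => g' n τ z.1 z.2 * testFn c θ p (r' n) τ z)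
      atTop (𝓝 (g τ z.1 z.2 * testFn c θ p r τ z)))
    (l2 : ∀ τ ∈ Icc a b, ∀ z : ℝ × ℝ, Tendsto (fun n => g' n τ z.1 z.2 *
      testFlow F c θ p (r' n) τ z) atTop (𝓝 (g τ z.1 z.2 * testFlow F c θ p r τ z))) :
    WeakOn F g c θ p r a b := by
  have t1 : ∀ τ ∈ Icc a b, Tendsto (fun n => ∫ z, g' n τ z.1 z.2 * testFn c θ p (r' n) τ z
      ∂phaseMeasure) atTop (𝓝 (∫ z, g τ z.1 z.2 * testFn c θ p r τ z ∂phaseMeasure)) := by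
    intro τ hτ
    refine tendsto_integral_of_dominated_convergence (D τ) (fun n => ?_) (hD τ hτ)
      (fun n => Eventually.of_forall fun z => b1 n τ hτ z) (Eventually.of_forall fun z => l1 τ hτ z)
    exact (hs n τ hτ).mul (testFn_continuous hp (hr n) τ).aestronglyMeasurable
  have t2 : ∀ τ ∈ Icc a b, Tendsto (fun n => ∫ z, g' n τ z.1 z.2 * testFlow F c θ p (r' n) τ z
      ∂phaseMeasure) atTop (𝓝 (∫ z, g τ z.1 z.2 * testFlow F c θ p r τ z ∂phaseMeasure)) := by
    intro τ hτ
    refine tendsto_integral_of_dominated_convergence (D τ) (fun n => ?_) (hD τ hτ)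
      (fun n => Eventually.of_forall fun z => b2 n τ hτ z) (Eventually.of_forall fun z => l2 τ hτ z)
    exact (hs n τ hτ).mul (testFlow_continuous hF hθ hp (hr n) τ).aestronglyMeasurable
  have t3 : Tendsto (fun n => ∫ τ in a..b, ∫ z, g' n τ z.1 z.2 * testFlow F c θ p (r' n) τ z
      ∂phaseMeasure) atTop
      (𝓝 (∫ τ in a..b, ∫ z, g τ z.1 z.2 * testFlow F c θ p r τ z ∂phaseMeasure)) := by
    refine intervalIntegral.tendsto_integral_filter_of_dominated_convergence (fun _ => B)
      (Eventually.of_forall fun n => ?_) (Eventually.of_forall fun n => ?_)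
      intervalIntegrable_const (Eventually.of_forall fun τ hτ => ?_)
    · rw [uIoc_of_le hab]; exact hm n
    · refine Eventually.of_forall fun τ hτ => ?_
      rw [uIoc_of_le hab] at hτ
      have hτ' := Ioc_subset_Icc_self hτ
      refine (norm_integral_le_integral_norm _).trans ((integral_mono_of_nonneg
        (Eventually.of_forall fun z => norm_nonneg _) (hD τ hτ')
        (Eventually.of_forall fun z => b2 n τ hτ' z)).trans (hB τ hτ'))
    · rw [uIoc_of_le hab] at hτ
      exact t2 τ (Ioc_subset_Icc_self hτ)
  refine tendsto_nhds_unique ((t1 b ⟨hab, le_rfl⟩).sub (t1 a ⟨le_rfl, hab⟩)) ?_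
  refine t3.congr fun n => (hW n).symm

theorem measurable_indicator_of_continuousOn {g : ℝ → ℝ → ℝ → ℝ}
    (hg : ContinuousOn (fun z : ℝ × ℝ × ℝ => g z.1 z.2.1 z.2.2)
      (Ioi (0 : ℝ) ×ˢ (univ : Set (ℝ × ℝ)))) :
    Measurable ((Ioi (0 : ℝ) ×ˢ (univ : Set (ℝ × ℝ))).indicator
      fun z : ℝ × ℝ × ℝ => g z.1 z.2.1 z.2.2) := by
  have hms : MeasurableSet (Ioi (0 : ℝ) ×ˢ (univ : Set (ℝ × ℝ))) :=
    measurableSet_Ioi.prod MeasurableSet.univ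
  classical
  rw [← piecewise_eq_indicator]
  exact hg.measurable_piecewise continuousOn_const hms

/-- Joint measurability of g is known only at positive times, where g is continuous. Extending by 0
makes the integrand measurable and changes nothing on (a, b]. -/
theorem aestronglyMeasurable_integral_mul {g : ℝ → ℝ → ℝ → ℝ}
    (hg : ContinuousOn (fun z : ℝ × ℝ × ℝ => g z.1 z.2.1 z.2.2)
      (Ioi (0 : ℝ) ×ˢ (univ : Set (ℝ × ℝ)))) {Ψ : ℝ → ℝ × ℝ → ℝ}
    (hΨ : Continuous fun z : ℝ × ℝ × ℝ => Ψ z.1 z.2) {a b : ℝ} (ha : 0 ≤ a) :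
    AEStronglyMeasurable (fun τ => ∫ z, g τ z.1 z.2 * Ψ τ z ∂phaseMeasure)
      (volume.restrict (Ioc a b)) := by
  have h1 : StronglyMeasurable (fun z : ℝ × ℝ × ℝ => (Ioi (0 : ℝ) ×ˢ (univ : Set (ℝ × ℝ))).indicator
      (fun z : ℝ × ℝ × ℝ => g z.1 z.2.1 z.2.2) z * Ψ z.1 z.2) :=
    ((measurable_indicator_of_continuousOn hg).mul hΨ.measurable).stronglyMeasurable
  refine (h1.integral_prod_right' (ν := phaseMeasure)).aestronglyMeasurable.congr ?_
  filter_upwards [ae_restrict_mem measurableSet_Ioc] with τ hτ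
  have h0 : 0 < τ := ha.trans_lt hτ.1
  simp [indicator, h0]

theorem continuous_slice_of_continuousOn {g : ℝ → ℝ → ℝ → ℝ}
    (hg : ContinuousOn (fun z : ℝ × ℝ × ℝ => g z.1 z.2.1 z.2.2)
      (Ioi (0 : ℝ) ×ˢ (univ : Set (ℝ × ℝ)))) {t : ℝ} (ht : 0 < t) :
    Continuous fun z : ℝ × ℝ => g t z.1 z.2 := by
  refine ContinuousOn.comp_continuous (f := fun z : ℝ × ℝ => (t, z)) hg (by fun_prop) ?_
  intro z
  exact ⟨ht, mem_univ _⟩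

/-- A smooth cutoff function, equal to `1` on `[-1, 1]`. -/
def cutoff (v : ℝ) : ℝ := Real.smoothTransition (2 - v ^ 2)

theorem cutoff_contDiff : ContDiff ℝ 1 cutoff := by
  unfold cutoff
  exact Real.smoothTransition.contDiff.comp (by fun_prop)

theorem cutoff_hasCompactSupport : HasCompactSupport cutoff := by
  refine HasCompactSupport.intro (isCompact_Icc (a := (-2 : ℝ)) (b := 2)) fun v hv => ?_
  refine Real.smoothTransition.zero_of_nonpos ?_
  rw [mem_Icc, not_and_or, not_le, not_le] at hv
  rcases hv with hv | hv <;> nlinarith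

theorem cutoff_nonneg (v : ℝ) : 0 ≤ cutoff v := Real.smoothTransition.nonneg _

theorem cutoff_le_one (v : ℝ) : cutoff v ≤ 1 := Real.smoothTransition.le_one _

theorem cutoff_eq_one {v : ℝ} (hv : |v| ≤ 1) : cutoff v = 1 := by
  refine Real.smoothTransition.one_of_one_le ?_
  have := (sq_le_one_iff_abs_le_one v).2 hv
  linarith

theorem exists_deriv_cutoff_bound : ∃ C : ℝ, 0 ≤ C ∧ ∀ v, |deriv cutoff v| ≤ C := by
  obtain ⟨C, hC⟩ := cutoff_hasCompactSupport.deriv.exists_bound_of_continuous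
    (cutoff_contDiff.continuous_deriv le_rfl)
  exact ⟨C, (norm_nonneg _).trans (hC 0), hC⟩

/-- The rescaled cutoff functions. -/
def cutoffSeq (n : ℕ) (v : ℝ) : ℝ := cutoff (((n : ℝ) + 1)⁻¹ * v)

theorem cutoffSeq_contDiff (n : ℕ) : ContDiff ℝ 1 (cutoffSeq n) :=
  cutoff_contDiff.comp (contDiff_const.mul contDiff_id)

theorem cutoffSeq_hasCompactSupport (n : ℕ) : HasCompactSupport (cutoffSeq n) := by
  have := cutoff_hasCompactSupport.comp_smul (c := ((n : ℝ) + 1)⁻¹) (by positivity)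
  exact this

theorem deriv_cutoffSeq (n : ℕ) (v : ℝ) :
    deriv (cutoffSeq n) v = ((n : ℝ) + 1)⁻¹ * deriv cutoff (((n : ℝ) + 1)⁻¹ * v) := by
  exact deriv_comp_mul_left (((n : ℝ) + 1)⁻¹) cutoff v

theorem cutoffSeq_eventually_eq_one (v : ℝ) : ∀ᶠ n in atTop, cutoffSeq n v = 1 := by
  obtain ⟨N, hN⟩ := exists_nat_ge |v|
  filter_upwards [eventually_ge_atTop N] with n hn
  refine cutoff_eq_one ?_
  have hn' : (N : ℝ) ≤ n := by exact_mod_cast hn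
  rw [abs_mul, abs_inv, abs_of_pos (by positivity : (0 : ℝ) < n + 1), inv_mul_le_iff₀ (by positivity)]
  linarith

theorem deriv_cutoffSeq_tendsto (v : ℝ) :
    Tendsto (fun n => deriv (cutoffSeq n) v) atTop (𝓝 0) := by
  obtain ⟨C, hC0, hC⟩ := exists_deriv_cutoff_bound
  have h1 : Tendsto (fun n : ℕ => ((n : ℝ) + 1)⁻¹ * C) atTop (𝓝 (0 * C)) :=
    (by simpa using tendsto_one_div_add_atTop_nhds_zero_nat (𝕜 := ℝ) :
      Tendsto (fun n : ℕ => ((n : ℝ) + 1)⁻¹) atTop (𝓝 0)).mul_const C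
  rw [zero_mul] at h1
  refine squeeze_zero_norm (fun n => ?_) h1
  rw [deriv_cutoffSeq, norm_mul, norm_inv, Real.norm_of_nonneg (by positivity : (0 : ℝ) ≤ n + 1)]
  gcongr
  exact hC _

/-- The tests r(v)χ(v/(n+1)) are used and n tends to infinity. Integrability of gω dominates
everything, as the derivatives of the cutoffs are bounded and tend to 0. The transport term is
bounded as a whole, so that constant p, for which it vanishes, costs no power of v. -/
theorem weakOn_of_forall_hasCompactSupport {F : ℝ → ℝ → ℝ}
    (hF : Continuous fun z : ℝ × ℝ => F z.1 z.2) {g : ℝ → ℝ → ℝ → ℝ}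
    (hg : ContinuousOn (fun z : ℝ × ℝ × ℝ => g z.1 z.2.1 z.2.2)
      (Ioi (0 : ℝ) ×ˢ (univ : Set (ℝ × ℝ)))) {c : ℝ} {θ p r ω : ℝ → ℝ} {a b B C : ℝ} (ha : 0 ≤ a)
    (hab : a ≤ b) (hθ : ContDiff ℝ 1 θ) (hp : ContDiff ℝ 1 p) (hr : ContDiff ℝ 1 r)
    (hW : ∀ r', ContDiff ℝ 1 r' → HasCompactSupport r' → WeakOn F g c θ p r' a b)
    (hD : ∀ τ ∈ Icc a b, Integrable (fun z : ℝ × ℝ => g τ z.1 z.2 * ω z.2) phaseMeasure)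
    (hs : ∀ τ ∈ Icc a b, AEStronglyMeasurable (fun z : ℝ × ℝ => g τ z.1 z.2) phaseMeasure)
    (hB : ∀ τ ∈ Icc a b, ∫ z, |g τ z.1 z.2 * ω z.2| ∂phaseMeasure ≤ B)
    (hθ0 : ∀ τ ∈ Icc a b, |θ τ| ≤ C) (hθ1 : ∀ τ ∈ Icc a b, |deriv θ τ| ≤ C)
    (hp0 : ∀ x, |p x| ≤ C) (hF0 : ∀ t x, |F t x| ≤ C)
    (hr0 : ∀ v, |r v| ≤ ω v) (hr1 : ∀ v, |deriv r v| ≤ ω v)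
    (hpr : ∀ x v, |(v - c) * deriv p x * r v| ≤ C * ω v) :
    WeakOn F g c θ p r a b := by
  obtain ⟨K, hK0, hK⟩ := exists_deriv_cutoff_bound
  have hC : 0 ≤ C := (abs_nonneg _).trans (hp0 0)
  have hω : ∀ v, 0 ≤ ω v := fun v => (abs_nonneg _).trans (hr0 v)
  have hdr : ∀ n v, deriv (fun v => r v * cutoffSeq n v) v
      = deriv r v * cutoffSeq n v + r v * deriv (cutoffSeq n) v := fun n v =>
    deriv_fun_mul (hr.differentiable (by norm_num) v)
      ((cutoffSeq_contDiff n).differentiable (by norm_num) v)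
  -- One summand for each term of `testFlow`; the factor 1 + K accounts for both terms in the
  -- derivative of the product of r and the cutoff.
  set M : ℝ := C * C + C * C + C * C * C * (1 + K) with hM
  have hsq : ∀ n v, |cutoffSeq n v| ≤ 1 := fun n v => by
    rw [cutoffSeq, abs_of_nonneg (cutoff_nonneg _)]; exact cutoff_le_one _
  have hsd : ∀ n v, |deriv (cutoffSeq n) v| ≤ K := fun n v => by
    rw [deriv_cutoffSeq, abs_mul]
    have h1 : |((n : ℝ) + 1)⁻¹| ≤ 1 := by
      rw [abs_of_pos (by positivity)]
      exact inv_le_one_of_one_le₀ (by linarith [n.cast_nonneg (α := ℝ)])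
    calc _ ≤ 1 * K := mul_le_mul h1 (hK _) (abs_nonneg _) zero_le_one
      _ = K := one_mul K
  refine weakOn_of_tendsto (g' := fun _ => g) (r' := fun n v => r v * cutoffSeq n v)
    (B := M * B) (D := fun τ z => M * |g τ z.1 z.2 * ω z.2|) hF hab hθ hp
    (fun n => hr.mul (cutoffSeq_contDiff n))
    (fun n => hW _ (hr.mul (cutoffSeq_contDiff n)) (cutoffSeq_hasCompactSupport n).mul_left)
    (fun n => aestronglyMeasurable_integral_mul hg
      (testFlow_continuous_uncurry hF hθ hp (hr.mul (cutoffSeq_contDiff n))) ha)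
    (fun _ => hs) (fun τ hτ => (hD τ hτ).abs.const_mul _) ?_ ?_ ?_ ?_ ?_
  · intro τ hτ
    rw [integral_const_mul]
    exact mul_le_mul_of_nonneg_left (hB τ hτ) (by positivity)
  · intro n τ hτ z
    rw [abs_mul, abs_mul (g τ z.1 z.2), abs_of_nonneg (hω z.2), mul_left_comm]
    refine mul_le_mul_of_nonneg_left ?_ (abs_nonneg _)
    rw [testFn, abs_mul, abs_mul, abs_mul (r z.2)]
    calc |θ τ| * |p (z.1 - c * τ)| * (|r z.2| * |cutoffSeq n z.2|)
        ≤ C * C * (ω z.2 * 1) := by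
          gcongr
          · exact hθ0 τ hτ
          · exact hp0 _
          · exact hω _
          · exact hr0 _
          · exact hsq _ _
      _ ≤ M * ω z.2 := by
          rw [mul_one]
          refine mul_le_mul_of_nonneg_right ?_ (hω _)
          rw [hM]
          have : 0 ≤ C * C * C * (1 + K) := by positivity
          nlinarith [mul_nonneg hC hC]
  · intro n τ hτ z
    rw [abs_mul, abs_mul (g τ z.1 z.2), abs_of_nonneg (hω z.2), mul_left_comm]
    refine mul_le_mul_of_nonneg_left ?_ (abs_nonneg _)
    rw [testFlow, hdr]
    have i1 : |deriv θ τ * p (z.1 - c * τ) * (r z.2 * cutoffSeq n z.2)| ≤ C * C * ω z.2 := by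
      rw [abs_mul, abs_mul, abs_mul]
      calc _ ≤ C * C * (ω z.2 * 1) := by
            gcongr
            · exact hθ1 τ hτ
            · exact hp0 _
            · exact hω _
            · exact hr0 _
            · exact hsq _ _
        _ = _ := by ring
    have i2 : |θ τ * ((z.2 - c) * deriv p (z.1 - c * τ) * (r z.2 * cutoffSeq n z.2))|
        ≤ C * C * ω z.2 := by
      rw [← mul_assoc ((z.2 - c) * deriv p (z.1 - c * τ)), abs_mul, abs_mul _ (cutoffSeq n z.2)]
      calc _ ≤ C * ((C * ω z.2) * 1) := by
            gcongr
            · exact hθ0 τ hτ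
            · exact mul_nonneg hC (hω _)
            · exact hpr _ _
            · exact hsq _ _
        _ = _ := by ring
    have i3 : |θ τ * (F τ z.1 * p (z.1 - c * τ) *
        (deriv r z.2 * cutoffSeq n z.2 + r z.2 * deriv (cutoffSeq n) z.2))|
        ≤ C * C * C * (1 + K) * ω z.2 := by
      rw [abs_mul, abs_mul, abs_mul]
      have i4 : |deriv r z.2 * cutoffSeq n z.2 + r z.2 * deriv (cutoffSeq n) z.2|
          ≤ ω z.2 * 1 + ω z.2 * K := by
        refine (abs_add_le _ _).trans (add_le_add ?_ ?_)
        · rw [abs_mul]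
          exact mul_le_mul (hr1 _) (hsq _ _) (abs_nonneg _) (hω _)
        · rw [abs_mul]
          exact mul_le_mul (hr0 _) (hsd _ _) (abs_nonneg _) (hω _)
      calc _ ≤ C * (C * C * (ω z.2 * 1 + ω z.2 * K)) := by
            gcongr
            · exact hθ0 τ hτ
            · exact hF0 _ _
            · exact hp0 _
        _ = _ := by ring
    refine (abs_sub _ _).trans ((add_le_add ((abs_add_le _ _).trans (add_le_add i1 i2)) i3).trans ?_)
    rw [hM]
    apply le_of_eq
    ring
  · intro τ hτ z
    refine tendsto_const_nhds.congr' ?_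
    filter_upwards [cutoffSeq_eventually_eq_one z.2] with n hn
    simp [testFn, hn]
  · intro τ hτ z
    have h1 : Tendsto (fun n => cutoffSeq n z.2) atTop (𝓝 1) :=
      tendsto_const_nhds.congr' ((cutoffSeq_eventually_eq_one z.2).mono fun n hn => hn.symm)
    have h2 := deriv_cutoffSeq_tendsto z.2
    refine Tendsto.const_mul _ ?_
    simp only [testFlow, hdr]
    have e : ∀ y, Tendsto (fun n => y * (r z.2 * cutoffSeq n z.2)) atTop (𝓝 (y * r z.2)) :=
      fun y => by simpa using (h1.const_mul (r z.2)).const_mul y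
    have e' : Tendsto (fun n => deriv r z.2 * cutoffSeq n z.2 + r z.2 * deriv (cutoffSeq n) z.2)
        atTop (𝓝 (deriv r z.2)) := by
      simpa using (h1.const_mul (deriv r z.2)).add (h2.const_mul (r z.2))
    exact ((e _).add ((e _).const_mul _)).sub ((e'.const_mul _).const_mul _)

end VlasovPoisson
end
-- The Poisson equation and the continuity of the field
open scoped ENNReal NNReal
noncomputable section
namespace VlasovPoisson

/-- As h has mean zero, h(y) is the average over z of h(y) - h(z), and each difference is at most
the variation over one period. -/
theorem abs_le_integral_abs_deriv {h : ℝ → ℝ} (hper : Function.Periodic h 1)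
    (hac : AbsolutelyContinuousOnInterval h 0 1) (h0 : ∫ x in (0 : ℝ)..1, h x = 0) (x : ℝ) :
    |h x| ≤ ∫ y in Ioc (0 : ℝ) 1, |deriv h y| := by
  obtain ⟨y, hy, hxy⟩ := hper.exists_mem_Ico₀ one_pos x
  rw [hxy]
  have hcont : ContinuousOn h (uIcc 0 1) := hac.continuousOn
  have hint := hac.intervalIntegrable_deriv
  have hd : ∀ z ∈ Icc (0 : ℝ) 1, |h y - h z| ≤ ∫ y in Ioc (0 : ℝ) 1, |deriv h y| := by
    intro z hz
    have hsub : uIcc z y ⊆ uIcc (0 : ℝ) 1 := by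
      rw [uIcc_of_le (zero_le_one (α := ℝ))]
      exact uIcc_subset_Icc hz ⟨hy.1, hy.2.le⟩
    rw [← (hac.mono hsub).integral_deriv_eq_sub]
    refine (intervalIntegral.norm_integral_le_integral_norm_uIoc (μ := volume) (f := deriv h)
      (a := z) (b := y)).trans ?_
    refine setIntegral_mono_set hint.abs.1 (Eventually.of_forall fun _ => abs_nonneg _) ?_
    refine LE.le.eventuallyLE (fun w hw => ?_ : Set.uIoc z y ⊆ Ioc 0 1)
    have h1 : min z y < w ∧ w ≤ max z y := hw
    exact ⟨(le_min hz.1 hy.1).trans_lt h1.1, h1.2.trans (max_le hz.2 hy.2.le)⟩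
  have e : h y = ∫ z in (0 : ℝ)..1, (h y - h z) := by
    rw [intervalIntegral.integral_sub intervalIntegrable_const hcont.intervalIntegrable, h0]
    simp
  rw [e]
  have := intervalIntegral.norm_integral_le_of_norm_le_const (a := (0 : ℝ)) (b := 1)
    (f := fun z => h y - h z) (C := ∫ y in Ioc (0 : ℝ) 1, |deriv h y|) fun z hz => by
      rw [uIoc_of_le zero_le_one] at hz
      exact hd z (Ioc_subset_Icc_self hz)
  simpa using this

/-- The force field `∂ₓV`, extended by its initial value to negative times. -/
def field (V : ℝ → ℝ → ℝ) (t x : ℝ) : ℝ := deriv (V (max t 0)) x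

theorem field_of_nonneg {V : ℝ → ℝ → ℝ} {t : ℝ} (ht : 0 ≤ t) : field V t = deriv (V t) := by
  ext x
  rw [field, max_eq_left ht]

/-- The `L¹` distance of the distribution functions at two times. -/
def distL1 (f : ℝ → ℝ → ℝ → ℝ) (t s : ℝ) : ℝ :=
  ∫ z, |f t z.1 z.2 - f s z.1 z.2| ∂phaseMeasure

theorem Periodic_deriv {h : ℝ → ℝ} (hp : Function.Periodic h 1) : Function.Periodic (deriv h) 1 := by
  intro x
  rw [← deriv_comp_add_const]
  congr 1
  ext y
  exact hp y

namespace IsStrongSolution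

variable {ε : ℝ} {f : ℝ → ℝ → ℝ → ℝ} {V : ℝ → ℝ → ℝ}

theorem field_periodic (S : IsStrongSolution ε f V) (t : ℝ) : Function.Periodic (field V t) 1 :=
  Periodic_deriv (S.potential_periodic _ (le_max_right _ _))

theorem field_ac (S : IsStrongSolution ε f V) (t a b : ℝ) :
    AbsolutelyContinuousOnInterval (field V t) a b :=
  S.field_absolutelyContinuous _ (le_max_right _ _) a b

theorem field_continuous_space (S : IsStrongSolution ε f V) (t : ℝ) : Continuous (field V t) :=
  (S.potential_contDiff _ (le_max_right _ _)).continuous_deriv le_rfl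

theorem integral_field (S : IsStrongSolution ε f V) (t : ℝ) : ∫ x in (0 : ℝ)..1, field V t x = 0 := by
  have h0 := S.potential_contDiff (max t 0) (le_max_right _ _)
  have : ∫ x in (0 : ℝ)..1, deriv (V (max t 0)) x = V (max t 0) 1 - V (max t 0) 0 :=
    intervalIntegral.integral_deriv_eq_sub (fun x _ => h0.differentiable (by norm_num) x)
      ((h0.continuous_deriv le_rfl).intervalIntegrable _ _)
  have h1 := S.potential_periodic (max t 0) (le_max_right _ _) 0
  rw [zero_add] at h1
  simp only [field]
  rw [this, h1, sub_self]

theorem integrable_density (S : IsStrongSolution ε f V) {t : ℝ} (ht : 0 ≤ t) :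
    Integrable (density (f t)) (volume.restrict (Ioc (0 : ℝ) 1)) :=
  (S.integrable t ht).integral_prod_left

theorem deriv_field (S : IsStrongSolution ε f V) (hε : 0 < ε) {t : ℝ} (ht : 0 ≤ t) :
    ∀ᵐ x : ℝ, deriv (field V t) x = -(density (f t) x - 1) / ε ^ 2 := by
  filter_upwards [S.poisson t ht] with x hx
  rw [field_of_nonneg ht, ← hx]
  field_simp

/-- Conservation of mass needs no transport: the derivative of the periodic field integrates to 0
over a period, hence so does ρ - 1. -/
theorem integral_eq_one (S : IsStrongSolution ε f V) (hε : 0 < ε) {t : ℝ} (ht : 0 ≤ t) :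
    ∫ z, f t z.1 z.2 ∂phaseMeasure = 1 := by
  have h1 := (S.field_ac t 0 1).integral_deriv_eq_sub
  have h2 := S.field_periodic t 0
  rw [zero_add] at h2
  rw [h2, sub_self, intervalIntegral.integral_of_le zero_le_one,
    setIntegral_congr_ae measurableSet_Ioc ((S.deriv_field hε ht).mono fun x hx _ => hx),
    integral_div, integral_neg, integral_sub (S.integrable_density ht) (integrable_const _)] at h1
  have h3 : ∫ z, f t z.1 z.2 ∂phaseMeasure = ∫ x in Ioc (0 : ℝ) 1, density (f t) x :=
    integral_prod _ (S.integrable t ht)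
  rw [h3]
  have : ε ^ 2 ≠ 0 := by positivity
  simp [this] at h1
  linarith

theorem integral_abs_density_sub_le (S : IsStrongSolution ε f V) {t s : ℝ} (ht : 0 ≤ t)
    (hs : 0 ≤ s) : ∫ x in Ioc (0 : ℝ) 1, |density (f t) x - density (f s) x| ≤ distL1 f t s := by
  have hi := (S.integrable t ht).sub (S.integrable s hs)
  have e : distL1 f t s = ∫ x in Ioc (0 : ℝ) 1, ∫ v, |f t x v - f s x v| :=
    integral_prod _ hi.abs
  rw [e]
  refine integral_mono_ae ((S.integrable_density ht).sub (S.integrable_density hs)).abs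
    hi.abs.integral_prod_left ?_
  filter_upwards [(S.integrable t ht).prod_right_ae, (S.integrable s hs).prod_right_ae] with x h1 h2
  simp only [density]
  rw [← integral_sub h1 h2]
  exact abs_integral_le_integral_abs

/-- The difference of two fields is periodic with mean zero, and its derivative is the difference of
the densities up to the factor -1/ε². Continuity of f in L¹ thus gives continuity of the field,
uniformly in x. -/
theorem abs_field_sub_le (S : IsStrongSolution ε f V) (hε : 0 < ε) {t s : ℝ} (ht : 0 ≤ t)
    (hs : 0 ≤ s) (x : ℝ) : |field V t x - field V s x| ≤ distL1 f t s / ε ^ 2 := by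
  have h1 := abs_le_integral_abs_deriv (h := fun x => field V t x - field V s x)
    ((S.field_periodic t).sub (S.field_periodic s)) ((S.field_ac t 0 1).sub (S.field_ac s 0 1))
    (by
      rw [intervalIntegral.integral_sub ((S.field_continuous_space t).intervalIntegrable _ _)
        ((S.field_continuous_space s).intervalIntegrable _ _), S.integral_field, S.integral_field,
        sub_self]) x
  refine h1.trans ?_
  have h2 : ∫ y in Ioc (0 : ℝ) 1, |deriv (fun x => field V t x - field V s x) y|
      = ∫ y in Ioc (0 : ℝ) 1, |density (f t) y - density (f s) y| / ε ^ 2 := by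
    refine setIntegral_congr_ae measurableSet_Ioc ?_
    filter_upwards [(S.field_ac t 0 1).ae_differentiableAt, (S.field_ac s 0 1).ae_differentiableAt,
      S.deriv_field hε ht, S.deriv_field hε hs] with y d1 d2 e1 e2 hy
    have hy' : y ∈ uIcc (0 : ℝ) 1 := by
      rw [uIcc_of_le zero_le_one]; exact Ioc_subset_Icc_self hy
    rw [deriv_fun_sub (d1 hy') (d2 hy'), e1, e2, ← abs_of_pos (by positivity : 0 < ε ^ 2), ← abs_div,
      abs_of_pos (by positivity : 0 < ε ^ 2), ← abs_neg]
    congr 1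
    ring
  rw [h2, integral_div]
  gcongr
  exact S.integral_abs_density_sub_le ht hs

/-- The density is nonnegative of mass one, so ρ - 1 has L¹ norm at most 2. -/
theorem abs_field_le (S : IsStrongSolution ε f V) (hε : 0 < ε) (t x : ℝ) :
    |field V t x| ≤ 2 / ε ^ 2 := by
  wlog ht : 0 ≤ t generalizing t
  · have h := this (max t 0) (le_max_right _ _)
    simpa [field] using h
  refine (abs_le_integral_abs_deriv (S.field_periodic t) (S.field_ac t 0 1)
    (S.integral_field t) x).trans ?_
  rw [setIntegral_congr_ae (g := fun y => |density (f t) y - 1| / ε ^ 2) measurableSet_Ioc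
    ((S.deriv_field hε ht).mono fun y hy _ => by
      rw [hy, abs_div, abs_neg, abs_of_pos (by positivity : 0 < ε ^ 2)]), integral_div]
  gcongr
  have hd := S.integrable_density ht
  have h3 : ∫ x in Ioc (0 : ℝ) 1, density (f t) x = 1 := by
    exact (integral_prod _ (S.integrable t ht)).symm.trans (S.integral_eq_one hε ht)
  calc ∫ y in Ioc (0 : ℝ) 1, |density (f t) y - 1|
      ≤ ∫ y in Ioc (0 : ℝ) 1, (density (f t) y + 1) := by
        refine integral_mono (hd.sub (integrable_const _)).abs (hd.add (integrable_const _)) ?_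
        intro y
        have : 0 ≤ density (f t) y := integral_nonneg fun v => S.nonneg t ht y v
        simp only
        rw [abs_le]
        constructor <;> linarith
    _ = 2 := by
        rw [integral_add hd (integrable_const _), h3]
        norm_num

theorem integral_mul_eq (S : IsStrongSolution ε f V) (hε : 0 < ε) {t : ℝ} (ht : 0 ≤ t)
    {q : ℝ → ℝ} (hq : Continuous q) (hqp : Function.Periodic q 1) :
    ∫ z, f t z.1 z.2 * q z.1 ∂phaseMeasure
      = ∫ x in (0 : ℝ)..1, (1 - ε ^ 2 * deriv (field V t) x) * q x := by
  obtain ⟨C, hC⟩ := isCompact_Icc (a := (0 : ℝ)) (b := 1) |>.exists_bound_of_continuousOn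
    hq.continuousOn
  have hb : ∀ x, ‖q x‖ ≤ C := fun x => by
    obtain ⟨y, hy, hxy⟩ := hqp.exists_mem_Ico₀ one_pos x
    rw [hxy]; exact hC y ⟨hy.1, hy.2.le⟩
  have hi : Integrable (fun z : ℝ × ℝ => f t z.1 z.2 * q z.1) phaseMeasure :=
    (S.integrable t ht).mul_bdd (c := C) (hq.comp continuous_fst).aestronglyMeasurable
      (Eventually.of_forall fun z => hb z.1)
  rw [phaseMeasure, integral_prod _ hi, intervalIntegral.integral_of_le zero_le_one]
  refine setIntegral_congr_ae measurableSet_Ioc ((S.deriv_field hε ht).mono fun x hx _ => ?_)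
  rw [hx]
  simp only [integral_mul_const]
  rw [show ∫ v, f t x v = density (f t) x from rfl]
  field_simp
  ring

/-- The Poisson equation tested against a function of `x`. -/
theorem integral_mul_sub (S : IsStrongSolution ε f V) (hε : 0 < ε) {t : ℝ} (ht : 0 ≤ t)
    {p : ℝ → ℝ} (hp : ContDiff ℝ 1 p) (hpp : Function.Periodic p 1) :
    ∫ z, f t z.1 z.2 * p z.1 ∂phaseMeasure
      = (∫ x in (0 : ℝ)..1, p x) + ε ^ 2 * ∫ x in (0 : ℝ)..1, field V t x * deriv p x := by
  rw [S.integral_mul_eq hε ht hp.continuous hpp]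
  have hpac : AbsolutelyContinuousOnInterval p 0 1 := hp.contDiffOn.absolutelyContinuousOnInterval
  have h1 := (S.field_ac t 0 1).integral_mul_deriv_eq_deriv_mul hpac
  have h2 := S.field_periodic t 0
  have h3 := hpp 0
  rw [zero_add] at h2 h3
  rw [h2, h3, sub_self, zero_sub] at h1
  rw [h1]
  have hi := (S.field_ac t 0 1).intervalIntegrable_deriv.mul_continuousOn hpac.continuousOn
  rw [mul_neg, ← intervalIntegral.integral_const_mul, ← sub_eq_add_neg,
    ← intervalIntegral.integral_sub (hp.continuous.intervalIntegrable _ _) (hi.const_mul _)]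
  congr 1
  ext x
  ring

/-- The Maxwell stress identity `ρ ∂ₓV = ∂ₓV - ε²/2 ∂ₓ(∂ₓV)²`, tested against a function of `x`. -/
theorem integral_mul_field (S : IsStrongSolution ε f V) (hε : 0 < ε) {t : ℝ} (ht : 0 ≤ t)
    {p : ℝ → ℝ} (hp : ContDiff ℝ 1 p) (hpp : Function.Periodic p 1) :
    ∫ z, f t z.1 z.2 * (field V t z.1 * p z.1) ∂phaseMeasure
      = (∫ x in (0 : ℝ)..1, field V t x * p x)
        + ε ^ 2 / 2 * ∫ x in (0 : ℝ)..1, field V t x ^ 2 * deriv p x := by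
  have hFc : Continuous fun x => field V t x * p x :=
    (S.field_continuous_space t).mul hp.continuous
  rw [S.integral_mul_eq hε ht (q := fun x => field V t x * p x) hFc
    ((S.field_periodic t).mul hpp)]
  have hpac : AbsolutelyContinuousOnInterval p 0 1 := hp.contDiffOn.absolutelyContinuousOnInterval
  have hF2 : AbsolutelyContinuousOnInterval (fun x => field V t x * field V t x) 0 1 :=
    (S.field_ac t 0 1).fun_mul (S.field_ac t 0 1)
  have h1 := hF2.integral_mul_deriv_eq_deriv_mul hpac
  have h2 := S.field_periodic t 0
  have h3 := hpp 0
  rw [zero_add] at h2 h3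
  rw [h2, h3, sub_self, zero_sub] at h1
  have e1 : ∫ x in (0 : ℝ)..1, field V t x ^ 2 * deriv p x
      = -∫ x in (0 : ℝ)..1, 2 * (deriv (field V t) x * (field V t x * p x)) := by
    simp only [sq]
    rw [h1]
    congr 1
    refine intervalIntegral.integral_congr_ae ?_
    filter_upwards [(S.field_ac t 0 1).ae_differentiableAt] with x hx hxI
    have hd := hx (uIoc_subset_uIcc hxI)
    rw [deriv_fun_mul hd hd]
    ring
  rw [e1]
  have hi := (S.field_ac t 0 1).intervalIntegrable_deriv.mul_continuousOn hFc.continuousOn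
  rw [mul_neg, ← intervalIntegral.integral_const_mul, ← sub_eq_add_neg,
    ← intervalIntegral.integral_sub (hFc.intervalIntegrable _ _)
      ((hi.const_mul _).const_mul _)]
  congr 1
  ext x
  ring

/-- Scheffé's argument: |a - b| = a + b - 2 min(a, b), both masses are one, and the minimum is
dominated by f(s), so pointwise continuity in time suffices for s > 0. At s = 0 this is the
attainment of the datum. -/
theorem distL1_tendsto (S : IsStrongSolution ε f V) (hε : 0 < ε) {s : ℝ} (hs : 0 ≤ s) :
    Tendsto (fun t => distL1 f t s) (𝓝[≥] s) (𝓝 0) ∧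
      (0 < s → Tendsto (fun t => distL1 f t s) (𝓝 s) (𝓝 0)) := by
  have hpos : 0 < s → Tendsto (fun t => distL1 f t s) (𝓝 s) (𝓝 0) := by
    intro hs0
    have hev : ∀ᶠ t in 𝓝 s, 0 < t := lt_mem_nhds hs0
    have hmin : Tendsto (fun t => ∫ z, min (f t z.1 z.2) (f s z.1 z.2) ∂phaseMeasure) (𝓝 s)
        (𝓝 (∫ z, f s z.1 z.2 ∂phaseMeasure)) := by
      refine tendsto_integral_filter_of_dominated_convergence (fun z => f s z.1 z.2) ?_ ?_
        (S.integrable s hs) ?_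
      · filter_upwards [hev] with t ht
        exact ((S.integrable t ht.le).inf (S.integrable s hs)).aestronglyMeasurable
      · filter_upwards [hev] with t ht
        refine Eventually.of_forall fun z => ?_
        rw [Real.norm_of_nonneg (le_min (S.nonneg t ht.le _ _) (S.nonneg s hs _ _))]
        exact min_le_right _ _
      · refine Eventually.of_forall fun z => ?_
        have hc : ContinuousAt (fun t => f t z.1 z.2) s := by
          have h1 : ContinuousAt (fun y : ℝ × ℝ × ℝ => f y.1 y.2.1 y.2.2) (s, z) :=
            S.locallyLipschitz.continuousOn.continuousAt
              ((isOpen_Ioi.prod isOpen_univ).mem_nhds ⟨hs0, mem_univ _⟩)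
          exact ContinuousAt.comp (f := fun t : ℝ => (t, z)) (x := s) h1 (by fun_prop)
        have h2 := Tendsto.min hc.tendsto (tendsto_const_nhds (x := f s z.1 z.2))
        simpa using h2
    have he : (fun t => 2 - 2 * ∫ z, min (f t z.1 z.2) (f s z.1 z.2) ∂phaseMeasure) =ᶠ[𝓝 s]
        fun t => distL1 f t s := by
      filter_upwards [hev] with t ht
      have hm : Integrable (fun z : ℝ × ℝ => min (f t z.1 z.2) (f s z.1 z.2)) phaseMeasure :=
        (S.integrable t ht.le).inf (S.integrable s hs)
      have ha : Integrable (fun z : ℝ × ℝ => f t z.1 z.2 + f s z.1 z.2) phaseMeasure :=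
        (S.integrable t ht.le).add (S.integrable s hs)
      have e : distL1 f t s = ∫ z, ((f t z.1 z.2 + f s z.1 z.2)
          - 2 * min (f t z.1 z.2) (f s z.1 z.2)) ∂phaseMeasure := by
        refine integral_congr_ae (Eventually.of_forall fun z => ?_)
        dsimp only
        rcases le_total (f t z.1 z.2) (f s z.1 z.2) with h | h
        · rw [min_eq_left h, abs_of_nonpos (by linarith)]; ring
        · rw [min_eq_right h, abs_of_nonneg (by linarith)]; ring
      rw [e, integral_sub ha (hm.const_mul 2),
        integral_add (S.integrable t ht.le) (S.integrable s hs), integral_const_mul,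
        S.integral_eq_one hε ht.le, S.integral_eq_one hε hs]
      ring
    have h3 : Tendsto (fun t => 2 - 2 * ∫ z, min (f t z.1 z.2) (f s z.1 z.2) ∂phaseMeasure) (𝓝 s)
        (𝓝 (2 - 2 * 1)) := by
      rw [← S.integral_eq_one hε hs]
      exact tendsto_const_nhds.sub (hmin.const_mul 2)
    norm_num at h3
    exact h3.congr' he
  refine ⟨?_, hpos⟩
  rcases hs.eq_or_lt with h0 | h0
  · subst h0
    have h1 : Tendsto (fun t => distL1 f t 0) (𝓝[>] 0) (𝓝 0) := S.initial
    rw [← Ioi_insert, nhdsWithin_insert]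
    refine Tendsto.sup ?_ h1
    rw [tendsto_pure_left]
    intro u hu
    simpa [distL1] using mem_of_mem_nhds hu
  · exact (hpos h0).mono_left nhdsWithin_le_nhds

theorem distL1_tendsto_within (S : IsStrongSolution ε f V) (hε : 0 < ε) {s : ℝ} (hs : 0 ≤ s) :
    Tendsto (fun t => distL1 f t s) (𝓝[Ici 0] s) (𝓝 0) := by
  rcases hs.eq_or_lt with h0 | h0
  · subst h0; exact (S.distL1_tendsto hε le_rfl).1
  · exact ((S.distL1_tendsto hε hs).2 h0).mono_left nhdsWithin_le_nhds

/-- Continuity in time is uniform in x, and at a fixed time the field is continuous in x. -/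
theorem field_continuous (S : IsStrongSolution ε f V) (hε : 0 < ε) :
    Continuous fun z : ℝ × ℝ => field V z.1 z.2 := by
  rw [continuous_iff_continuousAt]
  rintro ⟨s, y⟩
  have hmax : Tendsto (fun z : ℝ × ℝ => max z.1 0) (𝓝 (s, y)) (𝓝[Ici 0] (max s 0)) := by
    refine tendsto_nhdsWithin_iff.2 ⟨?_, Eventually.of_forall fun z => mem_Ici.2 (le_max_right _ _)⟩
    have : Continuous fun z : ℝ × ℝ => max z.1 0 := by fun_prop
    exact this.tendsto (s, y)
  have h1 : Tendsto (fun z : ℝ × ℝ => distL1 f (max z.1 0) (max s 0) / ε ^ 2) (𝓝 (s, y)) (𝓝 0) := by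
    simpa using ((S.distL1_tendsto_within hε (le_max_right s 0)).comp hmax).div_const (ε ^ 2)
  have h2 : Tendsto (fun z : ℝ × ℝ => field V z.1 z.2 - field V s z.2) (𝓝 (s, y)) (𝓝 0) := by
    refine squeeze_zero_norm (fun z => ?_) h1
    have := S.abs_field_sub_le hε (le_max_right z.1 0) (le_max_right s 0) z.2
    simpa [field] using this
  have h3 : Tendsto (fun z : ℝ × ℝ => field V s z.2) (𝓝 (s, y)) (𝓝 (field V s y)) :=
    ((S.field_continuous_space s).comp continuous_snd).tendsto (s, y)
  have h4 := h2.add h3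
  simp only [sub_add_cancel, zero_add] at h4
  exact h4

theorem isTransported (S : IsStrongSolution ε f V) : IsTransported (field V) f where
  locallyLipschitz := S.locallyLipschitz
  periodic t ht := S.periodic t ht.le
  eqn := by
    filter_upwards [S.vlasov] with z hz h0
    rw [field_of_nonneg h0.le]
    exact hz h0

end IsStrongSolution

end VlasovPoisson
end
-- Weak formulation from the initial time and conservation of the values of f
open scoped ENNReal NNReal
noncomputable section
namespace VlasovPoisson

/-- Split gΨ - g₀Ψ₀ into (g - g₀)Ψ, small by weighted L¹ convergence, and g₀(Ψ - Ψ₀), small by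
dominated convergence. -/
theorem tendsto_integral_mul_of_weighted {X : Type*} [MeasurableSpace X] {m : Measure X}
    {l : Filter ℝ} [l.IsCountablyGenerated] {g : ℝ → X → ℝ} {g₀ ω : X → ℝ} {Ψ : ℝ → X → ℝ}
    {Ψ₀ : X → ℝ} {C : ℝ} (hC : 0 ≤ C) (hω : ∀ z, 0 ≤ ω z)
    (h1 : Tendsto (fun t => ∫ z, |g t z - g₀ z| * ω z ∂m) l (𝓝 0))
    (hg : ∀ᶠ t in l, Integrable (fun z => g t z * ω z) m)
    (hgm : ∀ᶠ t in l, AEStronglyMeasurable (g t) m)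
    (h0 : Integrable (fun z => g₀ z * ω z) m) (h0m : AEStronglyMeasurable g₀ m)
    (hΨm : ∀ᶠ t in l, AEStronglyMeasurable (Ψ t) m)
    (hb : ∀ᶠ t in l, ∀ z, |Ψ t z| ≤ C * ω z)
    (hlim : ∀ z, Tendsto (fun t => Ψ t z) l (𝓝 (Ψ₀ z))) :
    Tendsto (fun t => ∫ z, g t z * Ψ t z ∂m) l (𝓝 (∫ z, g₀ z * Ψ₀ z ∂m)) := by
  have hbd : ∀ (k : X → ℝ) (Φ : X → ℝ), Integrable (fun z => k z * ω z) m →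
      AEStronglyMeasurable k m → AEStronglyMeasurable Φ m → (∀ z, |Φ z| ≤ C * ω z) →
      Integrable (fun z => k z * Φ z) m := by
    intro k Φ hk hkm hΦm hΦ
    refine (hk.const_mul C).mono (hkm.mul hΦm) (Eventually.of_forall fun z => ?_)
    rw [Real.norm_eq_abs, Real.norm_eq_abs, abs_mul, abs_mul, abs_mul, abs_of_nonneg hC,
      abs_of_nonneg (hω z)]
    calc |k z| * |Φ z| ≤ |k z| * (C * ω z) := by gcongr; exact hΦ z
      _ = C * (|k z| * ω z) := by ring
  have t2 : Tendsto (fun t => ∫ z, g₀ z * Ψ t z ∂m) l (𝓝 (∫ z, g₀ z * Ψ₀ z ∂m)) := by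
    refine tendsto_integral_filter_of_dominated_convergence (fun z => C * |g₀ z * ω z|)
      (hΨm.mono fun t ht => h0m.mul ht) ?_ (h0.abs.const_mul C)
      (Eventually.of_forall fun z => (hlim z).const_mul _)
    filter_upwards [hb] with t ht
    refine Eventually.of_forall fun z => ?_
    rw [Real.norm_eq_abs, abs_mul, abs_mul, abs_of_nonneg (hω z)]
    calc |g₀ z| * |Ψ t z| ≤ |g₀ z| * (C * ω z) := by gcongr; exact ht z
      _ = C * (|g₀ z| * ω z) := by ring
  have t1 : Tendsto (fun t => ∫ z, g t z * Ψ t z ∂m - ∫ z, g₀ z * Ψ t z ∂m) l (𝓝 0) := by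
    have h1' := h1.const_mul C
    rw [mul_zero] at h1'
    refine squeeze_zero_norm' ?_ h1'
    filter_upwards [hg, hgm, hΨm, hb] with t a1 a2 a3 a4
    have i1 := hbd _ _ a1 a2 a3 a4
    have i2 := hbd _ _ h0 h0m a3 a4
    rw [← integral_sub i1 i2, ← integral_const_mul]
    refine norm_integral_le_of_norm_le ?_ (Eventually.of_forall fun z => ?_)
    · refine Integrable.const_mul ?_ C
      refine ((a1.sub h0).abs).congr (Eventually.of_forall fun z => ?_)
      simp only [Pi.sub_apply]
      rw [← sub_mul, abs_mul, abs_of_nonneg (hω z)]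
    · rw [← sub_mul, norm_mul, Real.norm_eq_abs, Real.norm_eq_abs]
      calc |g t z - g₀ z| * |Ψ t z| ≤ |g t z - g₀ z| * (C * ω z) := by gcongr; exact a4 z
        _ = C * (|g t z - g₀ z| * ω z) := by ring
  have := t1.add t2
  simpa using this

/-- The weak formulation from the initial time, for solutions attaining their datum in `L¹`. -/
theorem IsTransported.weakOn_zero {F : ℝ → ℝ → ℝ} {g : ℝ → ℝ → ℝ → ℝ} (hg : IsTransported F g)
    (hF : Continuous fun z : ℝ × ℝ => F z.1 z.2) {CF : ℝ} (hFb : ∀ t x, |F t x| ≤ CF)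
    (hgi : ∀ t, 0 ≤ t → Integrable (fun z : ℝ × ℝ => g t z.1 z.2) phaseMeasure)
    (hgb : ∃ B, ∀ t, 0 ≤ t → ∫ z, |g t z.1 z.2| ∂phaseMeasure ≤ B)
    (hg0 : Tendsto (fun t => ∫ z, |g t z.1 z.2 - g 0 z.1 z.2| ∂phaseMeasure) (𝓝[>] 0) (𝓝 0))
    {c : ℝ} {θ p r : ℝ → ℝ} (hθ : ContDiff ℝ 1 θ)
    (hp : ContDiff ℝ 1 p) (hpp : Function.Periodic p 1) (hr : ContDiff ℝ 1 r)
    (hrc : HasCompactSupport r) {b : ℝ} (hb : 0 ≤ b) :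
    WeakOn F g c θ p r 0 b := by
  rcases hb.eq_or_lt with h0 | hb0
  · subst h0; simp [WeakOn]
  obtain ⟨B, hB⟩ := hgb
  obtain ⟨C1, hC1⟩ := isCompact_Icc (a := (0 : ℝ)) (b := b) |>.exists_bound_of_continuousOn
    hθ.continuous.continuousOn
  obtain ⟨C2, hC2⟩ := isCompact_Icc (a := (0 : ℝ)) (b := b) |>.exists_bound_of_continuousOn
    (hθ.continuous_deriv le_rfl).continuousOn
  have hper : ∀ q : ℝ → ℝ, Continuous q → Function.Periodic q 1 → ∃ C, ∀ x, ‖q x‖ ≤ C := by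
    intro q hq hqp
    obtain ⟨C, hC⟩ := isCompact_Icc (a := (0 : ℝ)) (b := 1) |>.exists_bound_of_continuousOn
      hq.continuousOn
    refine ⟨C, fun x => ?_⟩
    obtain ⟨y, hy, hxy⟩ := hqp.exists_mem_Ico₀ one_pos x
    rw [hxy]; exact hC y ⟨hy.1, hy.2.le⟩
  obtain ⟨C3, hC3⟩ := hper p hp.continuous hpp
  obtain ⟨C4, hC4⟩ := hper _ (hp.continuous_deriv le_rfl) (Periodic_deriv hpp)
  obtain ⟨C5, hC5⟩ := hrc.exists_bound_of_continuous hr.continuous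
  obtain ⟨C6, hC6⟩ := hrc.deriv.exists_bound_of_continuous (hr.continuous_deriv le_rfl)
  -- Compact support of r bounds the growing factor v - c, so unweighted L¹ bounds on g suffice.
  obtain ⟨C7, hC7⟩ := (hrc.mul_left (f := fun v => v - c)).exists_bound_of_continuous
    ((continuous_id.sub continuous_const).mul hr.continuous)
  simp only [Pi.mul_apply, Real.norm_eq_abs] at hC1 hC2 hC3 hC4 hC5 hC6 hC7
  have p1 := (abs_nonneg _).trans (hC1 0 ⟨le_rfl, hb⟩)
  have p2 := (abs_nonneg _).trans (hC2 0 ⟨le_rfl, hb⟩)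
  have p3 := (abs_nonneg _).trans (hC3 0)
  have p4 := (abs_nonneg _).trans (hC4 0)
  have p5 := (abs_nonneg _).trans (hC5 0)
  have pF := (abs_nonneg _).trans (hFb 0 0)
  have hT : ∀ t ∈ Icc 0 b, ∀ z, |testFn c θ p r t z| ≤ C1 * C3 * C5 := fun t ht z => by
    rw [testFn, abs_mul, abs_mul]
    gcongr
    · exact hC1 t ht
    · exact hC3 _
    · exact hC5 _
  set M := C2 * C3 * C5 + C1 * (C4 * C7) + C1 * (CF * C3 * C6) with hM
  have hL : ∀ t ∈ Icc 0 b, ∀ z, |testFlow F c θ p r t z| ≤ M := fun t ht z => by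
    rw [testFlow]
    refine (abs_sub _ _).trans (add_le_add ((abs_add_le _ _).trans (add_le_add ?_ ?_)) ?_)
    · rw [abs_mul, abs_mul]
      gcongr
      · exact hC2 t ht
      · exact hC3 _
      · exact hC5 _
    · rw [mul_right_comm _ _ (r z.2), mul_comm _ (deriv p _), abs_mul, abs_mul]
      gcongr
      · exact hC1 t ht
      · exact hC4 _
      · exact hC7 _
    · rw [abs_mul, abs_mul, abs_mul]
      gcongr
      · exact hC1 t ht
      · exact hFb _ _
      · exact hC3 _
      · exact hC6 _
  have hφb : ∀ τ ∈ Icc 0 b, |∫ z, g τ z.1 z.2 * testFlow F c θ p r τ z ∂phaseMeasure| ≤ B * M := by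
    intro τ hτ
    have hM0 : 0 ≤ M := (abs_nonneg _).trans (hL τ hτ 0)
    calc |∫ z, g τ z.1 z.2 * testFlow F c θ p r τ z ∂phaseMeasure|
        ≤ ∫ z, |g τ z.1 z.2| * M ∂phaseMeasure := by
          rw [← Real.norm_eq_abs]
          refine norm_integral_le_of_norm_le ((hgi τ hτ.1).abs.mul_const M)
            (Eventually.of_forall fun z => ?_)
          rw [norm_mul]
          exact mul_le_mul_of_nonneg_left (hL τ hτ z) (abs_nonneg _)
      _ ≤ B * M := by
          rw [integral_mul_const]
          exact mul_le_mul_of_nonneg_right (hB τ hτ.1) hM0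
  have hφi : ∀ a' b', 0 ≤ a' → a' ≤ b' → b' ≤ b → IntervalIntegrable
      (fun τ => ∫ z, g τ z.1 z.2 * testFlow F c θ p r τ z ∂phaseMeasure) volume a' b' := by
    intro a' b' ha' hab' hb'
    rw [intervalIntegrable_iff_integrableOn_Ioc_of_le hab']
    refine Integrable.of_bound (aestronglyMeasurable_integral_mul hg.locallyLipschitz.continuousOn
      (testFlow_continuous_uncurry hF hθ hp hr) ha') (B * M) ?_
    filter_upwards [ae_restrict_mem measurableSet_Ioc] with τ hτ
    exact hφb τ ⟨ha'.trans hτ.1.le, hτ.2.trans hb'⟩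
  have hev : ∀ᶠ t in 𝓝[>] (0 : ℝ), t ∈ Ioc 0 b := Ioc_mem_nhdsGT hb0
  have lim1 : Tendsto (fun t => ∫ z, g t z.1 z.2 * testFn c θ p r t z ∂phaseMeasure) (𝓝[>] 0)
      (𝓝 (∫ z, g 0 z.1 z.2 * testFn c θ p r 0 z ∂phaseMeasure)) := by
    refine tendsto_integral_mul_of_weighted (ω := fun _ => 1) (C := C1 * C3 * C5) (by positivity)
      (fun _ => zero_le_one) (by simpa using hg0) ?_ ?_ (by simpa using hgi 0 le_rfl)
      (hgi 0 le_rfl).aestronglyMeasurable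
      (Eventually.of_forall fun t => (testFn_continuous hp hr t).aestronglyMeasurable)
      ?_ ?_
    · filter_upwards [hev] with t ht
      simpa using hgi t ht.1.le
    · filter_upwards [hev] with t ht using (hgi t ht.1.le).aestronglyMeasurable
    · filter_upwards [hev] with t ht z
      simpa using hT t ⟨ht.1.le, ht.2⟩ z
    · intro z
      have hc : Continuous fun t => testFn c θ p r t z := by
        have := hθ.continuous
        have := hp.continuous
        unfold testFn
        fun_prop
      exact (hc.tendsto 0).mono_left nhdsWithin_le_nhds
  have lim2 : Tendsto (fun t => ∫ τ in (0 : ℝ)..t, ∫ z, g τ z.1 z.2 * testFlow F c θ p r τ z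
      ∂phaseMeasure) (𝓝[>] 0) (𝓝 0) := by
    have h1 : Tendsto (fun t : ℝ => B * M * |t - 0|) (𝓝[>] 0) (𝓝 0) := by
      have : Continuous fun t : ℝ => B * M * |t - 0| := by fun_prop
      simpa using (this.tendsto 0).mono_left (nhdsWithin_le_nhds (s := Ioi 0))
    refine squeeze_zero_norm' ?_ h1
    filter_upwards [hev] with t ht
    refine intervalIntegral.norm_integral_le_of_norm_le_const fun τ hτ => ?_
    rw [uIoc_of_le ht.1.le] at hτ
    exact hφb τ ⟨hτ.1.le, hτ.2.trans ht.2⟩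
  -- The identity between t > 0 and b is known; t tends to 0. The integral over (0, t) vanishes in
  -- the limit since its integrand is bounded.
  have lim3 := lim1.add (tendsto_const_nhds (x := ∫ τ in (0 : ℝ)..b, ∫ z, g τ z.1 z.2 *
    testFlow F c θ p r τ z ∂phaseMeasure) |>.sub lim2)
  have e : (fun t => ∫ z, g t z.1 z.2 * testFn c θ p r t z ∂phaseMeasure
      + ((∫ τ in (0 : ℝ)..b, ∫ z, g τ z.1 z.2 * testFlow F c θ p r τ z ∂phaseMeasure)
        - ∫ τ in (0 : ℝ)..t, ∫ z, g τ z.1 z.2 * testFlow F c θ p r τ z ∂phaseMeasure))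
      =ᶠ[𝓝[>] 0] fun _ => ∫ z, g b z.1 z.2 * testFn c θ p r b z ∂phaseMeasure := by
    filter_upwards [hev] with t ht
    have hw := hg.weakOn hF (c := c) hθ hp hpp hr hrc ht.1 ht.2
    rw [WeakOn, ← intervalIntegral.integral_add_adjacent_intervals
      (hφi 0 t le_rfl ht.1.le ht.2) (hφi t b ht.1.le ht.2 le_rfl)] at *
    linarith
  have hlast := tendsto_nhds_unique (lim3.congr' e) tendsto_const_nhds
  rw [WeakOn, ← hlast]
  ring

namespace IsStrongSolution

variable {ε : ℝ} {f : ℝ → ℝ → ℝ → ℝ} {V : ℝ → ℝ → ℝ}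

/-- Test the equation for β(f) against 1, whose flow derivative is zero. The Lipschitz bound with
β(0) = 0 makes β(f) integrable and transfers the L¹ convergence at time 0. -/
theorem integral_comp_eq (S : IsStrongSolution ε f V) (hε : 0 < ε) {β : ℝ → ℝ}
    (hβ : ContDiff ℝ 1 β) {K : ℝ≥0} (hK : LipschitzWith K β) (h0 : β 0 = 0) {t : ℝ} (ht : 0 ≤ t) :
    ∫ z, β (f t z.1 z.2) ∂phaseMeasure = ∫ z, β (f 0 z.1 z.2) ∂phaseMeasure := by
  have hle : ∀ s, |β s| ≤ K * |s| := fun s => by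
    have := hK.dist_le_mul s 0
    simpa [h0, Real.dist_eq] using this
  have hβm : ∀ t, 0 ≤ t → AEStronglyMeasurable (fun z : ℝ × ℝ => β (f t z.1 z.2)) phaseMeasure :=
    fun t ht => hβ.continuous.comp_aestronglyMeasurable (S.integrable t ht).aestronglyMeasurable
  have hi : ∀ t, 0 ≤ t → Integrable (fun z : ℝ × ℝ => β (f t z.1 z.2)) phaseMeasure :=
    fun t ht => ((S.integrable t ht).abs.const_mul (K : ℝ)).mono' (hβm t ht)
      (Eventually.of_forall fun z => hle _)
  have hB : ∀ t, 0 ≤ t → ∫ z, |β (f t z.1 z.2)| ∂phaseMeasure ≤ K := fun t ht => by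
    calc ∫ z, |β (f t z.1 z.2)| ∂phaseMeasure ≤ ∫ z, K * f t z.1 z.2 ∂phaseMeasure := by
          refine integral_mono (hi t ht).abs ((S.integrable t ht).const_mul _) fun z => ?_
          have := hle (f t z.1 z.2)
          rwa [abs_of_nonneg (S.nonneg t ht _ _)] at this
      _ = K := by rw [integral_const_mul, S.integral_eq_one hε ht, mul_one]
  have hT := S.isTransported.comp hβ
  have hw : WeakOn (field V) (fun t x v => β (f t x v)) 0 (fun _ => 1) (fun _ => 1) (fun _ => 1) 0 t := by
    refine weakOn_of_forall_hasCompactSupport (S.field_continuous hε)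
      hT.locallyLipschitz.continuousOn (ω := fun _ => 1) (B := K) (C := max 1 (2 / ε ^ 2)) le_rfl ht
      contDiff_const contDiff_const contDiff_const ?_ (fun τ hτ => by simpa using hi τ hτ.1)
      (fun τ hτ => hβm τ hτ.1) (fun τ hτ => by simpa using hB τ hτ.1) ?_ ?_ ?_ ?_ ?_ ?_ ?_
    · intro r' hr' hrc'
      refine hT.weakOn_zero (S.field_continuous hε) (S.abs_field_le hε) hi ⟨K, hB⟩ ?_ contDiff_const
        contDiff_const (fun _ => rfl) hr' hrc' ht
      have h1 := S.initial.const_mul (K : ℝ)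
      rw [mul_zero] at h1
      refine squeeze_zero' (Eventually.of_forall fun t => integral_nonneg fun _ => abs_nonneg _) ?_ h1
      filter_upwards [self_mem_nhdsWithin] with t (ht : 0 < t)
      rw [← integral_const_mul]
      refine integral_mono ((hi t ht.le).sub (hi 0 le_rfl)).abs
        (((S.integrable t ht.le).sub (S.integrable 0 le_rfl)).abs.const_mul _) fun z => ?_
      have := hK.dist_le_mul (f t z.1 z.2) (f 0 z.1 z.2)
      simpa [Real.dist_eq] using this
    all_goals intros; simp
    exact Or.inr (S.abs_field_le hε _ _)
  rw [WeakOn] at hw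
  simp only [testFn, testFlow, deriv_const] at hw
  simp at hw
  linarith

/-- The distribution of the values of a strong solution, weighted by the values. -/
def valueMeasure (f : ℝ → ℝ → ℝ → ℝ) (t : ℝ) : Measure ℝ :=
  (phaseMeasure.withDensity fun z => ENNReal.ofReal (f t z.1 z.2)).map fun z => f t z.1 z.2

theorem valueMeasure_Iic (S : IsStrongSolution ε f V) {t : ℝ} (ht : 0 ≤ t)
    (a : ℝ) : valueMeasure f t (Iic a) = ENNReal.ofReal
      (∫ z, (Iic a).indicator (fun s => s) (f t z.1 z.2) ∂phaseMeasure) := by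
  have hm := (S.integrable t ht).aestronglyMeasurable.aemeasurable
  have hm' := hm.mono_ac (withDensity_absolutelyContinuous phaseMeasure
    (fun z => ENNReal.ofReal (f t z.1 z.2)))
  have hns : NullMeasurableSet ((fun z : ℝ × ℝ => f t z.1 z.2) ⁻¹' Iic a) phaseMeasure :=
    hm.nullMeasurable measurableSet_Iic
  rw [valueMeasure, Measure.map_apply_of_aemeasurable hm' measurableSet_Iic,
    withDensity_apply₀ _ hns, ← lintegral_indicator₀ hns, ofReal_integral_eq_lintegral_ofReal]
  · congr 1
    ext z
    simp only [indicator, mem_preimage, mem_Iic]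
    split_ifs <;> simp
  · have := (S.integrable t ht).indicator₀ hns
    refine this.congr (Eventually.of_forall fun z => ?_)
    simp [indicator]
  · refine Eventually.of_forall fun z => ?_
    simp only [indicator]
    split_ifs
    · exact S.nonneg t ht _ _
    · exact le_rfl

/-- Weighted by f, the distribution of values is a finite measure, so half lines determine it. The
function s·1(s ≤ a) is a limit of C¹ compactly supported functions to which the previous
conservation law applies. -/
theorem valueMeasure_eq (S : IsStrongSolution ε f V) (hε : 0 < ε) {t : ℝ} (ht : 0 ≤ t) :
    valueMeasure f t = valueMeasure f 0 := by
  have hfin : ∀ t, 0 ≤ t → IsFiniteMeasure (valueMeasure f t) := fun t ht => by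
    have : IsFiniteMeasure (phaseMeasure.withDensity fun z : ℝ × ℝ => ENNReal.ofReal (f t z.1 z.2)) :=
      isFiniteMeasure_withDensity_ofReal (S.integrable t ht).2
    unfold valueMeasure
    infer_instance
  have := hfin t ht
  refine Measure.ext_of_Iic _ _ fun a => ?_
  rw [S.valueMeasure_Iic ht, S.valueMeasure_Iic le_rfl]
  congr 1
  let T := Real.smoothTransition
  -- The first transition is 1 for s ≤ a and 0 for s ≥ a + 1/n. The second only cuts off negative s;
  -- it equals 1 at all values of f. For n = 0 the upper cut disappears, hence the restriction n ≥ 1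
  -- below.
  let β : ℕ → ℝ → ℝ := fun n s => s * (T (1 + n * (a - s)) * T (s + 1))
  have hβ : ∀ n, ContDiff ℝ 1 (β n) := fun n => by
    have h1 : ContDiff ℝ 1 T := Real.smoothTransition.contDiff
    have h2 : ContDiff ℝ 1 fun s : ℝ => 1 + (n : ℝ) * (a - s) := by fun_prop
    have h3 : ContDiff ℝ 1 fun s : ℝ => s + 1 := by fun_prop
    exact contDiff_id.mul ((h1.comp h2).mul (h1.comp h3))
  have hβc : ∀ n, 1 ≤ n → HasCompactSupport (β n) := fun n hn => by
    refine HasCompactSupport.intro (isCompact_Icc (a := (-1 : ℝ)) (b := a + 1)) fun s hs => ?_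
    have hn' : (1 : ℝ) ≤ n := by exact_mod_cast hn
    rw [mem_Icc, not_and_or, not_le, not_le] at hs
    rcases hs with hs | hs
    · have : T (s + 1) = 0 := Real.smoothTransition.zero_of_nonpos (by linarith)
      simp [β, this]
    · have : T (1 + n * (a - s)) = 0 := Real.smoothTransition.zero_of_nonpos (by nlinarith)
      simp [β, this]
  have hlim : ∀ t, 0 ≤ t → Tendsto (fun n => ∫ z, β n (f t z.1 z.2) ∂phaseMeasure) atTop
      (𝓝 (∫ z, (Iic a).indicator (fun s => s) (f t z.1 z.2) ∂phaseMeasure)) := by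
    intro t ht
    refine tendsto_integral_of_dominated_convergence (fun z => f t z.1 z.2)
      (fun n => (hβ n).continuous.comp_aestronglyMeasurable (S.integrable t ht).aestronglyMeasurable)
      (S.integrable t ht) (fun n => Eventually.of_forall fun z => ?_)
      (Eventually.of_forall fun z => ?_)
    · have h0 := S.nonneg t ht z.1 z.2
      have h1 : 0 ≤ T (1 + n * (a - f t z.1 z.2)) * T (f t z.1 z.2 + 1) :=
        mul_nonneg (Real.smoothTransition.nonneg _) (Real.smoothTransition.nonneg _)
      have h2 : T (1 + n * (a - f t z.1 z.2)) * T (f t z.1 z.2 + 1) ≤ 1 :=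
        mul_le_one₀ (Real.smoothTransition.le_one _) (Real.smoothTransition.nonneg _)
          (Real.smoothTransition.le_one _)
      simp only [β]
      rw [Real.norm_of_nonneg (mul_nonneg h0 h1)]
      exact mul_le_of_le_one_right h0 h2
    · refine tendsto_const_nhds.congr' ?_
      have h0 := S.nonneg t ht z.1 z.2
      have e2 : T (f t z.1 z.2 + 1) = 1 := Real.smoothTransition.one_of_one_le (by linarith)
      rcases le_or_gt (f t z.1 z.2) a with h | h
      · refine Eventually.of_forall fun n => ?_
        have e1 : T (1 + n * (a - f t z.1 z.2)) = 1 := Real.smoothTransition.one_of_one_le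
          (by nlinarith [mul_nonneg (n.cast_nonneg (α := ℝ)) (sub_nonneg.2 h)])
        simp [β, e1, e2, h]
      · obtain ⟨N, hN⟩ := exists_nat_ge (1 / (f t z.1 z.2 - a))
        filter_upwards [eventually_ge_atTop N] with n hn
        have hn' : (N : ℝ) ≤ n := by exact_mod_cast hn
        have hp : 0 < f t z.1 z.2 - a := by linarith
        have h3 : 1 ≤ n * (f t z.1 z.2 - a) := by
          rw [← div_le_iff₀ hp]; exact hN.trans hn'
        have e1 : T (1 + n * (a - f t z.1 z.2)) = 0 :=
          Real.smoothTransition.zero_of_nonpos (by linarith)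
        simp [β, e1, h]
  refine tendsto_nhds_unique (hlim t ht) ((hlim 0 le_rfl).congr' ?_)
  filter_upwards [eventually_ge_atTop 1] with n hn
  obtain ⟨K, hK⟩ := ContDiff.lipschitzWith_of_hasCompactSupport (hβc n hn) (hβ n) (by norm_num)
  exact (S.integral_comp_eq hε (hβ n) hK (by simp [β]) ht).symm

/-- The distribution function of a strong solution is conserved. -/
theorem lintegral_comp_eq (S : IsStrongSolution ε f V) (hε : 0 < ε) {G : ℝ → ℝ≥0∞}
    (hG : Measurable G) (h0 : G 0 = 0) {t : ℝ} (ht : 0 ≤ t) :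
    ∫⁻ z, G (f t z.1 z.2) ∂phaseMeasure = ∫⁻ z, G (f 0 z.1 z.2) ∂phaseMeasure := by
  -- Write G(f) as f times G(f)/f. Points where f = 0 contribute nothing, because G(0) = 0.
  have key : ∀ t, 0 ≤ t → ∫⁻ z, G (f t z.1 z.2) ∂phaseMeasure
      = ∫⁻ s, G s / ENNReal.ofReal s ∂(valueMeasure f t) := by
    intro t ht
    have hm := (S.integrable t ht).aestronglyMeasurable.aemeasurable
    have hm' := hm.mono_ac (withDensity_absolutelyContinuous phaseMeasure
      (fun z => ENNReal.ofReal (f t z.1 z.2)))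
    have hq : Measurable fun s => G s / ENNReal.ofReal s := hG.div ENNReal.measurable_ofReal
    have hqm : AEMeasurable (fun z : ℝ × ℝ => G (f t z.1 z.2) / ENNReal.ofReal (f t z.1 z.2))
      phaseMeasure := hq.comp_aemeasurable hm
    rw [valueMeasure, lintegral_map' hq.aemeasurable hm',
      lintegral_withDensity_eq_lintegral_mul₀ hm.ennreal_ofReal hqm]
    congr 1
    ext z
    rcases (S.nonneg t ht z.1 z.2).eq_or_lt with h | h
    · simp [← h, h0]
    · simp only [Pi.mul_apply]
      rw [ENNReal.mul_div_cancel (by simpa using h) ENNReal.ofReal_ne_top]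
  rw [key t ht, key 0 le_rfl, S.valueMeasure_eq hε ht]

end IsStrongSolution

end VlasovPoisson
end
-- Grönwall's inequality and propagation of the second moment
open scoped ENNReal NNReal
noncomputable section
namespace VlasovPoisson

/-- Grönwall's inequality in integral form; `κ` is a primitive of the rate `k`. -/
theorem gronwall_integral {y k κ : ℝ → ℝ} {A D : ℝ} (hy : ContinuousOn y (Ici 0))
    (hk : Continuous k) (hk0 : ∀ t, 0 ≤ k t) (hκ : ∀ t, HasDerivAt κ (k t) t) (hκ0 : κ 0 = 0)
    (hD : 0 ≤ D) (h : ∀ t, 0 ≤ t → y t ≤ A + ∫ s in (0 : ℝ)..t, (k s * y s + D)) {t : ℝ}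
    (ht : 0 ≤ t) : y t ≤ (A + D * t) * Real.exp (κ t) := by
  let φ : ℝ → ℝ := fun s => k s * y (max s 0) + D
  have hymax : Continuous fun s => y (max s 0) :=
    hy.comp_continuous (by fun_prop) fun s => mem_Ici.2 (le_max_right _ _)
  have hφ : Continuous φ := (hk.mul hymax).add continuous_const
  let N : ℝ → ℝ := fun t => A + ∫ s in (0 : ℝ)..t, φ s
  have hN : ∀ t, HasDerivAt N (φ t) t := fun t =>
    (intervalIntegral.integral_hasDerivAt_right (hφ.intervalIntegrable _ _)
      (hφ.stronglyMeasurableAtFilter _ _) hφ.continuousAt).const_add A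
  have hyN : ∀ t, 0 ≤ t → y t ≤ N t := fun t ht => by
    refine (h t ht).trans_eq ?_
    simp only [N]
    congr 1
    refine intervalIntegral.integral_congr fun s hs => ?_
    rw [uIcc_of_le ht] at hs
    simp only [φ, max_eq_left hs.1]
  -- Its derivative is at most D(exp(-κ) - 1), which is nonpositive since κ ≥ 0 for nonnegative
  -- times.
  let P : ℝ → ℝ := fun t => N t * Real.exp (-κ t) - D * t
  have hP : ∀ t, HasDerivAt P (φ t * Real.exp (-κ t) + N t * (Real.exp (-κ t) * (-k t)) - D) t :=
    fun t => by
      have h1 : HasDerivAt (fun t => D * t) D t := by simpa using (hasDerivAt_id t).const_mul D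
      exact ((hN t).mul ((hκ t).neg.exp)).sub h1
  have hκnn : ∀ t, 0 ≤ t → 0 ≤ κ t := fun t ht => by
    have : MonotoneOn κ (Ici 0) := monotoneOn_of_deriv_nonneg (convex_Ici 0)
      (fun x _ => (hκ x).continuousAt.continuousWithinAt)
      (fun x _ => (hκ x).differentiableAt.differentiableWithinAt)
      (fun x _ => by rw [(hκ x).deriv]; exact hk0 x)
    have := this (mem_Ici.2 le_rfl) (mem_Ici.2 ht) ht
    rwa [hκ0] at this
  have hanti : AntitoneOn P (Ici 0) := by
    refine antitoneOn_of_deriv_nonpos (convex_Ici 0)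
      (fun x _ => (hP x).continuousAt.continuousWithinAt)
      (fun x _ => (hP x).differentiableAt.differentiableWithinAt) fun x hx => ?_
    rw [interior_Ici, mem_Ioi] at hx
    rw [(hP x).deriv]
    have h1 : φ x ≤ k x * N x + D := by
      simp only [φ, max_eq_left hx.le]
      gcongr
      · exact hk0 x
      · exact hyN x hx.le
    have h2 : Real.exp (-κ x) ≤ 1 := Real.exp_le_one_iff.2 (neg_nonpos.2 (hκnn x hx.le))
    have h3 := Real.exp_pos (-κ x)
    nlinarith
  have h1 := hanti (mem_Ici.2 le_rfl) (mem_Ici.2 ht) ht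
  simp only [P, N, hκ0, neg_zero, Real.exp_zero, intervalIntegral.integral_same, mul_zero, sub_zero,
    add_zero, mul_one] at h1
  have h2 : N t * Real.exp (-κ t) ≤ A + D * t := by linarith
  refine (hyN t ht).trans ?_
  have h3 := mul_le_mul_of_nonneg_right h2 (Real.exp_pos (κ t)).le
  rwa [mul_assoc, ← Real.exp_add, neg_add_cancel, Real.exp_zero, mul_one] at h3

/-- The truncated square `w²/(1 + δw²)`. -/
def truncSq (δ w : ℝ) : ℝ := w ^ 2 / (1 + δ * w ^ 2)

theorem truncSq_hasDerivAt {δ : ℝ} (hδ : 0 < δ) (w : ℝ) :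
    HasDerivAt (truncSq δ) (2 * w / (1 + δ * w ^ 2) ^ 2) w := by
  have hne : 1 + δ * w ^ 2 ≠ 0 := by positivity
  have h := (hasDerivAt_pow 2 w).div ((hasDerivAt_pow 2 w).const_mul δ |>.const_add 1) hne
  refine h.congr_deriv ?_
  field_simp
  ring

theorem truncSq_contDiff {δ : ℝ} (hδ : 0 < δ) : ContDiff ℝ 1 (truncSq δ) := by
  unfold truncSq
  exact ContDiff.div (by fun_prop) (by fun_prop) fun w => by positivity

theorem truncSq_nonneg {δ : ℝ} (hδ : 0 < δ) (w : ℝ) : 0 ≤ truncSq δ w := by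
  unfold truncSq; positivity

theorem truncSq_le_sq {δ : ℝ} (hδ : 0 < δ) (w : ℝ) : truncSq δ w ≤ w ^ 2 :=
  div_le_self (sq_nonneg _) (by nlinarith [mul_nonneg hδ.le (sq_nonneg w)])

theorem truncSq_le {δ : ℝ} (hδ : 0 < δ) (w : ℝ) : truncSq δ w ≤ 1 / δ := by
  unfold truncSq
  rw [div_le_div_iff₀ (by positivity) hδ]
  nlinarith

/-- The derivative is controlled by the function itself with constants independent of δ, so that the
Grönwall bound survives δ → 0. -/
theorem abs_deriv_truncSq_le {δ : ℝ} (hδ : 0 < δ) (w : ℝ) :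
    |deriv (truncSq δ) w| ≤ 1 + truncSq δ w := by
  rw [(truncSq_hasDerivAt hδ w).deriv, abs_div, abs_of_pos (by positivity : 0 < (1 + δ * w ^ 2) ^ 2),
    truncSq]
  have h1 : 0 < 1 + δ * w ^ 2 := by positivity
  have h2 : 0 ≤ δ * w ^ 2 := by positivity
  have e : 1 + w ^ 2 / (1 + δ * w ^ 2) = ((1 + δ * w ^ 2) ^ 2 + w ^ 2 * (1 + δ * w ^ 2))
      / (1 + δ * w ^ 2) ^ 2 := by field_simp
  rw [e]
  gcongr
  have h3 : |2 * w| ≤ 1 + w ^ 2 := by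
    rw [abs_le]; constructor <;> nlinarith [sq_nonneg (w - 1), sq_nonneg (w + 1)]
  nlinarith [mul_nonneg h2 (sq_nonneg w)]

namespace IsStrongSolution

variable {ε : ℝ} {f : ℝ → ℝ → ℝ → ℝ} {V : ℝ → ℝ → ℝ}

theorem continuousOn (S : IsStrongSolution ε f V) :
    ContinuousOn (fun z : ℝ × ℝ × ℝ => f z.1 z.2.1 z.2.2)
      (Ioi (0 : ℝ) ×ˢ (univ : Set (ℝ × ℝ))) := S.locallyLipschitz.continuousOn

theorem weakOn_of_hasCompactSupport (S : IsStrongSolution ε f V) (hε : 0 < ε) {c : ℝ}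
    {θ p r : ℝ → ℝ} (hθ : ContDiff ℝ 1 θ)
    (hp : ContDiff ℝ 1 p) (hpp : Function.Periodic p 1) (hr : ContDiff ℝ 1 r)
    (hrc : HasCompactSupport r) {a b : ℝ} (ha : 0 ≤ a) (hab : a ≤ b) :
    WeakOn (field V) f c θ p r a b := by
  rcases ha.eq_or_lt with h0 | h0
  · subst h0
    refine S.isTransported.weakOn_zero (S.field_continuous hε) (S.abs_field_le hε) S.integrable
      ⟨1, fun t ht => ?_⟩ S.initial hθ hp hpp hr hrc hab
    rw [← S.integral_eq_one hε ht]
    exact (integral_congr_ae (Eventually.of_forall fun z => abs_of_nonneg (S.nonneg t ht _ _))).le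
  · exact S.isTransported.weakOn (S.field_continuous hε) hθ hp hpp hr hrc h0 hab

theorem integrable_mul_of_bounded (S : IsStrongSolution ε f V) {t : ℝ} (ht : 0 ≤ t) {Ψ : ℝ × ℝ → ℝ}
    (hΨ : Continuous Ψ) {C : ℝ} (hb : ∀ z, |Ψ z| ≤ C) :
    Integrable (fun z : ℝ × ℝ => f t z.1 z.2 * Ψ z) phaseMeasure :=
  (S.integrable t ht).mul_bdd (c := C) hΨ.aestronglyMeasurable (Eventually.of_forall hb)

theorem continuousOn_integral_of_bounded (S : IsStrongSolution ε f V) (hε : 0 < ε)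
    {Ψ : ℝ × ℝ → ℝ} (hΨ : Continuous Ψ) {C : ℝ} (hb : ∀ z, |Ψ z| ≤ C) :
    ContinuousOn (fun t => ∫ z, f t z.1 z.2 * Ψ z ∂phaseMeasure) (Ici 0) := by
  intro s hs
  have hC : 0 ≤ C := (abs_nonneg _).trans (hb 0)
  have hev : ∀ᶠ t in 𝓝[Ici 0] s, t ∈ Ici (0 : ℝ) := self_mem_nhdsWithin
  refine tendsto_integral_mul_of_weighted (ω := fun _ => 1) (Ψ := fun _ => Ψ) hC
    (fun _ => zero_le_one) ?_ ?_ ?_ ?_ (S.integrable s hs).aestronglyMeasurable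
    (Eventually.of_forall fun _ => hΨ.aestronglyMeasurable)
    (Eventually.of_forall fun _ z => by simpa using hb z) fun _ => tendsto_const_nhds
  · simpa [distL1] using S.distL1_tendsto_within hε hs
  · filter_upwards [hev] with t ht
    simpa using S.integrable t ht
  · filter_upwards [hev] with t ht using (S.integrable t ht).aestronglyMeasurable
  · simpa using S.integrable s hs

/-- The truncated square is bounded, hence an admissible test for f in L¹. The force is at most
2/ε², so the truncated moment y grows at rate at most (2/ε²)(y + 1), uniformly in δ. -/
theorem integral_truncSq_le (S : IsStrongSolution ε f V) (hε : 0 < ε) {vbar : ℝ}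
    (h0 : Integrable (fun z : ℝ × ℝ => f 0 z.1 z.2 * (z.2 - vbar) ^ 2) phaseMeasure)
    {δ : ℝ} (hδ : 0 < δ) {t : ℝ} (ht : 0 ≤ t) :
    ∫ z, f t z.1 z.2 * truncSq δ (z.2 - vbar) ∂phaseMeasure
      ≤ ((∫ z, f 0 z.1 z.2 * (z.2 - vbar) ^ 2 ∂phaseMeasure) + 2 / ε ^ 2 * t)
        * Real.exp (2 / ε ^ 2 * t) := by
  set C := 2 / ε ^ 2 with hC
  have hC0 : 0 < C := by positivity
  have hrC : ContDiff ℝ 1 fun v => truncSq δ (v - vbar) :=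
    (truncSq_contDiff hδ).comp (contDiff_id.sub contDiff_const)
  have hder : ∀ v, deriv (fun v => truncSq δ (v - vbar)) v = deriv (truncSq δ) (v - vbar) :=
    fun v => deriv_comp_sub_const (truncSq δ) vbar v
  have hc1 : Continuous fun z : ℝ × ℝ => truncSq δ (z.2 - vbar) :=
    hrC.continuous.comp continuous_snd
  have hb1 : ∀ z : ℝ × ℝ, |truncSq δ (z.2 - vbar)| ≤ 1 / δ := fun z => by
    rw [abs_of_nonneg (truncSq_nonneg hδ _)]; exact truncSq_le hδ _
  have hi : ∀ τ, 0 ≤ τ → Integrable (fun z : ℝ × ℝ => f τ z.1 z.2 * truncSq δ (z.2 - vbar))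
    phaseMeasure := fun τ hτ => S.integrable_mul_of_bounded hτ hc1 hb1
  set y : ℝ → ℝ := fun t => ∫ z, f t z.1 z.2 * truncSq δ (z.2 - vbar) ∂phaseMeasure with hy
  have hyc : ContinuousOn y (Ici 0) := S.continuousOn_integral_of_bounded hε hc1 hb1
  refine gronwall_integral (y := y) (k := fun _ => C) (κ := fun t => C * t) hyc continuous_const
    (fun _ => hC0.le) (fun t => by simpa using (hasDerivAt_id t).const_mul C) (by simp) hC0.le
    (fun t ht => ?_) ht
  have hw : WeakOn (field V) f 0 (fun _ => 1) (fun _ => 1) (fun v => truncSq δ (v - vbar)) 0 t := by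
    refine weakOn_of_forall_hasCompactSupport (S.field_continuous hε) S.continuousOn
      (ω := fun _ => 1 + 1 / δ) (B := 1 + 1 / δ) (C := max 1 C) le_rfl ht
      contDiff_const contDiff_const hrC
      (fun r' hr' hrc' => S.weakOn_of_hasCompactSupport hε contDiff_const contDiff_const
        (fun _ => rfl) hr' hrc' le_rfl ht)
      (fun τ hτ => (S.integrable τ hτ.1).mul_const _)
      (fun τ hτ => (S.integrable τ hτ.1).aestronglyMeasurable) (fun τ hτ => ?_) ?_ ?_ ?_ ?_ ?_ ?_ ?_
    · have e : ∀ z : ℝ × ℝ, |f τ z.1 z.2 * (1 + 1 / δ)| = f τ z.1 z.2 * (1 + 1 / δ) := fun z =>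
        abs_of_nonneg (mul_nonneg (S.nonneg τ hτ.1 _ _) (by positivity))
      simp only [e]
      rw [integral_mul_const, S.integral_eq_one hε hτ.1, one_mul]
    · intros; simp
    · intros; simp
    · intros; simp
    · exact fun t x => (S.abs_field_le hε t x).trans (le_max_right _ _)
    · exact fun v => (hb1 (0, v)).trans (by linarith)
    · intro v
      rw [hder]
      exact (abs_deriv_truncSq_le hδ _).trans (by linarith [truncSq_le hδ (v - vbar)])
    · intros; simp; positivity
  rw [WeakOn] at hw
  simp only [testFn, testFlow, deriv_const, hder] at hw
  simp only [mul_one, one_mul, mul_zero, zero_mul, zero_add, zero_sub] at hw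
  have hA : ∫ z, f 0 z.1 z.2 * truncSq δ (z.2 - vbar) ∂phaseMeasure
      ≤ ∫ z, f 0 z.1 z.2 * (z.2 - vbar) ^ 2 ∂phaseMeasure :=
    integral_mono (hi 0 le_rfl) h0 fun z =>
      mul_le_mul_of_nonneg_left (truncSq_le_sq hδ _) (S.nonneg 0 le_rfl _ _)
  have hcomp : ∫ τ in (0 : ℝ)..t, ∫ z, f τ z.1 z.2 * -(field V τ z.1 * deriv (truncSq δ) (z.2 - vbar))
      ∂phaseMeasure ≤ ∫ τ in (0 : ℝ)..t, (C * y τ + C) := by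
    have hyi : IntervalIntegrable (fun τ => C * y τ + C) volume 0 t := by
      refine ContinuousOn.intervalIntegrable ?_
      rw [uIcc_of_le ht]
      exact ((hyc.mono Icc_subset_Ici_self).const_smul C).add continuousOn_const
    have hbound : ∀ τ, 0 ≤ τ → |∫ z, f τ z.1 z.2 * -(field V τ z.1 *
        deriv (truncSq δ) (z.2 - vbar)) ∂phaseMeasure| ≤ C * y τ + C := by
      intro τ hτ
      have e : C * y τ + C = ∫ z, (C * (f τ z.1 z.2 * truncSq δ (z.2 - vbar)) + C * f τ z.1 z.2)
          ∂phaseMeasure := by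
        rw [integral_add ((hi τ hτ).const_mul C) ((S.integrable τ hτ).const_mul C),
          integral_const_mul, integral_const_mul, S.integral_eq_one hε hτ, mul_one]
      rw [e, ← Real.norm_eq_abs]
      refine norm_integral_le_of_norm_le (((hi τ hτ).const_mul C).add
        ((S.integrable τ hτ).const_mul C)) (Eventually.of_forall fun z => ?_)
      have hf := S.nonneg τ hτ z.1 z.2
      rw [norm_mul, norm_neg, norm_mul, Real.norm_of_nonneg hf, Real.norm_eq_abs, Real.norm_eq_abs]
      calc f τ z.1 z.2 * (|field V τ z.1| * |deriv (truncSq δ) (z.2 - vbar)|)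
          ≤ f τ z.1 z.2 * (C * (1 + truncSq δ (z.2 - vbar))) := by
            gcongr
            · exact S.abs_field_le hε _ _
            · exact abs_deriv_truncSq_le hδ _
        _ = _ := by ring
    have hdc : Continuous (deriv (truncSq δ)) := (truncSq_contDiff hδ).continuous_deriv le_rfl
    have hFc := S.field_continuous hε
    have hFz : Continuous fun z : ℝ × ℝ × ℝ => field V z.1 z.2.1 :=
      hFc.comp (f := fun z : ℝ × ℝ × ℝ => (z.1, z.2.1)) (by fun_prop)
    refine intervalIntegral.integral_mono_on ht ?_ hyi fun τ hτ =>
      (le_abs_self _).trans (hbound τ hτ.1)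
    refine hyi.mono_fun ?_ ?_
    · rw [uIoc_of_le ht]
      exact aestronglyMeasurable_integral_mul S.continuousOn
        (Ψ := fun τ z => -(field V τ z.1 * deriv (truncSq δ) (z.2 - vbar))) (by fun_prop) le_rfl
    · rw [uIoc_of_le ht]
      filter_upwards [ae_restrict_mem measurableSet_Ioc] with τ hτ
      exact (hbound τ hτ.1.le).trans (le_abs_self _)
  linarith

/-- Propagation of the second velocity moment. -/
theorem exists_second_moment_bound (S : IsStrongSolution ε f V) (hε : 0 < ε) {vbar : ℝ}
    (h0 : Integrable (fun z : ℝ × ℝ => f 0 z.1 z.2 * (z.2 - vbar) ^ 2) phaseMeasure) (T : ℝ) :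
    ∃ B, ∀ t ∈ Icc 0 T, Integrable (fun z : ℝ × ℝ => f t z.1 z.2 * (1 + (z.2 - vbar) ^ 2)) phaseMeasure
      ∧ ∫ z, f t z.1 z.2 * (1 + (z.2 - vbar) ^ 2) ∂phaseMeasure ≤ B := by
  set M0 := ∫ z, f 0 z.1 z.2 * (z.2 - vbar) ^ 2 ∂phaseMeasure with hM0
  have hM0nn : 0 ≤ M0 := integral_nonneg fun z => mul_nonneg (S.nonneg 0 le_rfl _ _) (sq_nonneg _)
  set B := (M0 + 2 / ε ^ 2 * T) * Real.exp (2 / ε ^ 2 * T) with hB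
  refine ⟨1 + B, fun t ht => ?_⟩
  have hT : 0 ≤ T := ht.1.trans ht.2
  have hBnn : 0 ≤ B := by positivity
  have hm : AEStronglyMeasurable (fun z : ℝ × ℝ => f t z.1 z.2 * (z.2 - vbar) ^ 2) phaseMeasure :=
    (S.integrable t ht.1).aestronglyMeasurable.mul (by fun_prop)
  have hle : ∫⁻ z, ENNReal.ofReal (f t z.1 z.2 * (z.2 - vbar) ^ 2) ∂phaseMeasure
      ≤ ENNReal.ofReal B := by
    -- As the truncation is removed, Fatou's lemma carries the uniform bound to the full second
    -- moment.
    let δ : ℕ → ℝ := fun n => 1 / ((n : ℝ) + 1)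
    have hδ : ∀ n, 0 < δ n := fun n => by simp only [δ]; positivity
    have hi : ∀ n, Integrable (fun z : ℝ × ℝ => f t z.1 z.2 * truncSq (δ n) (z.2 - vbar))
        phaseMeasure := fun n => S.integrable_mul_of_bounded ht.1
      ((truncSq_contDiff (hδ n)).continuous.comp (by fun_prop)) (C := 1 / δ n) fun z => by
        rw [abs_of_nonneg (truncSq_nonneg (hδ n) _)]; exact truncSq_le (hδ n) _
    have e : ∀ z : ℝ × ℝ, ENNReal.ofReal (f t z.1 z.2 * (z.2 - vbar) ^ 2)
        = liminf (fun n => ENNReal.ofReal (f t z.1 z.2 * truncSq (δ n) (z.2 - vbar))) atTop := by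
      intro z
      refine (Tendsto.liminf_eq ?_).symm
      refine ENNReal.tendsto_ofReal (Tendsto.const_mul _ ?_)
      have hδ0 : Tendsto δ atTop (𝓝 0) := tendsto_one_div_add_atTop_nhds_zero_nat
      have := (tendsto_const_nhds (x := (z.2 - vbar) ^ 2)).div
        ((hδ0.mul_const ((z.2 - vbar) ^ 2)).const_add 1) (by simp)
      simpa [truncSq, Pi.div_def] using this
    simp only [e]
    refine (lintegral_liminf_le' fun n => (hi n).aestronglyMeasurable.aemeasurable.ennreal_ofReal).trans ?_
    refine liminf_le_of_frequently_le' (Frequently.of_forall fun n => ?_)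
    rw [← ofReal_integral_eq_lintegral_ofReal (hi n) (Eventually.of_forall fun z =>
      mul_nonneg (S.nonneg t ht.1 _ _) (truncSq_nonneg (hδ n) _))]
    refine ENNReal.ofReal_le_ofReal ((S.integral_truncSq_le hε h0 (hδ n) ht.1).trans ?_)
    rw [hB]
    gcongr
    · exact ht.2
    · exact ht.2
  have hnn : ∀ z : ℝ × ℝ, 0 ≤ f t z.1 z.2 * (z.2 - vbar) ^ 2 := fun z =>
    mul_nonneg (S.nonneg t ht.1 _ _) (sq_nonneg _)
  have hint : Integrable (fun z : ℝ × ℝ => f t z.1 z.2 * (z.2 - vbar) ^ 2) phaseMeasure := by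
    refine ⟨hm, ?_⟩
    rw [hasFiniteIntegral_iff_ofReal (Eventually.of_forall hnn)]
    exact hle.trans_lt ENNReal.ofReal_lt_top
  have e : (fun z : ℝ × ℝ => f t z.1 z.2 * (1 + (z.2 - vbar) ^ 2))
      = fun z => f t z.1 z.2 + f t z.1 z.2 * (z.2 - vbar) ^ 2 := by ext z; ring
  rw [e]
  refine ⟨(S.integrable t ht.1).add hint, ?_⟩
  rw [integral_add (S.integrable t ht.1) hint, S.integral_eq_one hε ht.1]
  gcongr
  rw [← ofReal_integral_eq_lintegral_ofReal hint (Eventually.of_forall hnn)] at hle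
  exact (ENNReal.ofReal_le_ofReal_iff hBnn).1 hle

end IsStrongSolution

end VlasovPoisson
end
-- Tests of quadratic growth; continuity and differentiability of moments in time
open scoped ENNReal NNReal
noncomputable section
namespace VlasovPoisson

theorem exists_bound_of_periodic {q : ℝ → ℝ} (hq : Continuous q) (hqp : Function.Periodic q 1) :
    ∃ C, 0 ≤ C ∧ ∀ x, |q x| ≤ C := by
  obtain ⟨C, hC⟩ := isCompact_Icc (a := (0 : ℝ)) (b := 1) |>.exists_bound_of_continuousOn
    hq.continuousOn
  have h : ∀ x, |q x| ≤ C := fun x => by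
    obtain ⟨y, hy, hxy⟩ := hqp.exists_mem_Ico₀ one_pos x
    rw [hxy]; exact hC y ⟨hy.1, hy.2.le⟩
  exact ⟨C, (abs_nonneg _).trans (h 0), h⟩

namespace IsStrongSolution

variable {ε : ℝ} {f : ℝ → ℝ → ℝ → ℝ} {V : ℝ → ℝ → ℝ} {vbar : ℝ}

theorem integrable_weight (S : IsStrongSolution ε f V) (hε : 0 < ε)
    (h0 : Integrable (fun z : ℝ × ℝ => f 0 z.1 z.2 * (z.2 - vbar) ^ 2) phaseMeasure) {t : ℝ}
    (ht : 0 ≤ t) : Integrable (fun z : ℝ × ℝ => f t z.1 z.2 * (1 + (z.2 - vbar) ^ 2)) phaseMeasure := by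
  obtain ⟨B, hB⟩ := S.exists_second_moment_bound hε h0 t
  exact (hB t ⟨ht, le_rfl⟩).1

theorem integrable_mul (S : IsStrongSolution ε f V) (hε : 0 < ε)
    (h0 : Integrable (fun z : ℝ × ℝ => f 0 z.1 z.2 * (z.2 - vbar) ^ 2) phaseMeasure) {t : ℝ}
    (ht : 0 ≤ t) {Ψ : ℝ × ℝ → ℝ} (hΨ : Continuous Ψ) {C : ℝ}
    (hb : ∀ z, |Ψ z| ≤ C * (1 + (z.2 - vbar) ^ 2)) :
    Integrable (fun z : ℝ × ℝ => f t z.1 z.2 * Ψ z) phaseMeasure := by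
  refine ((S.integrable_weight hε h0 ht).const_mul C).mono'
    ((S.integrable t ht).aestronglyMeasurable.mul hΨ.aestronglyMeasurable)
    (Eventually.of_forall fun z => ?_)
  rw [norm_mul, Real.norm_of_nonneg (S.nonneg t ht _ _), Real.norm_eq_abs]
  calc f t z.1 z.2 * |Ψ z| ≤ f t z.1 z.2 * (C * (1 + (z.2 - vbar) ^ 2)) :=
        mul_le_mul_of_nonneg_left (hb z) (S.nonneg t ht _ _)
    _ = _ := by ring

theorem weakOn_of_le (S : IsStrongSolution ε f V) (hε : 0 < ε)
    (h0 : Integrable (fun z : ℝ × ℝ => f 0 z.1 z.2 * (z.2 - vbar) ^ 2) phaseMeasure) {c : ℝ}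
    {p r : ℝ → ℝ} (hp : ContDiff ℝ 1 p) (hpp : Function.Periodic p 1)
    (hr : ContDiff ℝ 1 r) {C : ℝ} (hr0 : ∀ v, |r v| ≤ C * (1 + (v - vbar) ^ 2))
    (hr1 : ∀ v, |deriv r v| ≤ C * (1 + (v - vbar) ^ 2))
    (hpr : ∀ x v, |(v - c) * deriv p x * r v| ≤ C * (1 + (v - vbar) ^ 2)) {a b : ℝ} (ha : 0 ≤ a)
    (hab : a ≤ b) : WeakOn (field V) f c (fun _ => 1) p r a b := by
  obtain ⟨B, hB⟩ := S.exists_second_moment_bound hε h0 b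
  obtain ⟨Cp, hCp0, hCp⟩ := exists_bound_of_periodic hp.continuous hpp
  have hmem : ∀ τ ∈ Icc a b, τ ∈ Icc 0 b := fun τ hτ => ⟨ha.trans hτ.1, hτ.2⟩
  have hC : 0 ≤ C := by
    have := (abs_nonneg _).trans (hr0 vbar)
    simpa using this
  refine weakOn_of_forall_hasCompactSupport (S.field_continuous hε) S.continuousOn
    (ω := fun v => C * (1 + (v - vbar) ^ 2)) (B := C * B)
    (C := max (max 1 Cp) (2 / ε ^ 2)) ha hab contDiff_const hp hr
    (fun r' hr' hrc' => S.weakOn_of_hasCompactSupport hε contDiff_const hp hpp hr' hrc' ha hab)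
    (fun τ hτ => ?_) (fun τ hτ => (S.integrable τ (hmem τ hτ).1).aestronglyMeasurable)
    (fun τ hτ => ?_) ?_ ?_ ?_ ?_ hr0 hr1 ?_
  · refine ((hB τ (hmem τ hτ)).1.const_mul C).congr (Eventually.of_forall fun z => ?_)
    ring
  · have e : ∀ z : ℝ × ℝ, |f τ z.1 z.2 * (C * (1 + (z.2 - vbar) ^ 2))|
        = C * (f τ z.1 z.2 * (1 + (z.2 - vbar) ^ 2)) := fun z => by
      rw [abs_of_nonneg (mul_nonneg (S.nonneg τ (hmem τ hτ).1 _ _) (by positivity))]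
      ring
    simp only [e]
    rw [integral_const_mul]
    exact mul_le_mul_of_nonneg_left (hB τ (hmem τ hτ)).2 hC
  · intros; simp
  · intros; simp
  · exact fun x => (hCp x).trans ((le_max_right _ _).trans (le_max_left _ _))
  · exact fun t x => (S.abs_field_le hε t x).trans (le_max_right _ _)
  · intro x v
    refine (hpr x v).trans ?_
    refine le_mul_of_one_le_left (by positivity) ((le_max_left _ _).trans (le_max_left _ _))

theorem secondMoment_sub (S : IsStrongSolution ε f V) (hε : 0 < ε)
    (h0 : Integrable (fun z : ℝ × ℝ => f 0 z.1 z.2 * (z.2 - vbar) ^ 2) phaseMeasure) {a b : ℝ}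
    (ha : 0 ≤ a) (hab : a ≤ b) :
    ∫ z, f b z.1 z.2 * (z.2 - vbar) ^ 2 ∂phaseMeasure
      - ∫ z, f a z.1 z.2 * (z.2 - vbar) ^ 2 ∂phaseMeasure
      = ∫ τ in a..b, ∫ z, f τ z.1 z.2 * (-2 * (field V τ z.1 * (z.2 - vbar))) ∂phaseMeasure := by
  have hder : ∀ v, deriv (fun v : ℝ => (v - vbar) ^ 2) v = 2 * (v - vbar) := fun v => by
    simp
  have hw : WeakOn (field V) f 0 (fun _ => 1) (fun _ => 1) (fun v => (v - vbar) ^ 2) a b := by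
    refine S.weakOn_of_le (C := 2) hε h0 contDiff_const (fun _ => rfl) (by fun_prop) (fun v => ?_)
      (fun v => ?_) (fun x v => ?_) ha hab
    · rw [abs_of_nonneg (sq_nonneg _)]; nlinarith [sq_nonneg (v - vbar)]
    · rw [hder, abs_le]
      constructor <;> nlinarith [sq_nonneg (v - vbar - 1), sq_nonneg (v - vbar + 1)]
    · simp; positivity
  rw [WeakOn] at hw
  simp only [testFn, testFlow, deriv_const, hder] at hw
  simp only [mul_one, one_mul, mul_zero, zero_mul, zero_add, zero_sub] at hw
  rw [hw]
  congr 1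
  ext τ
  congr 1
  ext z
  ring

theorem exists_lipschitz_secondMoment (S : IsStrongSolution ε f V) (hε : 0 < ε)
    (h0 : Integrable (fun z : ℝ × ℝ => f 0 z.1 z.2 * (z.2 - vbar) ^ 2) phaseMeasure) (T : ℝ) :
    ∃ C, ∀ a b, 0 ≤ a → a ≤ b → b ≤ T →
      |∫ z, f b z.1 z.2 * (z.2 - vbar) ^ 2 ∂phaseMeasure
      - ∫ z, f a z.1 z.2 * (z.2 - vbar) ^ 2 ∂phaseMeasure| ≤ C * (b - a) := by
  obtain ⟨B, hB⟩ := S.exists_second_moment_bound hε h0 T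
  refine ⟨2 / ε ^ 2 * B, fun a b ha hab hbT => ?_⟩
  rw [S.secondMoment_sub hε h0 ha hab, ← Real.norm_eq_abs, ← abs_of_nonneg (sub_nonneg.2 hab)]
  refine intervalIntegral.norm_integral_le_of_norm_le_const fun τ hτ => ?_
  rw [uIoc_of_le hab] at hτ
  have hτ' : τ ∈ Icc 0 T := ⟨ha.trans hτ.1.le, hτ.2.trans hbT⟩
  calc _ ≤ ∫ z, 2 / ε ^ 2 * (f τ z.1 z.2 * (1 + (z.2 - vbar) ^ 2)) ∂phaseMeasure := by
        refine norm_integral_le_of_norm_le ((hB τ hτ').1.const_mul _)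
          (Eventually.of_forall fun z => ?_)
        rw [norm_mul, Real.norm_of_nonneg (S.nonneg τ hτ'.1 _ _), mul_left_comm (2 / ε ^ 2)]
        refine mul_le_mul_of_nonneg_left ?_ (S.nonneg τ hτ'.1 _ _)
        have h1 := S.abs_field_le hε τ z.1
        have h2 : |2 * (z.2 - vbar)| ≤ 1 + (z.2 - vbar) ^ 2 := by
          rw [abs_le]
          constructor <;> nlinarith [sq_nonneg (z.2 - vbar - 1), sq_nonneg (z.2 - vbar + 1)]
        rw [show -2 * (field V τ z.1 * (z.2 - vbar)) = -(field V τ z.1 * (2 * (z.2 - vbar))) by ring,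
          norm_neg, norm_mul, Real.norm_eq_abs, Real.norm_eq_abs]
        gcongr
    _ ≤ 2 / ε ^ 2 * B := by
        rw [integral_const_mul]
        exact mul_le_mul_of_nonneg_left (hB τ hτ').2 (by positivity)

theorem continuousOn_of_lipschitz_increments {y : ℝ → ℝ}
    (h : ∀ T, ∃ C, ∀ a b, 0 ≤ a → a ≤ b → b ≤ T → |y b - y a| ≤ C * (b - a)) :
    ContinuousOn y (Ici 0) := by
  intro s hs
  obtain ⟨C, hC⟩ := h (s + 1)
  have h1 : ∀ᶠ t in 𝓝[Ici 0] s, t ∈ Ici (0 : ℝ) ∧ t < s + 1 := by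
    filter_upwards [self_mem_nhdsWithin, nhdsWithin_le_nhds (Iio_mem_nhds (lt_add_one s))]
      with t h1 h2 using ⟨h1, h2⟩
  have h2 : Tendsto (fun t => y t - y s) (𝓝[Ici 0] s) (𝓝 0) := by
    have h3 : Tendsto (fun t : ℝ => C * |t - s|) (𝓝[Ici 0] s) (𝓝 0) := by
      have : Continuous fun t : ℝ => C * |t - s| := by fun_prop
      simpa using (this.tendsto s).mono_left (nhdsWithin_le_nhds (s := Ici 0))
    refine squeeze_zero_norm' ?_ h3
    filter_upwards [h1] with t ht
    rcases le_total s t with hst | hst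
    · rw [abs_of_nonneg (sub_nonneg.2 hst)]; exact hC s t hs hst ht.2.le
    · rw [abs_sub_comm, abs_of_nonneg (sub_nonneg.2 hst), Real.norm_eq_abs, abs_sub_comm]
      exact hC t s ht.1 hst (by linarith)
  have h4 := h2.add_const (y s)
  simp only [sub_add_cancel, zero_add] at h4
  exact h4

theorem secondMoment_continuousOn (S : IsStrongSolution ε f V) (hε : 0 < ε)
    (h0 : Integrable (fun z : ℝ × ℝ => f 0 z.1 z.2 * (z.2 - vbar) ^ 2) phaseMeasure) :
    ContinuousOn (fun t => ∫ z, f t z.1 z.2 * (z.2 - vbar) ^ 2 ∂phaseMeasure) (Ici 0) :=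
  continuousOn_of_lipschitz_increments (S.exists_lipschitz_secondMoment hε h0)

theorem integrable_sq (S : IsStrongSolution ε f V) (hε : 0 < ε)
    (h0 : Integrable (fun z : ℝ × ℝ => f 0 z.1 z.2 * (z.2 - vbar) ^ 2) phaseMeasure) {t : ℝ}
    (ht : 0 ≤ t) : Integrable (fun z : ℝ × ℝ => f t z.1 z.2 * (z.2 - vbar) ^ 2) phaseMeasure :=
  S.integrable_mul hε h0 ht (C := 1) (by fun_prop) fun z => by
    rw [abs_of_nonneg (sq_nonneg _)]; linarith

/-- Strong solutions with finite energy are continuous in time in `L¹((1 + (v - v̄)²) dx dv)`. -/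
theorem tendsto_weighted (S : IsStrongSolution ε f V) (hε : 0 < ε)
    (h0 : Integrable (fun z : ℝ × ℝ => f 0 z.1 z.2 * (z.2 - vbar) ^ 2) phaseMeasure) {s : ℝ}
    (hs : 0 ≤ s) : Tendsto (fun t => ∫ z, |f t z.1 z.2 - f s z.1 z.2| * (1 + (z.2 - vbar) ^ 2)
      ∂phaseMeasure) (𝓝[Ici 0] s) (𝓝 0) := by
  set M : ℝ → ℝ := fun t => ∫ z, f t z.1 z.2 * (z.2 - vbar) ^ 2 ∂phaseMeasure with hM
  let tail : ℕ → ℝ := fun n => ∫ z, ({z : ℝ × ℝ | (n : ℝ) < (z.2 - vbar) ^ 2}).indicator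
    (fun z => f s z.1 z.2 * (z.2 - vbar) ^ 2) z ∂phaseMeasure
  have hms : ∀ n : ℕ, MeasurableSet {z : ℝ × ℝ | (n : ℝ) < (z.2 - vbar) ^ 2} := fun n =>
    measurableSet_lt measurable_const (by fun_prop)
  have hQs := S.integrable_sq hε h0 hs
  have htail : Tendsto tail atTop (𝓝 0) := by
    have : Tendsto tail atTop (𝓝 (∫ _z : ℝ × ℝ, (0 : ℝ) ∂phaseMeasure)) := by
      refine tendsto_integral_of_dominated_convergence (fun z => |f s z.1 z.2 * (z.2 - vbar) ^ 2|)
        (fun n => (hQs.indicator (hms n)).aestronglyMeasurable) hQs.abs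
        (fun n => Eventually.of_forall fun z => norm_indicator_le_norm_self _ _)
        (Eventually.of_forall fun z => ?_)
      obtain ⟨N, hN⟩ := exists_nat_ge ((z.2 - vbar) ^ 2)
      refine tendsto_const_nhds.congr' ?_
      filter_upwards [eventually_ge_atTop N] with n hn
      have hn' : (N : ℝ) ≤ n := by exact_mod_cast hn
      rw [indicator_of_notMem]
      simp only [mem_ofPred_eq, not_lt]
      linarith
    simpa using this
  -- Put d = f(t) - f(s) and w = (v-v̄)². Where w > n, use |d| ≤ d + 2f(s). Where w ≤ n, the weight
  -- costs n|d|, and a second n|d| compensates the sign of the term dw.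
  have hmain : ∀ t, 0 ≤ t → ∀ n : ℕ,
      ∫ z, |f t z.1 z.2 - f s z.1 z.2| * (1 + (z.2 - vbar) ^ 2) ∂phaseMeasure
        ≤ (1 + 2 * n) * distL1 f t s + (M t - M s) + 2 * tail n := by
    intro t ht n
    have hQt := S.integrable_sq hε h0 ht
    have hd := ((S.integrable t ht).sub (S.integrable s hs)).abs
    have e : (1 + 2 * (n : ℝ)) * distL1 f t s + (M t - M s) + 2 * tail n
        = ∫ z, ((1 + 2 * (n : ℝ)) * |f t z.1 z.2 - f s z.1 z.2|
          + (f t z.1 z.2 * (z.2 - vbar) ^ 2 - f s z.1 z.2 * (z.2 - vbar) ^ 2)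
          + 2 * ({z : ℝ × ℝ | (n : ℝ) < (z.2 - vbar) ^ 2}).indicator
            (fun z => f s z.1 z.2 * (z.2 - vbar) ^ 2) z) ∂phaseMeasure := by
      have i1 : Integrable (fun z : ℝ × ℝ => (1 + 2 * (n : ℝ)) * |f t z.1 z.2 - f s z.1 z.2|)
        phaseMeasure := hd.const_mul _
      have i2 : Integrable (fun z : ℝ × ℝ => f t z.1 z.2 * (z.2 - vbar) ^ 2
        - f s z.1 z.2 * (z.2 - vbar) ^ 2) phaseMeasure := hQt.sub hQs
      have i12 : Integrable (fun z : ℝ × ℝ => (1 + 2 * (n : ℝ)) * |f t z.1 z.2 - f s z.1 z.2|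
        + (f t z.1 z.2 * (z.2 - vbar) ^ 2 - f s z.1 z.2 * (z.2 - vbar) ^ 2)) phaseMeasure := i1.add i2
      rw [integral_add i12 ((hQs.indicator (hms n)).const_mul 2), integral_add i1 i2,
        integral_sub hQt hQs, integral_const_mul, integral_const_mul]
      rfl
    rw [e]
    refine integral_mono_of_nonneg (Eventually.of_forall fun z => by positivity)
      (((hd.const_mul _).add (hQt.sub hQs)).add ((hQs.indicator (hms n)).const_mul 2))
      (Eventually.of_forall fun z => ?_)
    have h1 := S.nonneg t ht z.1 z.2
    have h2 := S.nonneg s hs z.1 z.2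
    have hq := sq_nonneg (z.2 - vbar)
    simp only [indicator, mem_ofPred_eq]
    split_ifs with hz
    · rcases le_total (f t z.1 z.2) (f s z.1 z.2) with h | h
      · rw [abs_of_nonpos (by linarith)]
        nlinarith [mul_nonneg (n.cast_nonneg (α := ℝ)) (sub_nonneg.2 h), mul_nonneg h1 hq]
      · rw [abs_of_nonneg (by linarith)]
        nlinarith [mul_nonneg (n.cast_nonneg (α := ℝ)) (sub_nonneg.2 h), mul_nonneg h2 hq]
    · rw [not_lt] at hz
      rcases le_total (f t z.1 z.2) (f s z.1 z.2) with h | h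
      · rw [abs_of_nonpos (by linarith)]
        nlinarith [mul_le_mul_of_nonneg_left hz (sub_nonneg.2 h)]
      · rw [abs_of_nonneg (by linarith)]
        nlinarith [mul_nonneg (n.cast_nonneg (α := ℝ)) (sub_nonneg.2 h)]
  rw [Metric.tendsto_nhds]
  intro η hη
  obtain ⟨n, hn⟩ := (htail.eventually (gt_mem_nhds (show (0 : ℝ) < η / 4 by linarith))).exists
  have hlim : Tendsto (fun t => (1 + 2 * (n : ℝ)) * distL1 f t s + (M t - M s)) (𝓝[Ici 0] s)
      (𝓝 ((1 + 2 * (n : ℝ)) * 0 + (M s - M s))) :=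
    ((S.distL1_tendsto_within hε hs).const_mul _).add
      ((S.secondMoment_continuousOn hε h0 s hs).tendsto.sub_const _)
  rw [mul_zero, sub_self, add_zero] at hlim
  filter_upwards [hlim.eventually (gt_mem_nhds (show (0 : ℝ) < η / 2 by linarith)),
    self_mem_nhdsWithin] with t h1 h2
  rw [Real.dist_eq, sub_zero, abs_of_nonneg (integral_nonneg fun z => by positivity)]
  linarith [hmain t h2 n]

theorem continuousOn_integral (S : IsStrongSolution ε f V) (hε : 0 < ε)
    (h0 : Integrable (fun z : ℝ × ℝ => f 0 z.1 z.2 * (z.2 - vbar) ^ 2) phaseMeasure)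
    {Ψ : ℝ → ℝ × ℝ → ℝ} (hΨ : Continuous fun z : ℝ × ℝ × ℝ => Ψ z.1 z.2) {C : ℝ}
    (hb : ∀ t z, |Ψ t z| ≤ C * (1 + (z.2 - vbar) ^ 2)) :
    ContinuousOn (fun t => ∫ z, f t z.1 z.2 * Ψ t z ∂phaseMeasure) (Ici 0) := by
  intro s hs
  have hC : 0 ≤ C := by
    have := (abs_nonneg _).trans (hb 0 (0, vbar))
    simpa using this
  have hev : ∀ᶠ t in 𝓝[Ici 0] s, t ∈ Ici (0 : ℝ) := self_mem_nhdsWithin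
  refine tendsto_integral_mul_of_weighted (ω := fun z : ℝ × ℝ => 1 + (z.2 - vbar) ^ 2) (C := C) hC
    (fun _ => by positivity) (S.tendsto_weighted hε h0 hs) ?_ ?_ (S.integrable_weight hε h0 hs)
    (S.integrable s hs).aestronglyMeasurable (Eventually.of_forall fun t => ?_)
    (Eventually.of_forall hb) fun z => ?_
  · filter_upwards [hev] with t ht using S.integrable_weight hε h0 ht
  · filter_upwards [hev] with t ht using (S.integrable t ht).aestronglyMeasurable
  · exact (hΨ.comp (Continuous.prodMk_right t)).aestronglyMeasurable
  · have : Continuous fun t => Ψ t z := hΨ.comp (Continuous.prodMk_left z)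
    exact (this.tendsto s).mono_left nhdsWithin_le_nhds

/-- By the weak formulation the functional is a constant plus a primitive of an integrand continuous
on [0, ∞), so the fundamental theorem of calculus applies. -/
theorem hasDerivAt_integral (S : IsStrongSolution ε f V) (hε : 0 < ε)
    (h0 : Integrable (fun z : ℝ × ℝ => f 0 z.1 z.2 * (z.2 - vbar) ^ 2) phaseMeasure) {c : ℝ}
    {p r : ℝ → ℝ} (hp : ContDiff ℝ 1 p) (hpp : Function.Periodic p 1)
    (hr : ContDiff ℝ 1 r) {C : ℝ} (hr0 : ∀ v, |r v| ≤ C * (1 + (v - vbar) ^ 2))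
    (hr1 : ∀ v, |deriv r v| ≤ C * (1 + (v - vbar) ^ 2))
    (hpr : ∀ x v, |(v - c) * deriv p x * r v| ≤ C * (1 + (v - vbar) ^ 2)) {t : ℝ} (ht : 0 < t) :
    HasDerivAt (fun t => ∫ z, f t z.1 z.2 * (p (z.1 - c * t) * r z.2) ∂phaseMeasure)
      (∫ z, f t z.1 z.2 * ((z.2 - c) * deriv p (z.1 - c * t) * r z.2
        - field V t z.1 * p (z.1 - c * t) * deriv r z.2) ∂phaseMeasure) t := by
  obtain ⟨Cp, hCp0, hCp⟩ := exists_bound_of_periodic hp.continuous hpp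
  have hC : 0 ≤ C := by
    have := (abs_nonneg _).trans (hr0 vbar)
    simpa using this
  have hcont : Continuous fun z : ℝ × ℝ × ℝ => testFlow (field V) c (fun _ => 1) p r z.1 z.2 :=
    testFlow_continuous_uncurry (S.field_continuous hε) contDiff_const hp hr
  set φ : ℝ → ℝ := fun t => ∫ z, f t z.1 z.2 * testFlow (field V) c (fun _ => 1) p r t z
    ∂phaseMeasure with hφ
  have hφc : ContinuousOn φ (Ici 0) := by
    refine S.continuousOn_integral hε h0 (C := C + 2 / ε ^ 2 * Cp * C) hcont fun t z => ?_
    rw [testFlow, deriv_const, zero_mul, zero_mul, zero_add, one_mul, one_mul]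
    refine (abs_sub _ _).trans ?_
    rw [add_mul]
    refine add_le_add (hpr _ _) ?_
    rw [abs_mul, abs_mul]
    refine (mul_le_mul (mul_le_mul (S.abs_field_le hε _ _) (hCp _) (abs_nonneg _) (by positivity))
      (hr1 z.2) (abs_nonneg _) (by positivity)).trans_eq ?_
    ring
  have hφmax : Continuous fun s => φ (max s 0) :=
    hφc.comp_continuous (by fun_prop) fun s => mem_Ici.2 (le_max_right _ _)
  have hd : HasDerivAt (fun t => ∫ z, f 0 z.1 z.2 * testFn c (fun _ => 1) p r 0 z ∂phaseMeasure
      + ∫ s in (0 : ℝ)..t, φ (max s 0)) (φ (max t 0)) t :=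
    (intervalIntegral.integral_hasDerivAt_right (hφmax.intervalIntegrable _ _)
      (hφmax.stronglyMeasurableAtFilter _ _) hφmax.continuousAt).const_add _
  rw [max_eq_left ht.le] at hd
  have e1 : φ t = ∫ z, f t z.1 z.2 * ((z.2 - c) * deriv p (z.1 - c * t) * r z.2
        - field V t z.1 * p (z.1 - c * t) * deriv r z.2) ∂phaseMeasure := by
    simp only [hφ, testFlow, deriv_const, zero_mul, zero_add, one_mul]
  rw [← e1]
  refine hd.congr_of_eventuallyEq ?_
  filter_upwards [lt_mem_nhds ht] with u hu
  have hw := S.weakOn_of_le hε h0 hp hpp hr hr0 hr1 hpr le_rfl hu.le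
  rw [WeakOn] at hw
  have e2 : ∫ s in (0 : ℝ)..u, φ (max s 0) = ∫ s in (0 : ℝ)..u, φ s := by
    refine intervalIntegral.integral_congr fun s hs => ?_
    rw [uIcc_of_le hu.le] at hs
    simp only [max_eq_left hs.1]
  rw [e2, ← hw]
  simp only [testFn, one_mul]
  ring

end IsStrongSolution

end VlasovPoisson
end
-- Conservation of energy
open scoped ENNReal NNReal
noncomputable section
namespace VlasovPoisson

namespace IsStrongSolution

variable {ε : ℝ} {f : ℝ → ℝ → ℝ → ℝ} {V : ℝ → ℝ → ℝ} {vbar : ℝ}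

/-- No self-force: by the Maxwell stress identity with p = 1 the total force is the mean of the
field, which is zero. Hence the energy balance is insensitive to the shift of v by v̄. -/
theorem integral_mul_field_eq_zero (S : IsStrongSolution ε f V) (hε : 0 < ε) {t : ℝ} (ht : 0 ≤ t) :
    ∫ z, f t z.1 z.2 * field V t z.1 ∂phaseMeasure = 0 := by
  have := S.integral_mul_field hε ht (p := fun _ => 1) contDiff_const (fun _ => rfl)
  simpa [S.integral_field t] using this

theorem abs_le_weight (vbar v : ℝ) : |v| ≤ (1 + |vbar|) * (1 + (v - vbar) ^ 2) := by
  have h1 : |v| ≤ |v - vbar| + |vbar| := by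
    have := abs_add_le (v - vbar) vbar
    simpa using this
  have h2 : |v - vbar| ≤ 1 + (v - vbar) ^ 2 := by
    rw [abs_le]
    constructor <;> nlinarith [sq_nonneg (v - vbar - 1), sq_nonneg (v - vbar + 1)]
  nlinarith [mul_nonneg (abs_nonneg vbar) (sq_nonneg (v - vbar)), abs_nonneg vbar]

theorem abs_sub_le_weight (vbar v : ℝ) : |v - vbar| ≤ 1 + (v - vbar) ^ 2 := by
  rw [abs_le]
  constructor <;> nlinarith [sq_nonneg (v - vbar - 1), sq_nonneg (v - vbar + 1)]

/-- The total energy in the frame of the velocity `v̄`. -/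
def totalEnergy (vbar ε : ℝ) (f : ℝ → ℝ → ℝ → ℝ) (V : ℝ → ℝ → ℝ) (t : ℝ) : ℝ :=
  2⁻¹ * (∫ z, f t z.1 z.2 * (z.2 - vbar) ^ 2 ∂phaseMeasure)
    + ε ^ 2 / 2 * ∫ x in (0 : ℝ)..1, field V t x ^ 2

/-- The potential is never differentiated in time. As F(b)² - F(a)² = (F(b) - F(a))(F(a) + F(b)),
the Poisson equation turns the increment of the field energy into that of ∫f p with the fixed test p
= V(a) + V(b), half of which is then transported. With the kinetic increment, only the deviation of
F(τ) from the mean of the two end fields survives. -/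
theorem totalEnergy_sub (S : IsStrongSolution ε f V) (hε : 0 < ε)
    (h0 : Integrable (fun z : ℝ × ℝ => f 0 z.1 z.2 * (z.2 - vbar) ^ 2) phaseMeasure) {a b : ℝ}
    (ha : 0 ≤ a) (hab : a ≤ b) :
    totalEnergy vbar ε f V b - totalEnergy vbar ε f V a = ∫ τ in a..b, ∫ z, f τ z.1 z.2 *
      (z.2 * ((field V a z.1 + field V b z.1) / 2 - field V τ z.1)) ∂phaseMeasure := by
  have hb : 0 ≤ b := ha.trans hab
  have hFc := S.field_continuous hε
  have hFz : Continuous fun z : ℝ × ℝ × ℝ => field V z.1 z.2.1 :=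
    hFc.comp (f := fun z : ℝ × ℝ × ℝ => (z.1, z.2.1)) (by fun_prop)
  have hFa : Continuous (field V a) := S.field_continuous_space a
  have hFb : Continuous (field V b) := S.field_continuous_space b
  have hbd := S.abs_field_le hε
  set C := 2 / ε ^ 2 with hC
  have hC0 : 0 ≤ C := by positivity
  have e1 := S.secondMoment_sub hε h0 ha hab
  -- the potential energy
  set p : ℝ → ℝ := fun x => V a x + V b x with hp
  have hp1 : ContDiff ℝ 1 p := (S.potential_contDiff a ha).add (S.potential_contDiff b hb)
  have hpp : Function.Periodic p 1 := (S.potential_periodic a ha).add (S.potential_periodic b hb)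
  have hdp : ∀ x, deriv p x = field V a x + field V b x := fun x => by
    rw [hp, field_of_nonneg ha, field_of_nonneg hb]
    exact deriv_fun_add ((S.potential_contDiff a ha).differentiable (by norm_num) x)
      ((S.potential_contDiff b hb).differentiable (by norm_num) x)
  have e2 : WeakOn (field V) f 0 (fun _ => 1) p (fun _ => 1) a b := by
    refine S.weakOn_of_le (C := 1 + 2 * C * (1 + |vbar|)) hε h0 hp1 hpp contDiff_const (fun v => ?_)
      (fun v => ?_) (fun x v => ?_) ha hab
    · rw [abs_one]
      nlinarith [mul_nonneg hC0 (add_nonneg zero_le_one (abs_nonneg vbar)), sq_nonneg (v - vbar),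
        mul_nonneg (mul_nonneg hC0 (add_nonneg zero_le_one (abs_nonneg vbar)))
          (sq_nonneg (v - vbar))]
    · simp; positivity
    · rw [mul_one, sub_zero, abs_mul, hdp]
      have h1 : |field V a x + field V b x| ≤ 2 * C :=
        (abs_add_le _ _).trans (by linarith [hbd a x, hbd b x])
      calc |v| * |field V a x + field V b x| ≤ ((1 + |vbar|) * (1 + (v - vbar) ^ 2)) * (2 * C) :=
            mul_le_mul (abs_le_weight vbar v) h1 (abs_nonneg _) (by positivity)
        _ ≤ (1 + 2 * C * (1 + |vbar|)) * (1 + (v - vbar) ^ 2) := by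
            nlinarith [sq_nonneg (v - vbar)]
  rw [WeakOn] at e2
  simp only [testFn, testFlow, deriv_const, hdp] at e2
  simp only [mul_one, one_mul, mul_zero, zero_mul, zero_add, sub_zero] at e2
  have e3 := S.integral_mul_sub hε hb hp1 hpp
  have e4 := S.integral_mul_sub hε ha hp1 hpp
  simp only [hdp] at e3 e4
  have e5 : ε ^ 2 * (∫ x in (0 : ℝ)..1, field V b x ^ 2) - ε ^ 2 * (∫ x in (0 : ℝ)..1, field V a x ^ 2)
      = ∫ τ in a..b, ∫ z, f τ z.1 z.2 * (z.2 * (field V a z.1 + field V b z.1)) ∂phaseMeasure := by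
    rw [← e2, e3, e4, add_sub_add_left_eq_sub, ← mul_sub, ← mul_sub,
      ← intervalIntegral.integral_sub, ← intervalIntegral.integral_sub]
    · congr 2
      ext x
      ring
    all_goals exact Continuous.intervalIntegrable (by fun_prop) _ _
  have ci : ∀ Ψ : ℝ → ℝ × ℝ → ℝ, (Continuous fun z : ℝ × ℝ × ℝ => Ψ z.1 z.2) → ∀ C',
      (∀ t z, |Ψ t z| ≤ C' * (1 + (z.2 - vbar) ^ 2)) →
      IntervalIntegrable (fun τ => ∫ z, f τ z.1 z.2 * Ψ τ z ∂phaseMeasure) volume a b := by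
    intro Ψ hΨ C' hb'
    refine ContinuousOn.intervalIntegrable ?_
    rw [uIcc_of_le hab]
    exact (S.continuousOn_integral hε h0 hΨ hb').mono fun x hx => ha.trans hx.1
  have b1 : ∀ (t : ℝ) (z : ℝ × ℝ), |-2 * (field V t z.1 * (z.2 - vbar))|
      ≤ (2 * C) * (1 + (z.2 - vbar) ^ 2) := fun t z => by
    rw [abs_mul, abs_mul, abs_neg, abs_two, mul_assoc]
    gcongr
    · exact hbd _ _
    · exact abs_sub_le_weight _ _
  have b2 : ∀ (t : ℝ) (z : ℝ × ℝ), |z.2 * (field V a z.1 + field V b z.1)|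
      ≤ ((1 + |vbar|) * (2 * C)) * (1 + (z.2 - vbar) ^ 2) := fun t z => by
    rw [abs_mul, mul_right_comm]
    have h1 : |field V a z.1 + field V b z.1| ≤ 2 * C :=
      (abs_add_le _ _).trans (by linarith [hbd a z.1, hbd b z.1])
    gcongr
    exact abs_le_weight _ _
  have i1 := ci (fun t z => -2 * (field V t z.1 * (z.2 - vbar))) (by fun_prop) _ b1
  have i2 := ci (fun t z => z.2 * (field V a z.1 + field V b z.1)) (by fun_prop) _ b2
  rw [totalEnergy, totalEnergy]
  have e6 : 2⁻¹ * (∫ z, f b z.1 z.2 * (z.2 - vbar) ^ 2 ∂phaseMeasure)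
      + ε ^ 2 / 2 * (∫ x in (0 : ℝ)..1, field V b x ^ 2)
      - (2⁻¹ * (∫ z, f a z.1 z.2 * (z.2 - vbar) ^ 2 ∂phaseMeasure)
      + ε ^ 2 / 2 * ∫ x in (0 : ℝ)..1, field V a x ^ 2)
      = 2⁻¹ * ((∫ z, f b z.1 z.2 * (z.2 - vbar) ^ 2 ∂phaseMeasure
          - ∫ z, f a z.1 z.2 * (z.2 - vbar) ^ 2 ∂phaseMeasure)
        + (ε ^ 2 * (∫ x in (0 : ℝ)..1, field V b x ^ 2)
          - ε ^ 2 * (∫ x in (0 : ℝ)..1, field V a x ^ 2))) := by ring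
  rw [e6, e1, e5, ← intervalIntegral.integral_add i1 i2, ← intervalIntegral.integral_const_mul]
  refine intervalIntegral.integral_congr fun τ hτ => ?_
  rw [uIcc_of_le hab] at hτ
  have hτ0 := ha.trans hτ.1
  have hFτ : Continuous (field V τ) := S.field_continuous_space τ
  have j1 := S.integrable_mul hε h0 hτ0 (Ψ := fun z => -2 * (field V τ z.1 * (z.2 - vbar)))
    (by fun_prop) (b1 τ)
  have j2 := S.integrable_mul hε h0 hτ0 (Ψ := fun z => z.2 * (field V a z.1 + field V b z.1))
    (by fun_prop) (b2 τ)
  have j3 : Integrable (fun z : ℝ × ℝ => f τ z.1 z.2 * field V τ z.1) phaseMeasure :=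
    S.integrable_mul_of_bounded hτ0 (Ψ := fun z => field V τ z.1) (by fun_prop) fun z => hbd _ _
  have e7 := S.integral_mul_field_eq_zero hε hτ0
  rw [← integral_add j1 j2, ← integral_const_mul, ← sub_zero (∫ z, _ ∂phaseMeasure),
    ← mul_zero vbar, ← e7, ← integral_const_mul, ← integral_sub]
  · congr 1
    ext z
    ring
  · exact (j1.add j2).const_mul _
  · exact j3.const_mul _

theorem abs_totalEnergy_sub_le (S : IsStrongSolution ε f V) (hε : 0 < ε)
    (h0 : Integrable (fun z : ℝ × ℝ => f 0 z.1 z.2 * (z.2 - vbar) ^ 2) phaseMeasure) {T B : ℝ}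
    (hB : ∀ t ∈ Icc 0 T, Integrable (fun z : ℝ × ℝ => f t z.1 z.2 * (1 + (z.2 - vbar) ^ 2)) phaseMeasure
      ∧ ∫ z, f t z.1 z.2 * (1 + (z.2 - vbar) ^ 2) ∂phaseMeasure ≤ B) {a b η : ℝ}
    (ha : 0 ≤ a) (hab : a ≤ b) (hbT : b ≤ T)
    (hη : ∀ τ ∈ Icc a b, ∀ x, |(field V a x + field V b x) / 2 - field V τ x| ≤ η) :
    |totalEnergy vbar ε f V b - totalEnergy vbar ε f V a| ≤ η * ((1 + |vbar|) * B) * (b - a) := by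
  have hη0 : 0 ≤ η := (abs_nonneg _).trans (hη a ⟨le_rfl, hab⟩ 0)
  rw [S.totalEnergy_sub hε h0 ha hab, ← abs_of_nonneg (sub_nonneg.2 hab), ← Real.norm_eq_abs]
  refine intervalIntegral.norm_integral_le_of_norm_le_const fun τ hτ => ?_
  rw [uIoc_of_le hab] at hτ
  have hτ' : τ ∈ Icc 0 T := ⟨ha.trans hτ.1.le, hτ.2.trans hbT⟩
  calc _ ≤ ∫ z, (η * (1 + |vbar|)) * (f τ z.1 z.2 * (1 + (z.2 - vbar) ^ 2)) ∂phaseMeasure := by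
        refine norm_integral_le_of_norm_le ((hB τ hτ').1.const_mul _)
          (Eventually.of_forall fun z => ?_)
        rw [norm_mul, Real.norm_of_nonneg (S.nonneg τ hτ'.1 _ _),
          mul_left_comm (η * (1 + |vbar|))]
        refine mul_le_mul_of_nonneg_left ?_ (S.nonneg τ hτ'.1 _ _)
        rw [norm_mul, Real.norm_eq_abs, Real.norm_eq_abs]
        calc _ ≤ ((1 + |vbar|) * (1 + (z.2 - vbar) ^ 2)) * η :=
              mul_le_mul (abs_le_weight _ _) (hη τ ⟨hτ.1.le, hτ.2⟩ _) (abs_nonneg _) (by positivity)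
          _ = _ := by ring
    _ ≤ (η * (1 + |vbar|)) * B := by
        rw [integral_const_mul]
        exact mul_le_mul_of_nonneg_left (hB τ hτ').2 (by positivity)
    _ = _ := by ring

/-- Conservation of energy. -/
theorem totalEnergy_eq (S : IsStrongSolution ε f V) (hε : 0 < ε)
    (h0 : Integrable (fun z : ℝ × ℝ => f 0 z.1 z.2 * (z.2 - vbar) ^ 2) phaseMeasure) {T : ℝ}
    (hT : 0 ≤ T) : totalEnergy vbar ε f V T = totalEnergy vbar ε f V 0 := by
  have hcont : ContinuousOn (totalEnergy vbar ε f V) (Ici 0) := by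
    refine continuousOn_of_lipschitz_increments fun T => ?_
    obtain ⟨B, hB⟩ := S.exists_second_moment_bound hε h0 T
    refine ⟨2 * (2 / ε ^ 2) * ((1 + |vbar|) * B), fun a b ha hab hbT =>
      S.abs_totalEnergy_sub_le hε h0 hB ha hab hbT fun τ hτ x => ?_⟩
    have h1 := S.abs_field_le hε a x
    have h2 := S.abs_field_le hε b x
    have h3 := S.abs_field_le hε τ x
    rw [abs_le] at *
    constructor <;> linarith [h1.1, h1.2, h2.1, h2.2, h3.1, h3.2]
  obtain ⟨B, hB⟩ := S.exists_second_moment_bound hε h0 (T + 1)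
  have hB0 : 0 ≤ B := le_trans (integral_nonneg fun z =>
    mul_nonneg (S.nonneg 0 le_rfl _ _) (by positivity)) (hB 0 ⟨le_rfl, by linarith⟩).2
  -- On a short interval to the right of s the field hardly changes, so the energy increment is o(t
  -- - s) and the right derivative vanishes.
  refine constant_of_has_deriv_right_zero (a := 0) (b := T) (hcont.mono Icc_subset_Ici_self)
    (fun s hs => ?_) T ⟨hT, le_rfl⟩
  rw [hasDerivWithinAt_iff_isLittleO, Asymptotics.isLittleO_iff]
  intro η hη
  -- Chosen so that η' times the moment constant (1 + |v̄|)B is at most η; the added 1 keeps the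
  -- denominator positive.
  set η' := η / ((1 + |vbar|) * B + 1) with hη'
  have hη'0 : 0 < η' := by positivity
  have h1 : Tendsto (fun t => distL1 f t s / ε ^ 2) (𝓝[≥] s) (𝓝 0) := by
    simpa using (S.distL1_tendsto hε hs.1).1.div_const (ε ^ 2)
  have h2 := h1.eventually (gt_mem_nhds (show (0 : ℝ) < η' / 2 by positivity))
  obtain ⟨u, hu, hus⟩ := mem_nhdsGE_iff_exists_Ico_subset.1 h2
  have hu' : ∀ τ, s ≤ τ → τ < u → ∀ x, |field V τ x - field V s x| ≤ η' / 2 := fun τ h3 h4 x =>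
    (S.abs_field_sub_le hε (hs.1.trans h3) hs.1 x).trans (le_of_lt (hus ⟨h3, h4⟩))
  filter_upwards [Ico_mem_nhdsGE hu, Ico_mem_nhdsGE (show s < T + 1 by linarith [hs.2])]
    with t ht ht1
  have hle := S.abs_totalEnergy_sub_le hε h0 hB hs.1 ht.1 ht1.2.le (η := η') fun τ hτ x => by
    have a1 := hu' t ht.1 ht.2 x
    have a2 := hu' τ hτ.1 (hτ.2.trans_lt ht.2) x
    rw [abs_le] at *
    constructor <;> linarith [a1.1, a1.2, a2.1, a2.2]
  rw [smul_zero, sub_zero, Real.norm_eq_abs, Real.norm_of_nonneg (sub_nonneg.2 ht.1)]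
  refine hle.trans ?_
  gcongr
  · exact sub_nonneg.2 ht.1
  · rw [hη', div_mul_eq_mul_div, div_le_iff₀ (by positivity)]
    nlinarith

end IsStrongSolution

end VlasovPoisson
end
-- Moment equations in the moving frame and the derivative of the expanded energy
open scoped ENNReal NNReal
noncomputable section
namespace VlasovPoisson

/-- The velocity moments, relative to the velocity `v̄`, tested against `p(x - v̄t)`. -/
def mom (k : ℕ) (vbar : ℝ) (f : ℝ → ℝ → ℝ → ℝ) (p : ℝ → ℝ) (t : ℝ) : ℝ :=
  ∫ z, f t z.1 z.2 * (p (z.1 - vbar * t) * (z.2 - vbar) ^ k) ∂phaseMeasure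

/-- The powers of the force field, tested against `p(x - v̄t)`. -/
def fld (k : ℕ) (vbar : ℝ) (V : ℝ → ℝ → ℝ) (p : ℝ → ℝ) (t : ℝ) : ℝ :=
  ∫ x in (0 : ℝ)..1, field V t x ^ k * p (x - vbar * t)

theorem integral_periodic_sub {q : ℝ → ℝ} (hq : Function.Periodic q 1) (c : ℝ) :
    ∫ x in (0 : ℝ)..1, q (x - c) = ∫ x in (0 : ℝ)..1, q x := by
  rw [intervalIntegral.integral_comp_sub_right]
  have := hq.intervalIntegral_add_eq (0 - c) 0
  rw [zero_add] at this
  rw [← this]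
  congr 1
  ring

theorem deriv_comp_sub_mul (p : ℝ → ℝ) (c : ℝ) (x : ℝ) :
    deriv (fun x => p (x - c)) x = deriv p (x - c) := deriv_comp_sub_const p c x

namespace IsStrongSolution

variable {ε : ℝ} {f : ℝ → ℝ → ℝ → ℝ} {V : ℝ → ℝ → ℝ} {vbar : ℝ}

theorem hasDerivAt_mom_zero (S : IsStrongSolution ε f V) (hε : 0 < ε)
    (h0 : Integrable (fun z : ℝ × ℝ => f 0 z.1 z.2 * (z.2 - vbar) ^ 2) phaseMeasure)
    {p : ℝ → ℝ} (hp : ContDiff ℝ 1 p) (hpp : Function.Periodic p 1) {t : ℝ} (ht : 0 < t) :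
    HasDerivAt (mom 0 vbar f p) (mom 1 vbar f (deriv p) t) t := by
  obtain ⟨C, hC0, hC⟩ := exists_bound_of_periodic (hp.continuous_deriv le_rfl) (Periodic_deriv hpp)
  have h := S.hasDerivAt_integral hε h0 (c := vbar) hp hpp (r := fun _ => 1) contDiff_const
    (C := 1 + C) (fun v => ?_) (fun v => ?_) (fun x v => ?_) ht
  · have e0 : mom 0 vbar f p = fun t => ∫ z, f t z.1 z.2 * (p (z.1 - vbar * t) * 1)
        ∂phaseMeasure := by
      ext t; simp [mom]
    rw [e0]
    refine h.congr_deriv ?_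
    simp only [mom, deriv_const, mul_zero, sub_zero, mul_one, pow_one]
    congr 1
    ext z
    ring
  · rw [abs_one]; nlinarith [mul_nonneg hC0 (sq_nonneg (v - vbar)), sq_nonneg (v - vbar)]
  · simp; positivity
  · rw [mul_one, abs_mul]
    calc |v - vbar| * |deriv p x| ≤ (1 + (v - vbar) ^ 2) * C :=
          mul_le_mul (abs_sub_le_weight _ _) (hC x) (abs_nonneg _) (by positivity)
      _ ≤ _ := by nlinarith [sq_nonneg (v - vbar)]

theorem mom_zero_eq (S : IsStrongSolution ε f V) (hε : 0 < ε)
    {p : ℝ → ℝ} (hp : ContDiff ℝ 1 p) (hpp : Function.Periodic p 1) {t : ℝ} (ht : 0 ≤ t) :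
    mom 0 vbar f p t = (∫ x in (0 : ℝ)..1, p x) + ε ^ 2 * fld 1 vbar V (deriv p) t := by
  have h := S.integral_mul_sub hε ht (p := fun x => p (x - vbar * t))
    (hp.comp (contDiff_id.sub contDiff_const)) (fun x => by
      have := hpp (x - vbar * t)
      simp only
      rw [← this]; congr 1; ring)
  simp only [deriv_comp_sub_mul, integral_periodic_sub hpp] at h
  simpa [mom, fld] using h

/-- Momentum balance. The stress identity splits the nonlinear force ρF into the linear field, which
drives the plasma oscillation, and a quadratic stress. -/
theorem hasDerivAt_mom_one (S : IsStrongSolution ε f V) (hε : 0 < ε)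
    (h0 : Integrable (fun z : ℝ × ℝ => f 0 z.1 z.2 * (z.2 - vbar) ^ 2) phaseMeasure)
    {p : ℝ → ℝ} (hp : ContDiff ℝ 1 p) (hpp : Function.Periodic p 1) {t : ℝ} (ht : 0 < t) :
    HasDerivAt (mom 1 vbar f p) (mom 2 vbar f (deriv p) t - fld 1 vbar V p t
      - ε ^ 2 / 2 * fld 2 vbar V (deriv p) t) t := by
  obtain ⟨C, hC0, hC⟩ := exists_bound_of_periodic (hp.continuous_deriv le_rfl) (Periodic_deriv hpp)
  obtain ⟨C', hC'0, hC'⟩ := exists_bound_of_periodic hp.continuous hpp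
  have hd : ∀ v, deriv (fun v : ℝ => v - vbar) v = 1 := fun v => by simp
  have h := S.hasDerivAt_integral hε h0 (c := vbar) hp hpp (r := fun v => v - vbar)
    (contDiff_id.sub contDiff_const)
    (C := 1 + C) (fun v => ?_) (fun v => ?_) (fun x v => ?_) ht
  · have e0 : mom 1 vbar f p = fun t => ∫ z, f t z.1 z.2 * (p (z.1 - vbar * t) * (z.2 - vbar))
        ∂phaseMeasure := by
      ext t; simp [mom]
    rw [e0]
    refine h.congr_deriv ?_
    have hpt : ContDiff ℝ 1 fun x => p (x - vbar * t) := hp.comp (contDiff_id.sub contDiff_const)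
    have hft := S.field_continuous_space t
    have hdc : Continuous (deriv p) := hp.continuous_deriv le_rfl
    have hpc := hp.continuous
    have hF := S.integral_mul_field hε ht.le (p := fun x => p (x - vbar * t)) hpt (fun x => by
      have := hpp (x - vbar * t)
      simp only
      rw [← this]; congr 1; ring)
    simp only [deriv_comp_sub_mul] at hF
    have i1 : Integrable (fun z : ℝ × ℝ => f t z.1 z.2 *
        (deriv p (z.1 - vbar * t) * (z.2 - vbar) ^ 2)) phaseMeasure := by
      refine S.integrable_mul hε h0 ht.le (by fun_prop) (C := C) fun z => ?_
      rw [abs_mul, abs_of_nonneg (sq_nonneg (z.2 - vbar))]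
      refine mul_le_mul (hC _) (by linarith) (sq_nonneg _) hC0
    have i2 : Integrable (fun z : ℝ × ℝ => f t z.1 z.2 * (field V t z.1 * p (z.1 - vbar * t)))
        phaseMeasure := by
      refine S.integrable_mul_of_bounded ht.le (by fun_prop) (C := 2 / ε ^ 2 * C') fun z => ?_
      rw [abs_mul]
      exact mul_le_mul (S.abs_field_le hε _ _) (hC' _) (abs_nonneg _) (by positivity)
    have e1 : ∫ z, f t z.1 z.2 * ((z.2 - vbar) * deriv p (z.1 - vbar * t) * (z.2 - vbar)
        - field V t z.1 * p (z.1 - vbar * t) * deriv (fun v => v - vbar) z.2) ∂phaseMeasure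
        = mom 2 vbar f (deriv p) t
          - ∫ z, f t z.1 z.2 * (field V t z.1 * p (z.1 - vbar * t)) ∂phaseMeasure := by
      rw [mom, ← integral_sub i1 i2]
      congr 1
      ext z
      rw [hd]
      ring
    rw [e1, hF]
    simp only [fld, pow_one]
    ring
  · nlinarith [abs_sub_le_weight vbar v, mul_nonneg hC0 (sq_nonneg (v - vbar))]
  · rw [hd, abs_one]; nlinarith [mul_nonneg hC0 (sq_nonneg (v - vbar)), sq_nonneg (v - vbar)]
  · have : (v - vbar) * deriv p x * (v - vbar) = deriv p x * (v - vbar) ^ 2 := by ring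
    rw [this, abs_mul, abs_of_nonneg (sq_nonneg (v - vbar))]
    calc _ ≤ C * (1 + (v - vbar) ^ 2) :=
          mul_le_mul (hC _) (by linarith) (sq_nonneg _) hC0
      _ ≤ _ := by nlinarith [sq_nonneg (v - vbar)]

theorem continuousOn_mom (S : IsStrongSolution ε f V) (hε : 0 < ε)
    (h0 : Integrable (fun z : ℝ × ℝ => f 0 z.1 z.2 * (z.2 - vbar) ^ 2) phaseMeasure)
    {p : ℝ → ℝ} (hp : Continuous p) (hpp : Function.Periodic p 1) {k : ℕ} (hk : k ≤ 2) :
    ContinuousOn (mom k vbar f p) (Ici 0) := by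
  obtain ⟨C, hC0, hC⟩ := exists_bound_of_periodic hp hpp
  refine S.continuousOn_integral hε h0 (Ψ := fun t z => p (z.1 - vbar * t) * (z.2 - vbar) ^ k)
    (by fun_prop) (C := C) fun t z => ?_
  rw [abs_mul]
  refine mul_le_mul (hC _) ?_ (abs_nonneg _) hC0
  interval_cases k
  · simp; positivity
  · simpa using abs_sub_le_weight vbar z.2
  · rw [abs_of_nonneg (sq_nonneg _)]; linarith

theorem integrable_mom (S : IsStrongSolution ε f V) (hε : 0 < ε)
    (h0 : Integrable (fun z : ℝ × ℝ => f 0 z.1 z.2 * (z.2 - vbar) ^ 2) phaseMeasure)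
    {p : ℝ → ℝ} (hp : Continuous p) (hpp : Function.Periodic p 1) {k : ℕ} (hk : k ≤ 2) {t : ℝ}
    (ht : 0 ≤ t) : Integrable (fun z : ℝ × ℝ => f t z.1 z.2 *
      (p (z.1 - vbar * t) * (z.2 - vbar) ^ k)) phaseMeasure := by
  obtain ⟨C, hC0, hC⟩ := exists_bound_of_periodic hp hpp
  refine S.integrable_mul hε h0 ht (Ψ := fun z => p (z.1 - vbar * t) * (z.2 - vbar) ^ k)
    (by fun_prop) (C := C) fun z => ?_
  rw [abs_mul]
  refine mul_le_mul (hC _) ?_ (abs_nonneg _) hC0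
  interval_cases k
  · simp; positivity
  · simpa using abs_sub_le_weight vbar z.2
  · rw [abs_of_nonneg (sq_nonneg _)]; linarith

theorem continuous_fld (S : IsStrongSolution ε f V) (hε : 0 < ε) {p : ℝ → ℝ} (hp : Continuous p)
    (k : ℕ) : Continuous (fld k vbar V p) := by
  have hF := S.field_continuous hε
  have : Continuous (Function.uncurry fun t x => field V t x ^ k * p (x - vbar * t)) := by
    simp only [Function.uncurry_def]
    fun_prop
  exact intervalIntegral.continuous_parametric_intervalIntegral_of_continuous' this 0 1

/-- The kinetic and electric part of the filtered modulated energy, with the squares expanded and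
the conserved energy separated. -/
def expandedEnergy (vbar ε : ℝ) (V₀ : ℝ → ℝ) (f : ℝ → ℝ → ℝ → ℝ) (V : ℝ → ℝ → ℝ) (t : ℝ) : ℝ :=
  totalEnergy vbar ε f V t + Real.sin (t / ε) * mom 1 vbar f (deriv V₀) t
    + Real.sin (t / ε) ^ 2 / 2 * mom 0 vbar f (fun x => deriv V₀ x ^ 2) t
    - Real.cos (t / ε) * (ε * fld 1 vbar V (deriv V₀) t)
    + Real.cos (t / ε) ^ 2 / 2 * ∫ x in (0 : ℝ)..1, deriv V₀ x ^ 2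

theorem hasDerivAt_sin_div (ε t : ℝ) :
    HasDerivAt (fun t => Real.sin (t / ε)) (Real.cos (t / ε) / ε) t := by
  have := ((hasDerivAt_id t).div_const ε).sin
  simpa [div_eq_mul_inv] using this

theorem hasDerivAt_cos_div (ε t : ℝ) :
    HasDerivAt (fun t => Real.cos (t / ε)) (-Real.sin (t / ε) / ε) t := by
  have := ((hasDerivAt_id t).div_const ε).cos
  simpa [div_eq_mul_inv] using this

/-- A weak Ampère law. The field has no evolution equation of its own: the Poisson equation
expresses its moment through the charge, and the continuity equation is differentiated. The test
must be a derivative. -/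
theorem hasDerivAt_fld (S : IsStrongSolution ε f V) (hε : 0 < ε)
    (h0 : Integrable (fun z : ℝ × ℝ => f 0 z.1 z.2 * (z.2 - vbar) ^ 2) phaseMeasure)
    {p : ℝ → ℝ} (hp : ContDiff ℝ 1 p) (hpp : Function.Periodic p 1) {t : ℝ} (ht : 0 < t) :
    HasDerivAt (fun t => ε * fld 1 vbar V (deriv p) t) (mom 1 vbar f (deriv p) t / ε) t := by
  have h := ((S.hasDerivAt_mom_zero hε h0 hp hpp ht).sub_const (∫ x in (0 : ℝ)..1, p x)).div_const ε
  refine h.congr_of_eventuallyEq ?_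
  filter_upwards [lt_mem_nhds ht] with u hu
  rw [S.mom_zero_eq hε hp hpp hu.le]
  field_simp
  ring

/-- The rotation of the pair (current, ε times field) at frequency 1/ε matches the phases: the terms
(c/ε)∫f(v-v̄)W and s∫FW cancel. By the Poisson equation the charge term with W² differs from ∫W²
only by 2ε²∫F WW', which leaves the bounded contribution 2sc·ε∫F WW'. -/
theorem hasDerivAt_expandedEnergy (S : IsStrongSolution ε f V) (hε : 0 < ε)
    (h0 : Integrable (fun z : ℝ × ℝ => f 0 z.1 z.2 * (z.2 - vbar) ^ 2) phaseMeasure)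
    {V₀ : ℝ → ℝ} (hV : ContDiff ℝ 3 V₀) (hVp : Function.Periodic V₀ 1) {t : ℝ} (ht : 0 < t) :
    HasDerivAt (expandedEnergy vbar ε V₀ f V)
      (Real.sin (t / ε) * (mom 2 vbar f (deriv (deriv V₀)) t
          - ε ^ 2 / 2 * fld 2 vbar V (deriv (deriv V₀)) t)
        + Real.sin (t / ε) ^ 2 * mom 1 vbar f (fun x => deriv V₀ x * deriv (deriv V₀) x) t
        + 2 * Real.sin (t / ε) * Real.cos (t / ε) *
          (ε * fld 1 vbar V (fun x => deriv V₀ x * deriv (deriv V₀) x) t)) t := by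
  have hW : ContDiff ℝ 2 (deriv V₀) := by
    have := (contDiff_succ_iff_deriv (n := 2)).1 hV
    exact this.2.2
  have hW1 : ContDiff ℝ 1 (deriv V₀) := hW.of_le (by norm_num)
  have hV1 : ContDiff ℝ 1 V₀ := hV.of_le (by norm_num)
  have hWp := Periodic_deriv hVp
  have hW2 : ContDiff ℝ 1 fun x => deriv V₀ x ^ 2 := hW1.pow 2
  have hW2p : Function.Periodic (fun x => deriv V₀ x ^ 2) 1 := fun x => by
    simp only [hWp x]
  have hdW2 : deriv (fun x => deriv V₀ x ^ 2) = fun x => 2 * (deriv V₀ x * deriv (deriv V₀) x) := by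
    ext x
    rw [deriv_fun_pow (hW1.differentiable (by norm_num) x)]
    simp
    ring
  have e2m : ∀ k, mom k vbar f (fun x => 2 * (deriv V₀ x * deriv (deriv V₀) x)) t
      = 2 * mom k vbar f (fun x => deriv V₀ x * deriv (deriv V₀) x) t := fun k => by
    simp only [mom]
    rw [← integral_const_mul]
    congr 1
    ext z
    ring
  have e2f : ∀ k, fld k vbar V (fun x => 2 * (deriv V₀ x * deriv (deriv V₀) x)) t
      = 2 * fld k vbar V (fun x => deriv V₀ x * deriv (deriv V₀) x) t := fun k => by
    simp only [fld]
    rw [← intervalIntegral.integral_const_mul]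
    congr 1
    ext z
    ring
  have hs := hasDerivAt_sin_div ε t
  have hc := hasDerivAt_cos_div ε t
  have d0 : HasDerivAt (totalEnergy vbar ε f V) 0 t := by
    refine (hasDerivAt_const t (totalEnergy vbar ε f V 0)).congr_of_eventuallyEq ?_
    filter_upwards [lt_mem_nhds ht] with u hu using S.totalEnergy_eq hε h0 hu.le
  have d1 := hs.mul (S.hasDerivAt_mom_one hε h0 hW1 hWp ht)
  have d2 := ((hs.pow 2).div_const 2).mul (S.hasDerivAt_mom_zero hε h0 hW2 hW2p ht)
  have d3 := hc.mul (S.hasDerivAt_fld hε h0 hV1 hVp ht)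
  have d4 := ((hc.pow 2).div_const 2).mul_const (∫ x in (0 : ℝ)..1, deriv V₀ x ^ 2)
  have d := (((d0.add d1).add d2).sub d3).add d4
  refine d.congr_deriv ?_
  rw [S.mom_zero_eq hε hW2 hW2p ht.le, hdW2, e2m, e2f]
  simp only [Pi.pow_apply]
  field_simp
  ring

/-- The slowly varying combination of current and field. -/
def rotated (vbar ε : ℝ) (V₀ : ℝ → ℝ) (f : ℝ → ℝ → ℝ → ℝ) (V : ℝ → ℝ → ℝ) (t : ℝ) : ℝ :=
  Real.cos (t / ε) * (ε * fld 1 vbar V (fun x => deriv V₀ x * deriv (deriv V₀) x) t)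
    - Real.sin (t / ε) * mom 1 vbar f (fun x => deriv V₀ x * deriv (deriv V₀) x) t

/-- Sine and cosine undo the plasma rotation, so only the quadratic fluxes remain in the derivative.
The field law applies because WW' is the derivative of W²/2. -/
theorem hasDerivAt_rotated (S : IsStrongSolution ε f V) (hε : 0 < ε)
    (h0 : Integrable (fun z : ℝ × ℝ => f 0 z.1 z.2 * (z.2 - vbar) ^ 2) phaseMeasure)
    {V₀ : ℝ → ℝ} (hV : ContDiff ℝ 3 V₀) (hVp : Function.Periodic V₀ 1) {t : ℝ} (ht : 0 < t) :
    HasDerivAt (rotated vbar ε V₀ f V)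
      (-Real.sin (t / ε) * (mom 2 vbar f (deriv fun x => deriv V₀ x * deriv (deriv V₀) x) t
          - ε ^ 2 / 2 * fld 2 vbar V (deriv fun x => deriv V₀ x * deriv (deriv V₀) x) t)) t := by
  have hW : ContDiff ℝ 2 (deriv V₀) := ((contDiff_succ_iff_deriv (n := 2)).1 hV).2.2
  have hW1 : ContDiff ℝ 1 (deriv V₀) := hW.of_le (by norm_num)
  have hW' : ContDiff ℝ 1 (deriv (deriv V₀)) := ((contDiff_succ_iff_deriv (n := 1)).1 hW).2.2
  have hWp := Periodic_deriv hVp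
  have hG : ContDiff ℝ 1 fun x => deriv V₀ x * deriv (deriv V₀) x := hW1.mul hW'
  have hGp : Function.Periodic (fun x => deriv V₀ x * deriv (deriv V₀) x) 1 :=
    hWp.mul (Periodic_deriv hWp)
  set G : ℝ → ℝ := fun x => deriv V₀ x * deriv (deriv V₀) x with hGdef
  have hP : ContDiff ℝ 1 fun x => deriv V₀ x ^ 2 / 2 := (hW1.pow 2).div_const 2
  have hPp : Function.Periodic (fun x => deriv V₀ x ^ 2 / 2) 1 := fun x => by
    simp only [hWp x]
  have hdP : deriv (fun x => deriv V₀ x ^ 2 / 2) = G := by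
    ext x
    rw [deriv_div_const, deriv_fun_pow (hW1.differentiable (by norm_num) x)]
    simp [hGdef]
    ring
  have hs := hasDerivAt_sin_div ε t
  have hc := hasDerivAt_cos_div ε t
  have d1 := S.hasDerivAt_fld hε h0 hP hPp ht
  rw [hdP] at d1
  have d2 := S.hasDerivAt_mom_one hε h0 hG hGp ht
  refine ((hc.mul d1).sub (hs.mul d2)).congr_deriv ?_
  field_simp
  ring

end IsStrongSolution

end VlasovPoisson
end
-- Stable profiles, admissible functions and conservation of the Casimir quantities
open scoped ENNReal NNReal
noncomputable section
namespace VlasovPoisson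

namespace IsSStable

variable {μ : ℝ → ℝ} {vbar : ℝ}

/-- A nonintegrable function has integral 0 by convention, against the normalisation. -/
theorem integrable (P : IsSStable μ vbar) : Integrable μ := by
  by_contra h
  have := P.integral_eq_one
  rw [integral_undef h] at this
  exact zero_ne_one this

/-- If μ(w) ≤ 0 with w ≤ v̄, monotonicity keeps μ below the negative number μ(w - 1) on a half line,
against integrability. Symmetry covers the other side. -/
theorem pos (P : IsSStable μ vbar) (v : ℝ) : 0 < μ v := by
  have key : ∀ w, w ≤ vbar → 0 < μ w := by
    intro w hw
    by_contra hn
    have h1 : μ (w - 1) < 0 :=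
      (P.strictMonoOn (show w - 1 ≤ vbar by linarith) hw (by linarith)).trans_le (not_lt.1 hn)
    have h2 := P.integrable.measure_norm_ge_lt_top (neg_pos.2 h1)
    have h3 : Iic (w - 1) ⊆ {x | -μ (w - 1) ≤ ‖μ x‖} := by
      intro x hx
      have : μ x ≤ μ (w - 1) := P.strictMonoOn.monotoneOn
        (show x ≤ vbar by have := mem_Iic.1 hx; linarith) (show w - 1 ≤ vbar by linarith) hx
      rw [mem_ofPred_eq, Real.norm_eq_abs]
      exact (neg_le_neg this).trans (neg_le_abs _)
    have h4 := (measure_mono h3).trans_lt h2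
    rw [Real.volume_Iic] at h4
    exact lt_irrefl _ h4
  rcases le_total v vbar with h | h
  · exact key v h
  · rw [← P.symmetric v]
    exact key _ (by linarith)

end IsSStable

/-- The part of the density of the Casimir functional which does not depend on the distribution
function. -/
def casimirConst (Q μ : ℝ → ℝ) (vbar v : ℝ) : ℝ := -Q (μ v) - (v - vbar) ^ 2 / 2 * μ v

namespace IsAdmissible

variable {μ Q : ℝ → ℝ} {vbar : ℝ}

theorem deriv_profile (A : IsAdmissible μ vbar Q) (P : IsSStable μ vbar) (v : ℝ) :
    deriv Q (μ v) = -(v - vbar) ^ 2 / 2 := by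
  rw [P.eq_profileFun v]
  exact A.deriv_profileFun _ (by nlinarith [sq_nonneg (v - vbar)])

theorem convexOn (A : IsAdmissible μ vbar Q) : ConvexOn ℝ (Ici 0) Q :=
  MonotoneOn.convexOn_of_deriv (convex_Ici 0) A.continuousOn
    (by rw [interior_Ici]; exact A.differentiableOn)
    (by rw [interior_Ici]; exact A.deriv_monotoneOn)

theorem tangent_le (A : IsAdmissible μ vbar Q) {m g : ℝ} (hm : 0 < m) (hg : 0 ≤ g) :
    Q m + deriv Q m * (g - m) ≤ Q g := by
  have hd : HasDerivAt Q (deriv Q m) m :=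
    (A.differentiableOn.differentiableAt (Ioi_mem_nhds hm)).hasDerivAt
  rcases lt_trichotomy m g with h | h | h
  · have := A.convexOn.le_slope_of_hasDerivAt hm.le hg h hd
    rw [slope_def_field, le_div_iff₀ (sub_pos.2 h)] at this
    linarith
  · simp [h]
  · have := A.convexOn.slope_le_of_hasDerivAt hg hm.le h hd
    rw [slope_def_field, div_le_iff₀ (sub_pos.2 h)] at this
    linarith

theorem density_eq (A : IsAdmissible μ vbar Q) (P : IsSStable μ vbar) (g v : ℝ) :
    Q g - Q (μ v) - deriv Q (μ v) * (g - μ v)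
      = Q g + (v - vbar) ^ 2 / 2 * g + casimirConst Q μ vbar v := by
  rw [A.deriv_profile P, casimirConst]
  ring

theorem density_nonneg (A : IsAdmissible μ vbar Q) (P : IsSStable μ vbar) {g : ℝ} (hg : 0 ≤ g)
    (v : ℝ) : 0 ≤ Q g + (v - vbar) ^ 2 / 2 * g + casimirConst Q μ vbar v := by
  rw [← A.density_eq P]
  linarith [A.tangent_le (P.pos v) hg]

theorem casimirConst_nonneg (A : IsAdmissible μ vbar Q) (P : IsSStable μ vbar) (v : ℝ) :
    0 ≤ casimirConst Q μ vbar v := by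
  simpa [A.zero] using A.density_nonneg P le_rfl v

/-- Q is controlled on [0, ∞) only. This extension agrees with Q on the values of f and supplies
measurability on the whole line. -/
theorem continuous_extend (A : IsAdmissible μ vbar Q) : Continuous fun s => Q (max s 0) :=
  A.continuousOn.comp_continuous (by fun_prop) fun _ => mem_Ici.2 (le_max_right _ _)

theorem casimirConst_continuous (A : IsAdmissible μ vbar Q) (P : IsSStable μ vbar) :
    Continuous (casimirConst Q μ vbar) := by
  have h1 : Continuous fun v => Q (μ v) :=
    A.continuousOn.comp_continuous P.continuous fun v => (P.pos v).le
  have h2 : Continuous fun v : ℝ => (v - vbar) ^ 2 / 2 := by fun_prop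
  exact h1.neg.sub (h2.mul P.continuous)

end IsAdmissible

/-- The shear `(x, v) ↦ (x, v + u(x))`. -/
def shear (u : ℝ → ℝ) (hu : Measurable u) : ℝ × ℝ ≃ᵐ ℝ × ℝ where
  toFun z := (z.1, z.2 + u z.1)
  invFun z := (z.1, z.2 - u z.1)
  left_inv z := by simp
  right_inv z := by simp
  measurable_toFun := by
    change Measurable fun z : ℝ × ℝ => (z.1, z.2 + u z.1)
    fun_prop
  measurable_invFun := by
    change Measurable fun z : ℝ × ℝ => (z.1, z.2 - u z.1)
    fun_prop

theorem shear_apply (u : ℝ → ℝ) (hu : Measurable u) (z : ℝ × ℝ) :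
    shear u hu z = (z.1, z.2 + u z.1) := rfl

theorem measurePreserving_shear (u : ℝ → ℝ) (hu : Measurable u) :
    MeasurePreserving (shear u hu) phaseMeasure phaseMeasure :=
  (MeasurePreserving.id (volume.restrict (Ioc (0 : ℝ) 1))).skew_product
    (g := fun x v => v + u x) (by simp only [Function.uncurry_def]; fun_prop)
    (Eventually.of_forall fun x => (measurePreserving_add_right volume (u x)).map_eq)

namespace IsStrongSolution

variable {ε : ℝ} {f : ℝ → ℝ → ℝ → ℝ} {V : ℝ → ℝ → ℝ} {vbar : ℝ} {μ Q : ℝ → ℝ}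

theorem aestronglyMeasurable_casimir (S : IsStrongSolution ε f V) (A : IsAdmissible μ vbar Q)
    {t : ℝ} (ht : 0 ≤ t) :
    AEStronglyMeasurable (fun z : ℝ × ℝ => Q (f t z.1 z.2)) phaseMeasure := by
  refine (A.continuous_extend.comp_aestronglyMeasurable
    (S.integrable t ht).aestronglyMeasurable).congr (Eventually.of_forall fun z => ?_)
  simp [S.nonneg t ht z.1 z.2]

theorem aestronglyMeasurable_bound (S : IsStrongSolution ε f V) (A : IsAdmissible μ vbar Q)
    {t : ℝ} (ht : 0 ≤ t) : AEStronglyMeasurable (fun z : ℝ × ℝ =>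
      |Q (f t z.1 z.2)| + Q (f t z.1 z.2) ^ 2 / f t z.1 z.2) phaseMeasure := by
  have h1 := (S.aestronglyMeasurable_casimir A ht).aemeasurable
  have h2 := (S.integrable t ht).aestronglyMeasurable.aemeasurable
  exact ((h1.norm).add ((h1.pow_const 2).div h2)).aestronglyMeasurable

theorem bound_nonneg (S : IsStrongSolution ε f V) {t : ℝ} (ht : 0 ≤ t) (z : ℝ × ℝ) :
    0 ≤ |Q (f t z.1 z.2)| + Q (f t z.1 z.2) ^ 2 / f t z.1 z.2 :=
  add_nonneg (abs_nonneg _) (div_nonneg (sq_nonneg _) (S.nonneg t ht _ _))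

theorem integrable_bound_iff (S : IsStrongSolution ε f V) (A : IsAdmissible μ vbar Q)
    {t : ℝ} (ht : 0 ≤ t) : Integrable (fun z : ℝ × ℝ =>
      |Q (f t z.1 z.2)| + Q (f t z.1 z.2) ^ 2 / f t z.1 z.2) phaseMeasure
      ↔ casimirBound Q (f t) < ⊤ := by
  rw [Integrable, and_iff_right (S.aestronglyMeasurable_bound A ht),
    hasFiniteIntegral_iff_ofReal (Eventually.of_forall (S.bound_nonneg ht)), casimirBound]

theorem casimirBound_eq (S : IsStrongSolution ε f V) (hε : 0 < ε) (A : IsAdmissible μ vbar Q)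
    {t : ℝ} (ht : 0 ≤ t) : casimirBound Q (f t) = casimirBound Q (f 0) := by
  have hm : Measurable fun s => Q (max s 0) := A.continuous_extend.measurable
  have h := S.lintegral_comp_eq hε
    (G := fun s => ENNReal.ofReal (|Q (max s 0)| + Q (max s 0) ^ 2 / s))
    (((hm.norm).add ((hm.pow_const 2).div measurable_id)).ennreal_ofReal) (by simp [A.zero]) ht
  simp only [max_eq_left (S.nonneg t ht _ _), max_eq_left (S.nonneg 0 le_rfl _ _)] at h
  exact h

theorem integrable_bound (S : IsStrongSolution ε f V) (hε : 0 < ε) (A : IsAdmissible μ vbar Q)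
    (hQ : casimirBound Q (f 0) < ⊤) {t : ℝ} (ht : 0 ≤ t) : Integrable (fun z : ℝ × ℝ =>
      |Q (f t z.1 z.2)| + Q (f t z.1 z.2) ^ 2 / f t z.1 z.2) phaseMeasure := by
  rw [S.integrable_bound_iff A ht, S.casimirBound_eq hε A ht]
  exact hQ

theorem integral_bound (S : IsStrongSolution ε f V) (hε : 0 < ε) (A : IsAdmissible μ vbar Q)
    {t : ℝ} (ht : 0 ≤ t) :
    ∫ z, (|Q (f t z.1 z.2)| + Q (f t z.1 z.2) ^ 2 / f t z.1 z.2) ∂phaseMeasure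
      = (casimirBound Q (f 0)).toReal := by
  rw [integral_eq_lintegral_of_nonneg_ae (Eventually.of_forall (S.bound_nonneg ht))
    (S.aestronglyMeasurable_bound A ht), ← S.casimirBound_eq hε A ht, casimirBound]

theorem integrable_casimir (S : IsStrongSolution ε f V) (hε : 0 < ε) (A : IsAdmissible μ vbar Q)
    (hQ : casimirBound Q (f 0) < ⊤) {t : ℝ} (ht : 0 ≤ t) :
    Integrable (fun z : ℝ × ℝ => Q (f t z.1 z.2)) phaseMeasure := by
  refine (S.integrable_bound hε A hQ ht).mono' (S.aestronglyMeasurable_casimir A ht)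
    (Eventually.of_forall fun z => ?_)
  rw [Real.norm_eq_abs]
  exact le_add_of_nonneg_right (div_nonneg (sq_nonneg _) (S.nonneg t ht _ _))

theorem integral_casimir_eq (S : IsStrongSolution ε f V) (hε : 0 < ε) (A : IsAdmissible μ vbar Q)
    (hQ : casimirBound Q (f 0) < ⊤) {t : ℝ} (ht : 0 ≤ t) :
    ∫ z, Q (f t z.1 z.2) ∂phaseMeasure = ∫ z, Q (f 0 z.1 z.2) ∂phaseMeasure := by
  have hm : Measurable fun s => Q (max s 0) := A.continuous_extend.measurable
  rw [integral_eq_lintegral_pos_part_sub_lintegral_neg_part (S.integrable_casimir hε A hQ ht),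
    integral_eq_lintegral_pos_part_sub_lintegral_neg_part (S.integrable_casimir hε A hQ le_rfl)]
  have h1 := S.lintegral_comp_eq hε (G := fun s => ENNReal.ofReal (Q (max s 0)))
    hm.ennreal_ofReal (by simp [A.zero]) ht
  have h2 := S.lintegral_comp_eq hε (G := fun s => ENNReal.ofReal (-Q (max s 0)))
    hm.neg.ennreal_ofReal (by simp [A.zero]) ht
  simp only [max_eq_left (S.nonneg t ht _ _), max_eq_left (S.nonneg 0 le_rfl _ _)] at h1 h2
  rw [h1, h2]

/-- `|Q(f)| |w| ≤ (Q(f)²/f + f w²)/2`. -/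
theorem abs_casimir_mul_le (S : IsStrongSolution ε f V) (A : IsAdmissible μ vbar Q) {t : ℝ}
    (ht : 0 ≤ t) (z : ℝ × ℝ) (w : ℝ) : |Q (f t z.1 z.2)| * |w|
      ≤ 2⁻¹ * (Q (f t z.1 z.2) ^ 2 / f t z.1 z.2 + f t z.1 z.2 * w ^ 2) := by
  rcases (S.nonneg t ht z.1 z.2).eq_or_lt with h | h
  · simp [← h, A.zero]
  · have e : Q (f t z.1 z.2) ^ 2 / f t z.1 z.2 + f t z.1 z.2 * w ^ 2
        - 2 * (|Q (f t z.1 z.2)| * |w|) = (|Q (f t z.1 z.2)| - f t z.1 z.2 * |w|) ^ 2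
          / f t z.1 z.2 := by
      rw [← sq_abs (Q (f t z.1 z.2)), ← sq_abs w]
      field_simp
      ring
    have : 0 ≤ (|Q (f t z.1 z.2)| - f t z.1 z.2 * |w|) ^ 2 / f t z.1 z.2 := by positivity
    linarith

/-- The Casimir density at zero modulation is integrable if the functional is finite. -/
theorem finite_of_casimir (S : IsStrongSolution ε f V) (hε : 0 < ε) (A : IsAdmissible μ vbar Q)
    (P : IsSStable μ vbar) (hQ : casimirBound Q (f 0) < ⊤) (hL : casimir Q μ (f 0) < ⊤) :
    Integrable (fun z : ℝ × ℝ => f 0 z.1 z.2 * (z.2 - vbar) ^ 2) phaseMeasure ∧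
      Integrable (fun z : ℝ × ℝ => casimirConst Q μ vbar z.2) phaseMeasure := by
  have hf := (S.integrable 0 le_rfl).aestronglyMeasurable
  have hκ := A.casimirConst_continuous P
  have hi := S.integrable_casimir hε A hQ le_rfl
  have m1 : AEStronglyMeasurable (fun z : ℝ × ℝ => (z.2 - vbar) ^ 2 / 2 * f 0 z.1 z.2)
    phaseMeasure := AEStronglyMeasurable.mul (Continuous.aestronglyMeasurable (by fun_prop)) hf
  have m2 : AEStronglyMeasurable (fun z : ℝ × ℝ => casimirConst Q μ vbar z.2) phaseMeasure :=
    Continuous.aestronglyMeasurable (by fun_prop)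
  have hd : Integrable (fun z : ℝ × ℝ => Q (f 0 z.1 z.2) + (z.2 - vbar) ^ 2 / 2 * f 0 z.1 z.2
      + casimirConst Q μ vbar z.2) phaseMeasure := by
    refine ⟨(hi.1.add m1).add m2, ?_⟩
    rw [hasFiniteIntegral_iff_ofReal
      (Eventually.of_forall fun z => A.density_nonneg P (S.nonneg 0 le_rfl _ _) _)]
    simpa only [casimir, A.density_eq P] using hL
  -- Once the integrable Q(f) is removed, two nonnegative terms remain, each dominated by their sum.
  have hr := hd.sub hi
  have i1 : Integrable (fun z : ℝ × ℝ => (z.2 - vbar) ^ 2 / 2 * f 0 z.1 z.2) phaseMeasure := by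
    refine hr.mono' m1 (Eventually.of_forall fun z => ?_)
    have h1 := A.casimirConst_nonneg P z.2
    have h2 : 0 ≤ (z.2 - vbar) ^ 2 / 2 * f 0 z.1 z.2 :=
      mul_nonneg (by positivity) (S.nonneg 0 le_rfl _ _)
    rw [Real.norm_of_nonneg h2]
    simp only [Pi.sub_apply]
    linarith
  refine ⟨(i1.const_mul 2).congr (Eventually.of_forall fun z => ?_),
    (hr.sub i1).congr (Eventually.of_forall fun z => ?_)⟩
  · simp only
    ring
  · simp only [Pi.sub_apply]
    ring

end IsStrongSolution

end VlasovPoisson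
end
-- The modulated energy in sheared variables and its expansion
open scoped ENNReal NNReal
noncomputable section
namespace VlasovPoisson

/-- The Casimir density tested against `p(x - v̄t)`. -/
def casimirMom (Q : ℝ → ℝ) (vbar : ℝ) (f : ℝ → ℝ → ℝ → ℝ) (p : ℝ → ℝ) (t : ℝ) : ℝ :=
  ∫ z, Q (f t z.1 z.2) * p (z.1 - vbar * t) ∂phaseMeasure

/-- The filtered modulated energy with values in `ℝ`. -/
def realEnergy (Q μ : ℝ → ℝ) (vbar ε : ℝ) (V₀ : ℝ → ℝ) (f : ℝ → ℝ → ℝ → ℝ) (V : ℝ → ℝ → ℝ)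
    (t : ℝ) : ℝ :=
  (∫ z, Q (f 0 z.1 z.2) ∂phaseMeasure) + (∫ v, casimirConst Q μ vbar v)
    + IsStrongSolution.expandedEnergy vbar ε V₀ f V t

/-- The density of the Casimir functional, in the sheared variables. -/
def casimirDensity (Q μ : ℝ → ℝ) (vbar : ℝ) (u : ℝ → ℝ) (g : ℝ → ℝ → ℝ) (z : ℝ × ℝ) : ℝ :=
  Q (g z.1 z.2) + (z.2 + u z.1 - vbar) ^ 2 / 2 * g z.1 z.2
    + casimirConst Q μ vbar (z.2 + u z.1)

theorem casimir_shear {μ Q : ℝ → ℝ} {vbar : ℝ} (A : IsAdmissible μ vbar Q) (P : IsSStable μ vbar)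
    {u : ℝ → ℝ} (hu : Measurable u) (g : ℝ → ℝ → ℝ) :
    casimir Q μ (fun x v => g x (v - u x))
      = ∫⁻ z, ENNReal.ofReal (casimirDensity Q μ vbar u g z) ∂phaseMeasure := by
  rw [casimir, ← (measurePreserving_shear u hu).lintegral_comp_emb (shear u hu).measurableEmbedding]
  simp only [shear_apply, add_sub_cancel_right, A.density_eq P, casimirDensity]

theorem integral_phase_mul (p κ : ℝ → ℝ) (c : ℝ) (hp : Function.Periodic p 1) :
    ∫ z, p (z.1 - c) * κ z.2 ∂phaseMeasure = (∫ x in (0 : ℝ)..1, p x) * ∫ v, κ v := by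
  rw [phaseMeasure, integral_prod_mul (fun x => p (x - c)) κ, ← integral_periodic_sub hp c,
    intervalIntegral.integral_of_le zero_le_one]

theorem intervalIntegral_deriv_periodic {p : ℝ → ℝ} (hp : ContDiff ℝ 1 p)
    (hpp : Function.Periodic p 1) : ∫ x in (0 : ℝ)..1, deriv p x = 0 := by
  rw [intervalIntegral.integral_deriv_eq_sub (fun x _ => hp.differentiable (by norm_num) x)
    ((hp.continuous_deriv le_rfl).intervalIntegrable _ _)]
  have := hpp 0
  rw [zero_add] at this
  rw [this, sub_self]

namespace IsStrongSolution

variable {ε : ℝ} {f : ℝ → ℝ → ℝ → ℝ} {V : ℝ → ℝ → ℝ} {vbar : ℝ} {μ Q : ℝ → ℝ}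

theorem casimirDensity_nonneg (S : IsStrongSolution ε f V) (A : IsAdmissible μ vbar Q)
    (P : IsSStable μ vbar) (u : ℝ → ℝ) {t : ℝ} (ht : 0 ≤ t) (z : ℝ × ℝ) :
    0 ≤ casimirDensity Q μ vbar u (f t) z :=
  A.density_nonneg P (S.nonneg t ht _ _) _

theorem integrable_casimirConst_shear {u : ℝ → ℝ} (hu : Measurable u)
    (hκ : Integrable (fun z : ℝ × ℝ => casimirConst Q μ vbar z.2) phaseMeasure) :
    Integrable (fun z : ℝ × ℝ => casimirConst Q μ vbar (z.2 + u z.1)) phaseMeasure :=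
  ((measurePreserving_shear u hu).integrable_comp_emb (shear u hu).measurableEmbedding).2 hκ

theorem integrable_shifted_sq (S : IsStrongSolution ε f V) (hε : 0 < ε)
    (h0 : Integrable (fun z : ℝ × ℝ => f 0 z.1 z.2 * (z.2 - vbar) ^ 2) phaseMeasure)
    {W p : ℝ → ℝ} (hW : Continuous W) (hWp : Function.Periodic W 1) (hp : Continuous p)
    (hpp : Function.Periodic p 1) (s : ℝ) {t : ℝ} (ht : 0 ≤ t) :
    Integrable (fun z : ℝ × ℝ => f t z.1 z.2 * ((z.2 + W (z.1 - vbar * t) * s - vbar) ^ 2 *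
      p (z.1 - vbar * t))) phaseMeasure ∧
    ∫ z, f t z.1 z.2 * ((z.2 + W (z.1 - vbar * t) * s - vbar) ^ 2 * p (z.1 - vbar * t))
      ∂phaseMeasure = mom 2 vbar f p t + 2 * s * mom 1 vbar f (fun x => W x * p x) t
        + s ^ 2 * mom 0 vbar f (fun x => W x ^ 2 * p x) t := by
  have hWpp : Function.Periodic (fun x => W x ^ 2) 1 := fun x => by simp only [hWp x]
  have i2 := S.integrable_mom hε h0 hp hpp (k := 2) le_rfl ht
  have i1 := (S.integrable_mom hε h0 (hW.mul hp) (hWp.mul hpp) (k := 1) (by norm_num) ht).const_mul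
    (2 * s)
  have i0 := (S.integrable_mom hε h0 ((hW.pow 2).mul hp) (hWpp.mul hpp) (k := 0) (by norm_num)
    ht).const_mul (s ^ 2)
  have e : ∀ z : ℝ × ℝ, f t z.1 z.2 * (p (z.1 - vbar * t) * (z.2 - vbar) ^ 2)
      + 2 * s * (f t z.1 z.2 * (W (z.1 - vbar * t) * p (z.1 - vbar * t) * (z.2 - vbar) ^ 1))
      + s ^ 2 * (f t z.1 z.2 * (W (z.1 - vbar * t) ^ 2 * p (z.1 - vbar * t) * (z.2 - vbar) ^ 0))
      = f t z.1 z.2 * ((z.2 + W (z.1 - vbar * t) * s - vbar) ^ 2 * p (z.1 - vbar * t)) :=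
    fun z => by ring
  refine ⟨((i2.add i1).add i0).congr (Eventually.of_forall e), ?_⟩
  simp only [← e]
  simp only [Pi.mul_apply, Pi.pow_apply] at i1 i0
  rw [integral_add, integral_add, integral_const_mul, integral_const_mul]
  · rfl
  · exact i2
  · exact i1
  · exact i2.add i1
  · exact i0

/-- The weight p(x-v̄t) depends on x alone, so it commutes with the shear. In the sheared variables
the κ term factors into ∫p times ∫κ and disappears when p has mean zero. -/
theorem integral_casimirDensity_mul (S : IsStrongSolution ε f V) (hε : 0 < ε)
    (A : IsAdmissible μ vbar Q)
    (h0 : Integrable (fun z : ℝ × ℝ => f 0 z.1 z.2 * (z.2 - vbar) ^ 2) phaseMeasure)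
    (hκ : Integrable (fun z : ℝ × ℝ => casimirConst Q μ vbar z.2) phaseMeasure)
    (hQ : casimirBound Q (f 0) < ⊤)
    {W p : ℝ → ℝ} (hW : Continuous W) (hWp : Function.Periodic W 1) (hp : Continuous p)
    (hpp : Function.Periodic p 1) (s : ℝ) {t : ℝ} (ht : 0 ≤ t) :
    Integrable (fun z => casimirDensity Q μ vbar (fun x => W (x - vbar * t) * s) (f t) z *
      p (z.1 - vbar * t)) phaseMeasure ∧
    ∫ z, casimirDensity Q μ vbar (fun x => W (x - vbar * t) * s) (f t) z * p (z.1 - vbar * t)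
      ∂phaseMeasure = casimirMom Q vbar f p t
        + 2⁻¹ * (mom 2 vbar f p t + 2 * s * mom 1 vbar f (fun x => W x * p x) t
          + s ^ 2 * mom 0 vbar f (fun x => W x ^ 2 * p x) t)
        + (∫ x in (0 : ℝ)..1, p x) * ∫ v, casimirConst Q μ vbar v := by
  obtain ⟨C, hC0, hC⟩ := exists_bound_of_periodic hp hpp
  have hu : Measurable fun x => W (x - vbar * t) * s := by
    have : Continuous fun x => W (x - vbar * t) * s := by fun_prop
    exact this.measurable
  have hpm : AEStronglyMeasurable (fun z : ℝ × ℝ => p (z.1 - vbar * t)) phaseMeasure :=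
    Continuous.aestronglyMeasurable (by fun_prop)
  have i1 := (S.integrable_casimir hε A hQ ht).mul_bdd (c := C) hpm
    (Eventually.of_forall fun z => hC _)
  have i2 := S.integrable_shifted_sq hε h0 hW hWp hp hpp s ht
  have i3 := (integrable_casimirConst_shear hu hκ).mul_bdd (c := C) hpm
    (Eventually.of_forall fun z => hC _)
  have e : ∀ z : ℝ × ℝ, Q (f t z.1 z.2) * p (z.1 - vbar * t)
      + 2⁻¹ * (f t z.1 z.2 * ((z.2 + W (z.1 - vbar * t) * s - vbar) ^ 2 * p (z.1 - vbar * t)))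
      + casimirConst Q μ vbar (z.2 + W (z.1 - vbar * t) * s) * p (z.1 - vbar * t)
      = casimirDensity Q μ vbar (fun x => W (x - vbar * t) * s) (f t) z * p (z.1 - vbar * t) :=
    fun z => by rw [casimirDensity]; ring
  refine ⟨((i1.add (i2.1.const_mul 2⁻¹)).add i3).congr (Eventually.of_forall e), ?_⟩
  have e3 : ∫ z, casimirConst Q μ vbar (z.2 + W (z.1 - vbar * t) * s) * p (z.1 - vbar * t)
      ∂phaseMeasure = (∫ x in (0 : ℝ)..1, p x) * ∫ v, casimirConst Q μ vbar v := by
    rw [← integral_phase_mul p (casimirConst Q μ vbar) (vbar * t) hpp,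
      ← (measurePreserving_shear _ hu).integral_comp'
        (fun z => p (z.1 - vbar * t) * casimirConst Q μ vbar z.2)]
    simp only [shear_apply]
    congr 1
    ext z
    ring
  simp only [← e]
  rw [integral_add, integral_add, integral_const_mul, i2.2, e3, casimirMom]
  · exact i1
  · exact i2.1.const_mul _
  · exact i1.add (i2.1.const_mul _)
  · exact i3

theorem integral_field_sub_sq_mul (S : IsStrongSolution ε f V)
    {W p : ℝ → ℝ} (hW : Continuous W) (hWp : Function.Periodic W 1) (hp : Continuous p)
    (hpp : Function.Periodic p 1) (c t : ℝ) :
    ∫ x in (0 : ℝ)..1, (ε * field V t x - W (x - vbar * t) * c) ^ 2 * p (x - vbar * t)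
      = ε ^ 2 * fld 2 vbar V p t - 2 * c * (ε * fld 1 vbar V (fun x => W x * p x) t)
        + c ^ 2 * ∫ x in (0 : ℝ)..1, W x ^ 2 * p x := by
  have hWpp : Function.Periodic (fun x => W x ^ 2) 1 := fun x => by simp only [hWp x]
  have hF := S.field_continuous_space t
  have e : ∀ x, (ε * field V t x - W (x - vbar * t) * c) ^ 2 * p (x - vbar * t)
      = ε ^ 2 * (field V t x ^ 2 * p (x - vbar * t))
        - 2 * c * ε * (field V t x ^ 1 * (W (x - vbar * t) * p (x - vbar * t)))
        + c ^ 2 * (W (x - vbar * t) ^ 2 * p (x - vbar * t)) := fun x => by ring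
  simp only [e]
  rw [intervalIntegral.integral_add, intervalIntegral.integral_sub,
    intervalIntegral.integral_const_mul, intervalIntegral.integral_const_mul,
    intervalIntegral.integral_const_mul, fld, fld,
    integral_periodic_sub (q := fun x => W x ^ 2 * p x) (hWpp.mul hpp) (vbar * t)]
  · ring
  all_goals exact Continuous.intervalIntegrable (by fun_prop) _ _

theorem integral_casimirDensity (S : IsStrongSolution ε f V) (hε : 0 < ε)
    (A : IsAdmissible μ vbar Q)
    (h0 : Integrable (fun z : ℝ × ℝ => f 0 z.1 z.2 * (z.2 - vbar) ^ 2) phaseMeasure)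
    (hκ : Integrable (fun z : ℝ × ℝ => casimirConst Q μ vbar z.2) phaseMeasure)
    (hQ : casimirBound Q (f 0) < ⊤)
    {W : ℝ → ℝ} (hW : Continuous W) (hWp : Function.Periodic W 1) (s : ℝ) {t : ℝ} (ht : 0 ≤ t) :
    Integrable (casimirDensity Q μ vbar (fun x => W (x - vbar * t) * s) (f t)) phaseMeasure ∧
    ∫ z, casimirDensity Q μ vbar (fun x => W (x - vbar * t) * s) (f t) z ∂phaseMeasure
      = (∫ z, Q (f 0 z.1 z.2) ∂phaseMeasure)
        + 2⁻¹ * (mom 2 vbar f (fun _ => 1) t + 2 * s * mom 1 vbar f W t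
          + s ^ 2 * mom 0 vbar f (fun x => W x ^ 2) t)
        + ∫ v, casimirConst Q μ vbar v := by
  have h := S.integral_casimirDensity_mul hε A h0 hκ hQ hW hWp (p := fun _ => 1)
    continuous_const (fun _ => rfl) s ht
  simp only [mul_one, casimirMom, S.integral_casimir_eq hε A hQ ht] at h
  simpa using h

/-- The decomposition of the real energy into its Casimir part and its field part. -/
theorem realEnergy_eq (S : IsStrongSolution ε f V) (hε : 0 < ε) (A : IsAdmissible μ vbar Q)
    (h0 : Integrable (fun z : ℝ × ℝ => f 0 z.1 z.2 * (z.2 - vbar) ^ 2) phaseMeasure)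
    (hκ : Integrable (fun z : ℝ × ℝ => casimirConst Q μ vbar z.2) phaseMeasure)
    (hQ : casimirBound Q (f 0) < ⊤)
    {V₀ : ℝ → ℝ} (hV : ContDiff ℝ 1 V₀) (hVp : Function.Periodic V₀ 1) {t : ℝ} (ht : 0 ≤ t) :
    realEnergy Q μ vbar ε V₀ f V t
      = (∫ z, casimirDensity Q μ vbar (fun x => deriv V₀ (x - vbar * t) * Real.sin (t / ε)) (f t) z
          ∂phaseMeasure)
        + 2⁻¹ * ∫ x in (0 : ℝ)..1, (ε * field V t x
          - deriv V₀ (x - vbar * t) * Real.cos (t / ε)) ^ 2 := by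
  have hW := hV.continuous_deriv le_rfl
  have hWp := Periodic_deriv hVp
  rw [(S.integral_casimirDensity hε A h0 hκ hQ hW hWp _ ht).2]
  have h := S.integral_field_sub_sq_mul (vbar := vbar) hW hWp (p := fun _ => 1) continuous_const
    (fun _ => rfl) (Real.cos (t / ε)) t
  simp only [mul_one] at h
  rw [h, realEnergy, expandedEnergy, totalEnergy]
  simp only [mom, fld, one_mul, mul_one]
  ring

theorem filteredEnergy_eq (S : IsStrongSolution ε f V) (hε : 0 < ε) (A : IsAdmissible μ vbar Q)
    (P : IsSStable μ vbar)
    (h0 : Integrable (fun z : ℝ × ℝ => f 0 z.1 z.2 * (z.2 - vbar) ^ 2) phaseMeasure)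
    (hκ : Integrable (fun z : ℝ × ℝ => casimirConst Q μ vbar z.2) phaseMeasure)
    (hQ : casimirBound Q (f 0) < ⊤)
    {V₀ : ℝ → ℝ} (hV : ContDiff ℝ 1 V₀) (hVp : Function.Periodic V₀ 1) {t : ℝ} (ht : 0 ≤ t) :
    filteredEnergy Q μ vbar V₀ ε f V t = ENNReal.ofReal (realEnergy Q μ vbar ε V₀ f V t) := by
  have hW := hV.continuous_deriv le_rfl
  have hWp := Periodic_deriv hVp
  have hF := S.field_continuous_space t
  have hu : Measurable fun x => deriv V₀ (x - vbar * t) * Real.sin (t / ε) := by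
    have : Continuous fun x => deriv V₀ (x - vbar * t) * Real.sin (t / ε) := by fun_prop
    exact this.measurable
  have hi := (S.integral_casimirDensity hε A h0 hκ hQ hW hWp (Real.sin (t / ε)) ht).1
  have hn := S.casimirDensity_nonneg A P
    (fun x => deriv V₀ (x - vbar * t) * Real.sin (t / ε)) ht
  rw [S.realEnergy_eq hε A h0 hκ hQ hV hVp ht, filteredEnergy, casimir_shear A P hu,
    ENNReal.ofReal_add (integral_nonneg hn) (mul_nonneg (by norm_num)
      (intervalIntegral.integral_nonneg zero_le_one fun x _ => sq_nonneg _)),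
    ENNReal.ofReal_mul (by norm_num), intervalIntegral.integral_of_le zero_le_one,
    ofReal_integral_eq_lintegral_ofReal hi (Eventually.of_forall hn),
    ofReal_integral_eq_lintegral_ofReal (integrable_of_continuous_restrict_Ioc (by fun_prop) _ _)
      (Eventually.of_forall fun x => sq_nonneg _)]
  simp only [field_of_nonneg ht]
  rw [ENNReal.ofReal_inv_of_pos (by norm_num)]
  norm_num

end IsStrongSolution

end VlasovPoisson
end
-- The transport equation for Q(f)
open scoped ENNReal NNReal
noncomputable section
namespace VlasovPoisson

/-- The function `Q`, cut off near `0`. -/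
def cutCasimir (Q : ℝ → ℝ) (n : ℕ) (s : ℝ) : ℝ :=
  Real.smoothTransition (((n : ℝ) + 1) * s - 1) * Q s

theorem abs_cutCasimir_le (Q : ℝ → ℝ) (n : ℕ) (s : ℝ) : |cutCasimir Q n s| ≤ |Q s| := by
  rw [cutCasimir, abs_mul, abs_of_nonneg (Real.smoothTransition.nonneg _)]
  exact mul_le_of_le_one_left (abs_nonneg _) (Real.smoothTransition.le_one _)

theorem cutCasimir_tendsto {Q : ℝ → ℝ} (h0 : Q 0 = 0) {s : ℝ} (hs : 0 ≤ s) :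
    Tendsto (fun n => cutCasimir Q n s) atTop (𝓝 (Q s)) := by
  rcases hs.eq_or_lt with rfl | hs
  · simp [cutCasimir, h0]
  · refine tendsto_const_nhds.congr' ?_
    have h : Tendsto (fun n : ℕ => ((n : ℝ) + 1) * s - 1) atTop atTop :=
      tendsto_atTop_add_const_right _ _
        ((tendsto_atTop_add_const_right _ _ tendsto_natCast_atTop_atTop).atTop_mul_const hs)
    filter_upwards [h.eventually_ge_atTop 1] with n hn
    rw [cutCasimir, Real.smoothTransition.one_of_one_le hn, one_mul]

/-- Q need not be differentiable at 0. The cut function vanishes for s < 1/(n+1), hence near every s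
≤ 0, and is a product of C¹ functions on (0, ∞). -/
theorem IsAdmissible.cutCasimir_contDiff {μ Q : ℝ → ℝ} {vbar : ℝ} (A : IsAdmissible μ vbar Q)
    (n : ℕ) : ContDiff ℝ 1 (cutCasimir Q n) := by
  have hQ : ContDiffOn ℝ 1 Q (Ioi 0) := by
    have := (contDiffOn_succ_iff_deriv_of_isOpen (n := 0) (f := Q) (isOpen_Ioi (a := (0 : ℝ)))).2
      ⟨A.differentiableOn, by simp, contDiffOn_zero.2 A.deriv_continuousOn⟩
    simpa using this
  have hn : (0 : ℝ) < (n : ℝ) + 1 := by positivity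
  rw [contDiff_iff_contDiffAt]
  intro s
  rcases lt_or_ge 0 s with hs | hs
  · have h1 : ContDiff ℝ 1 fun s : ℝ => Real.smoothTransition (((n : ℝ) + 1) * s - 1) :=
      Real.smoothTransition.contDiff.comp (by fun_prop)
    exact h1.contDiffAt.mul (hQ.contDiffAt (Ioi_mem_nhds hs))
  · refine (contDiffAt_const (c := (0 : ℝ))).congr_of_eventuallyEq ?_
    have hlt : s < ((n : ℝ) + 1)⁻¹ := hs.trans_lt (by positivity)
    filter_upwards [Iio_mem_nhds hlt] with y hy
    have : ((n : ℝ) + 1) * y < 1 := by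
      calc ((n : ℝ) + 1) * y < ((n : ℝ) + 1) * ((n : ℝ) + 1)⁻¹ := mul_lt_mul_of_pos_left hy hn
        _ = 1 := mul_inv_cancel₀ hn.ne'
    rw [cutCasimir, Real.smoothTransition.zero_of_nonpos (by linarith), zero_mul]

namespace IsStrongSolution

variable {ε : ℝ} {f : ℝ → ℝ → ℝ → ℝ} {V : ℝ → ℝ → ℝ} {vbar : ℝ} {μ Q : ℝ → ℝ}

theorem abs_casimir_mul_weight_le (S : IsStrongSolution ε f V) (A : IsAdmissible μ vbar Q) {t : ℝ}
    (ht : 0 ≤ t) (z : ℝ × ℝ) : |Q (f t z.1 z.2)| * (1 + |z.2 - vbar|)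
      ≤ (|Q (f t z.1 z.2)| + Q (f t z.1 z.2) ^ 2 / f t z.1 z.2)
        + f t z.1 z.2 * (1 + (z.2 - vbar) ^ 2) := by
  have h := S.abs_casimir_mul_le A ht z (z.2 - vbar)
  have h1 := S.nonneg t ht z.1 z.2
  have h2 : 0 ≤ Q (f t z.1 z.2) ^ 2 / f t z.1 z.2 := div_nonneg (sq_nonneg _) h1
  have h3 : 0 ≤ f t z.1 z.2 * (z.2 - vbar) ^ 2 := mul_nonneg h1 (sq_nonneg _)
  nlinarith

/-- The cut functions of f are transported; the cutoff in v is removed for fixed n, then n tends to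
infinity, both limits dominated by |Q(f)| + Q(f)²/f + f(1 + (v-v̄)²). Only a first velocity moment
of Q(f) is available. This suffices: with r = 1 the force term is absent and the transport term is
linear in v - v̄. -/
theorem weakOn_casimir (S : IsStrongSolution ε f V) (hε : 0 < ε) (A : IsAdmissible μ vbar Q)
    (h0 : Integrable (fun z : ℝ × ℝ => f 0 z.1 z.2 * (z.2 - vbar) ^ 2) phaseMeasure)
    (hQ : casimirBound Q (f 0) < ⊤) {θ p : ℝ → ℝ} (hθ : ContDiff ℝ 1 θ) (hp : ContDiff ℝ 1 p)
    (hpp : Function.Periodic p 1) {K : ℝ} (hθ0 : ∀ t, |θ t| ≤ K) (hθ1 : ∀ t, |deriv θ t| ≤ K)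
    {a b : ℝ} (ha : 0 < a) (hab : a ≤ b) :
    WeakOn (field V) (fun t x v => Q (f t x v)) vbar θ p (fun _ => 1) a b := by
  obtain ⟨B, hB⟩ := S.exists_second_moment_bound hε h0 b
  obtain ⟨C₀, hC₀, hC0⟩ := exists_bound_of_periodic hp.continuous hpp
  obtain ⟨C₁, hC₁, hC1⟩ := exists_bound_of_periodic (hp.continuous_deriv le_rfl)
    (Periodic_deriv hpp)
  set C := max (max K (max C₀ C₁)) (2 / ε ^ 2) with hC
  have hK : K ≤ C := (le_max_left _ _).trans (le_max_left _ _)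
  have hCC0 : C₀ ≤ C := (le_max_left _ _).trans ((le_max_right _ _).trans (le_max_left _ _))
  have hCC1 : C₁ ≤ C := (le_max_right _ _).trans ((le_max_right _ _).trans (le_max_left _ _))
  have hCn : 0 ≤ C := hC₀.trans hCC0
  have hF := S.field_continuous hε
  have hmem : ∀ τ ∈ Icc a b, 0 ≤ τ := fun τ hτ => ha.le.trans hτ.1
  set D : ℝ → ℝ × ℝ → ℝ := fun t z => (|Q (f t z.1 z.2)| + Q (f t z.1 z.2) ^ 2 / f t z.1 z.2)
        + f t z.1 z.2 * (1 + (z.2 - vbar) ^ 2) with hDdef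
  have hDi : ∀ τ ∈ Icc a b, Integrable (D τ) phaseMeasure := fun τ hτ =>
    (S.integrable_bound hε A hQ (hmem τ hτ)).add (hB τ ⟨hmem τ hτ, hτ.2⟩).1
  set B' := (casimirBound Q (f 0)).toReal + B with hB'
  have hDB : ∀ τ ∈ Icc a b, ∫ z, D τ z ∂phaseMeasure ≤ B' := fun τ hτ => by
    rw [hDdef, integral_add (S.integrable_bound hε A hQ (hmem τ hτ))
      (hB τ ⟨hmem τ hτ, hτ.2⟩).1, S.integral_bound hε A (hmem τ hτ)]
    linarith [(hB τ ⟨hmem τ hτ, hτ.2⟩).2]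
  have hle : ∀ n, ∀ τ ∈ Icc a b, ∀ z : ℝ × ℝ,
      |cutCasimir Q n (f τ z.1 z.2)| * (1 + |z.2 - vbar|) ≤ D τ z := fun n τ hτ z =>
    (mul_le_mul_of_nonneg_right (abs_cutCasimir_le _ _ _) (by positivity)).trans
      (S.abs_casimir_mul_weight_le A (hmem τ hτ) z)
  have hTn : ∀ n, IsTransported (field V) (fun t x v => cutCasimir Q n (f t x v)) := fun n =>
    S.isTransported.comp (A.cutCasimir_contDiff n)
  have hgc : ∀ n, ContinuousOn (fun z : ℝ × ℝ × ℝ => cutCasimir Q n (f z.1 z.2.1 z.2.2))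
      (Ioi (0 : ℝ) ×ˢ (univ : Set (ℝ × ℝ))) := fun n => (hTn n).locallyLipschitz.continuousOn
  have hs : ∀ n, ∀ τ ∈ Icc a b, AEStronglyMeasurable
      (fun z : ℝ × ℝ => cutCasimir Q n (f τ z.1 z.2)) phaseMeasure := fun n τ hτ =>
    (continuous_slice_of_continuousOn (g := fun t x v => cutCasimir Q n (f t x v)) (hgc n)
      (ha.trans_le hτ.1)).aestronglyMeasurable
  have hw : ∀ v, (1 : ℝ) ≤ 1 + |v - vbar| := fun v => le_add_of_nonneg_right (abs_nonneg _)
  have hWn : ∀ n, WeakOn (field V) (fun t x v => cutCasimir Q n (f t x v)) vbar θ p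
      (fun _ => 1) a b := fun n => by
    refine weakOn_of_forall_hasCompactSupport hF (hgc n) (ω := fun v => 1 + |v - vbar|)
      (B := B') (C := C) ha.le hab hθ hp contDiff_const
      (fun r' hr' hrc' => (hTn n).weakOn hF hθ hp hpp hr' hrc' ha hab)
      (fun τ hτ => ?_) (hs n) (fun τ hτ => ?_) (fun τ _ => (hθ0 τ).trans hK)
      (fun τ _ => (hθ1 τ).trans hK) (fun x => (hC0 x).trans hCC0)
      (fun t x => (S.abs_field_le hε t x).trans (le_max_right _ _)) (fun v => ?_) (fun v => ?_)
      (fun x v => ?_)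
    · refine (hDi τ hτ).mono' ((hs n τ hτ).mul (Continuous.aestronglyMeasurable (by fun_prop)))
        (Eventually.of_forall fun z => ?_)
      rw [Real.norm_eq_abs, abs_mul, abs_of_nonneg (zero_le_one.trans (hw z.2))]
      exact hle n τ hτ z
    · refine (integral_mono_of_nonneg (Eventually.of_forall fun z => abs_nonneg _) (hDi τ hτ)
        (Eventually.of_forall fun z => ?_)).trans (hDB τ hτ)
      simp only
      rw [abs_mul, abs_of_nonneg (zero_le_one.trans (hw z.2))]
      exact hle n τ hτ z
    · rw [abs_one]; exact hw v
    · rw [deriv_const, abs_zero]; exact zero_le_one.trans (hw v)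
    · rw [mul_one, abs_mul, mul_comm]
      exact mul_le_mul ((hC1 x).trans hCC1) (by linarith) (abs_nonneg _) hCn
  have b1 : ∀ τ (z : ℝ × ℝ), |testFn vbar θ p (fun _ => 1) τ z| ≤ 2 * C ^ 2 * (1 + |z.2 - vbar|) := by
    intro τ z
    rw [testFn, mul_one, abs_mul]
    have h1 := mul_le_mul ((hθ0 τ).trans hK) ((hC0 (z.1 - vbar * τ)).trans hCC0) (abs_nonneg _) hCn
    nlinarith [hw z.2, sq_nonneg C]
  have b2 : ∀ τ (z : ℝ × ℝ),
      |testFlow (field V) vbar θ p (fun _ => 1) τ z| ≤ 2 * C ^ 2 * (1 + |z.2 - vbar|) := by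
    intro τ z
    have h1 := mul_le_mul ((hθ1 τ).trans hK) ((hC0 (z.1 - vbar * τ)).trans hCC0) (abs_nonneg _) hCn
    have h2 := mul_le_mul ((hθ0 τ).trans hK) ((hC1 (z.1 - vbar * τ)).trans hCC1) (abs_nonneg _) hCn
    have h3 := mul_le_mul_of_nonneg_left h2 (abs_nonneg (z.2 - vbar))
    rw [testFlow, deriv_const, mul_zero, mul_zero, sub_zero, mul_one, mul_one]
    refine (abs_add_le _ _).trans ?_
    rw [abs_mul, abs_mul, abs_mul]
    nlinarith [hw z.2, sq_nonneg C]
  refine weakOn_of_tendsto (g' := fun n t x v => cutCasimir Q n (f t x v))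
    (r' := fun _ _ => 1) (B := 2 * C ^ 2 * B') (D := fun τ z => 2 * C ^ 2 * D τ z)
    hF hab hθ hp (fun _ => contDiff_const) hWn
    (fun n => aestronglyMeasurable_integral_mul (g := fun t x v => cutCasimir Q n (f t x v)) (hgc n)
      (testFlow_continuous_uncurry hF hθ hp contDiff_const) ha.le)
    hs (fun τ hτ => (hDi τ hτ).const_mul _) (fun τ hτ => ?_) (fun n τ hτ z => ?_)
    (fun n τ hτ z => ?_) (fun τ hτ z => ?_) (fun τ hτ z => ?_)
  · rw [integral_const_mul]
    exact mul_le_mul_of_nonneg_left (hDB τ hτ) (by positivity)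
  · rw [abs_mul]
    refine (mul_le_mul_of_nonneg_left (b1 τ z) (abs_nonneg _)).trans ?_
    rw [mul_left_comm]
    exact mul_le_mul_of_nonneg_left (hle n τ hτ z) (by positivity)
  · rw [abs_mul]
    refine (mul_le_mul_of_nonneg_left (b2 τ z) (abs_nonneg _)).trans ?_
    rw [mul_left_comm]
    exact mul_le_mul_of_nonneg_left (hle n τ hτ z) (by positivity)
  · exact (cutCasimir_tendsto A.zero (S.nonneg τ (hmem τ hτ) _ _)).mul_const _
  · exact (cutCasimir_tendsto A.zero (S.nonneg τ (hmem τ hτ) _ _)).mul_const _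

/-- The first moment of `Q(f)`, tested against `p(x - v̄t)`. -/
def casimirFlux (Q : ℝ → ℝ) (vbar : ℝ) (f : ℝ → ℝ → ℝ → ℝ) (p : ℝ → ℝ) (t : ℝ) : ℝ :=
  ∫ z, Q (f t z.1 z.2) * (p (z.1 - vbar * t) * (z.2 - vbar)) ∂phaseMeasure

theorem abs_casimirMom_le (S : IsStrongSolution ε f V) (hε : 0 < ε) (A : IsAdmissible μ vbar Q)
    (hQ : casimirBound Q (f 0) < ⊤) {p : ℝ → ℝ} {C : ℝ} (hC : ∀ x, |p x| ≤ C) {t : ℝ}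
    (ht : 0 ≤ t) : |casimirMom Q vbar f p t| ≤ C * (casimirBound Q (f 0)).toReal := by
  have hC0 : 0 ≤ C := (abs_nonneg _).trans (hC 0)
  rw [← S.integral_bound hε A ht, ← integral_const_mul, casimirMom, ← Real.norm_eq_abs]
  refine norm_integral_le_of_norm_le ((S.integrable_bound hε A hQ ht).const_mul C)
    (Eventually.of_forall fun z => ?_)
  rw [Real.norm_eq_abs, abs_mul, mul_comm]
  refine mul_le_mul (hC _) ?_ (abs_nonneg _) hC0
  exact le_add_of_nonneg_right (div_nonneg (sq_nonneg _) (S.nonneg t ht _ _))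

theorem integrable_casimirFlux (S : IsStrongSolution ε f V) (hε : 0 < ε) (A : IsAdmissible μ vbar Q)
    (h0 : Integrable (fun z : ℝ × ℝ => f 0 z.1 z.2 * (z.2 - vbar) ^ 2) phaseMeasure)
    (hQ : casimirBound Q (f 0) < ⊤) {p : ℝ → ℝ} (hp : Continuous p) {C : ℝ} (hC : ∀ x, |p x| ≤ C)
    {t : ℝ} (ht : 0 ≤ t) :
    Integrable (fun z : ℝ × ℝ => Q (f t z.1 z.2) * (p (z.1 - vbar * t) * (z.2 - vbar)))
      phaseMeasure ∧
    |casimirFlux Q vbar f p t| ≤ C * (2⁻¹ * ((casimirBound Q (f 0)).toReal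
      + ∫ z, f t z.1 z.2 * (z.2 - vbar) ^ 2 ∂phaseMeasure)) := by
  have hC0 : 0 ≤ C := (abs_nonneg _).trans (hC 0)
  have i1 := S.integrable_bound hε A hQ ht
  have i2 := S.integrable_sq hε h0 ht
  have i3 := ((i1.add i2).const_mul 2⁻¹).const_mul C
  have hle : ∀ z : ℝ × ℝ, ‖Q (f t z.1 z.2) * (p (z.1 - vbar * t) * (z.2 - vbar))‖
      ≤ C * (2⁻¹ * ((|Q (f t z.1 z.2)| + Q (f t z.1 z.2) ^ 2 / f t z.1 z.2)
        + f t z.1 z.2 * (z.2 - vbar) ^ 2)) := fun z => by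
    rw [mul_left_comm, norm_mul, norm_mul, Real.norm_eq_abs, Real.norm_eq_abs, Real.norm_eq_abs]
    refine mul_le_mul (hC _) ?_ (by positivity) hC0
    have := S.abs_casimir_mul_le A ht z (z.2 - vbar)
    linarith [abs_nonneg (Q (f t z.1 z.2))]
  refine ⟨i3.mono' ((S.aestronglyMeasurable_casimir A ht).mul
    (Continuous.aestronglyMeasurable (by fun_prop))) (Eventually.of_forall hle), ?_⟩
  rw [← S.integral_bound hε A ht, ← integral_add i1 i2, ← integral_const_mul, ← integral_const_mul,
    casimirFlux, ← Real.norm_eq_abs]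
  exact norm_integral_le_of_norm_le i3 (Eventually.of_forall hle)

end IsStrongSolution

end VlasovPoisson
end
-- Integration by parts in time for the Casimir density
open scoped ENNReal NNReal
noncomputable section
namespace VlasovPoisson

/-- A primitive of `sin(t/ε)` which vanishes to second order at `0`. -/
def slowPhase (ε t : ℝ) : ℝ := ε * (1 - Real.cos (t / ε))

theorem hasDerivAt_slowPhase {ε : ℝ} (hε : 0 < ε) (t : ℝ) :
    HasDerivAt (slowPhase ε) (Real.sin (t / ε)) t := by
  refine (((IsStrongSolution.hasDerivAt_cos_div ε t).const_sub 1).const_mul ε).congr_deriv ?_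
  field_simp

theorem deriv_slowPhase {ε : ℝ} (hε : 0 < ε) :
    deriv (slowPhase ε) = fun t => Real.sin (t / ε) :=
  funext fun t => (hasDerivAt_slowPhase hε t).deriv

theorem slowPhase_zero (ε : ℝ) : slowPhase ε 0 = 0 := by simp [slowPhase]

theorem slowPhase_nonneg {ε : ℝ} (hε : 0 < ε) (t : ℝ) : 0 ≤ slowPhase ε t :=
  mul_nonneg hε.le (by linarith [Real.cos_le_one (t / ε)])

theorem slowPhase_le_two_mul {ε : ℝ} (hε : 0 < ε) (t : ℝ) : slowPhase ε t ≤ 2 * ε := by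
  unfold slowPhase
  nlinarith [Real.neg_one_le_cos (t / ε)]

theorem slowPhase_contDiff (ε : ℝ) : ContDiff ℝ 1 (slowPhase ε) :=
  contDiff_const.mul (contDiff_const.sub (Real.contDiff_cos.comp (contDiff_id.div_const ε)))

/-- The bounds t and 2ε are both used: the second gains a power of ε, the first lets a multiple of
the initial energy be absorbed into the growth in time. -/
theorem slowPhase_le_self {ε : ℝ} (hε : 0 < ε) {t : ℝ} (ht : 0 ≤ t) : slowPhase ε t ≤ t := by
  have hd : ∀ s, HasDerivAt (fun s => s - slowPhase ε s) (1 - Real.sin (s / ε)) s := fun s =>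
    (hasDerivAt_id s).sub (hasDerivAt_slowPhase hε s)
  have hm : Monotone fun s => s - slowPhase ε s :=
    monotone_of_deriv_nonneg (fun s => (hd s).differentiableAt) fun s => by
      rw [(hd s).deriv]
      linarith [Real.sin_le_one (s / ε)]
  have := hm ht
  simp only [slowPhase_zero, sub_zero] at this
  linarith

namespace IsStrongSolution

variable {ε : ℝ} {f : ℝ → ℝ → ℝ → ℝ} {V : ℝ → ℝ → ℝ} {vbar : ℝ} {μ Q : ℝ → ℝ}

theorem continuousOn_casimir (S : IsStrongSolution ε f V) (A : IsAdmissible μ vbar Q) :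
    ContinuousOn (fun z : ℝ × ℝ × ℝ => Q (f z.1 z.2.1 z.2.2))
      (Ioi (0 : ℝ) ×ˢ (univ : Set (ℝ × ℝ))) :=
  A.continuousOn.comp S.continuousOn fun z hz => S.nonneg z.1 (le_of_lt hz.1) _ _

theorem intervalIntegrable_of_bound {g : ℝ → ℝ} {C t : ℝ} (ht : 0 ≤ t)
    (hm : AEStronglyMeasurable g (volume.restrict (Ioc 0 t))) (hC : ∀ τ ∈ Ioc 0 t, |g τ| ≤ C) :
    IntervalIntegrable g volume 0 t := by
  rw [intervalIntegrable_iff, uIoc_of_le ht]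
  refine Integrable.of_bound hm C ?_
  filter_upwards [ae_restrict_mem measurableSet_Ioc] with τ hτ using hC τ hτ

theorem intervalIntegrable_casimirMom (S : IsStrongSolution ε f V) (hε : 0 < ε)
    (A : IsAdmissible μ vbar Q) (hQ : casimirBound Q (f 0) < ⊤) {p : ℝ → ℝ} (hp : Continuous p)
    {C : ℝ} (hC : ∀ x, |p x| ≤ C) {t : ℝ} (ht : 0 ≤ t) :
    IntervalIntegrable (casimirMom Q vbar f p) volume 0 t :=
  intervalIntegrable_of_bound ht
    (aestronglyMeasurable_integral_mul (g := fun t x v => Q (f t x v)) (S.continuousOn_casimir A)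
      (Ψ := fun τ z => p (z.1 - vbar * τ)) (by fun_prop) le_rfl)
    fun _ hτ => S.abs_casimirMom_le hε A hQ hC hτ.1.le

theorem mom_two_one (t : ℝ) : mom 2 vbar f (fun _ => 1) t
    = ∫ z, f t z.1 z.2 * (z.2 - vbar) ^ 2 ∂phaseMeasure := by
  simp [mom]

theorem fld_two_one (t : ℝ) : fld 2 vbar V (fun _ => 1) t
    = ∫ x in (0 : ℝ)..1, field V t x ^ 2 := by
  simp [fld]

theorem mom_two_one_nonneg (S : IsStrongSolution ε f V) {t : ℝ} (ht : 0 ≤ t) :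
    0 ≤ mom 2 vbar f (fun _ => 1) t := by
  rw [mom_two_one]
  exact integral_nonneg fun z => mul_nonneg (S.nonneg t ht _ _) (sq_nonneg _)

theorem fld_two_one_nonneg (t : ℝ) : 0 ≤ fld 2 vbar V (fun _ => 1) t := by
  rw [fld_two_one]
  exact intervalIntegral.integral_nonneg zero_le_one fun x _ => sq_nonneg _

theorem mom_add_fld_eq (S : IsStrongSolution ε f V) (hε : 0 < ε)
    (h0 : Integrable (fun z : ℝ × ℝ => f 0 z.1 z.2 * (z.2 - vbar) ^ 2) phaseMeasure) {t : ℝ}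
    (ht : 0 ≤ t) : mom 2 vbar f (fun _ => 1) t + ε ^ 2 * fld 2 vbar V (fun _ => 1) t
      = 2 * totalEnergy vbar ε f V 0 := by
  rw [← S.totalEnergy_eq hε h0 ht, totalEnergy, mom_two_one, fld_two_one]
  ring

theorem intervalIntegrable_casimirFlux (S : IsStrongSolution ε f V) (hε : 0 < ε)
    (A : IsAdmissible μ vbar Q)
    (h0 : Integrable (fun z : ℝ × ℝ => f 0 z.1 z.2 * (z.2 - vbar) ^ 2) phaseMeasure)
    (hQ : casimirBound Q (f 0) < ⊤) {p : ℝ → ℝ} (hp : Continuous p)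
    {C : ℝ} (hC : ∀ x, |p x| ≤ C) {t : ℝ} (ht : 0 ≤ t) :
    IntervalIntegrable (casimirFlux Q vbar f p) volume 0 t ∧
    ∀ τ, 0 ≤ τ → |casimirFlux Q vbar f p τ|
      ≤ C * (2⁻¹ * ((casimirBound Q (f 0)).toReal + 2 * totalEnergy vbar ε f V 0)) := by
  have hb : ∀ τ, 0 ≤ τ → |casimirFlux Q vbar f p τ|
      ≤ C * (2⁻¹ * ((casimirBound Q (f 0)).toReal + 2 * totalEnergy vbar ε f V 0)) := fun τ hτ => by
    refine (S.integrable_casimirFlux hε A h0 hQ hp hC hτ).2.trans ?_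
    have h1 : 0 ≤ C := (abs_nonneg _).trans (hC 0)
    have h2 := S.mom_add_fld_eq hε h0 hτ
    have h3 := mul_nonneg (sq_nonneg ε) (fld_two_one_nonneg (vbar := vbar) (V := V) τ)
    rw [mom_two_one] at h2
    gcongr
    linarith
  refine ⟨intervalIntegrable_of_bound ht
    (aestronglyMeasurable_integral_mul (g := fun t x v => Q (f t x v)) (S.continuousOn_casimir A)
      (Ψ := fun τ z => p (z.1 - vbar * τ) * (z.2 - vbar)) (by fun_prop) le_rfl)
    fun τ hτ => hb τ hτ.1.le, hb⟩

/-- Integration by parts in time for the Casimir density. -/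
theorem integral_sin_mul_casimirMom (S : IsStrongSolution ε f V) (hε : 0 < ε)
    (A : IsAdmissible μ vbar Q)
    (h0 : Integrable (fun z : ℝ × ℝ => f 0 z.1 z.2 * (z.2 - vbar) ^ 2) phaseMeasure)
    (hQ : casimirBound Q (f 0) < ⊤) {p : ℝ → ℝ} (hp : ContDiff ℝ 1 p)
    (hpp : Function.Periodic p 1) {t : ℝ} (ht : 0 ≤ t) :
    ∫ τ in (0 : ℝ)..t, (Real.sin (τ / ε) * casimirMom Q vbar f p τ
      + slowPhase ε τ * casimirFlux Q vbar f (deriv p) τ)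
      = slowPhase ε t * casimirMom Q vbar f p t := by
  rcases ht.eq_or_lt with rfl | ht0
  · simp [slowPhase_zero]
  obtain ⟨C₀, hC₀, hC0⟩ := exists_bound_of_periodic hp.continuous hpp
  obtain ⟨C₁, hC₁, hC1⟩ := exists_bound_of_periodic (hp.continuous_deriv le_rfl)
    (Periodic_deriv hpp)
  have hpc := hp.continuous
  have hdc : Continuous (deriv p) := hp.continuous_deriv le_rfl
  set Φ : ℝ → ℝ := fun τ => Real.sin (τ / ε) * casimirMom Q vbar f p τ
      + slowPhase ε τ * casimirFlux Q vbar f (deriv p) τ with hΦ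
  have hθc := (slowPhase_contDiff ε).continuous
  have hsc : Continuous fun τ => Real.sin (τ / ε) := by fun_prop
  have hi : IntervalIntegrable Φ volume 0 t :=
    ((S.intervalIntegrable_casimirMom hε A hQ hpc hC0 ht).continuousOn_mul hsc.continuousOn).add
      ((S.intervalIntegrable_casimirFlux hε A h0 hQ hdc hC1 ht).1.continuousOn_mul
        hθc.continuousOn)
  have key : ∀ a ∈ Ioc 0 t, ∫ τ in a..t, Φ τ
      = slowPhase ε t * casimirMom Q vbar f p t - slowPhase ε a * casimirMom Q vbar f p a := by
    intro a ha
    have hW := S.weakOn_casimir hε A h0 hQ (slowPhase_contDiff ε) hp hpp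
      (K := max (2 * ε) 1) (fun t => by
        rw [abs_of_nonneg (slowPhase_nonneg hε t)]
        exact (slowPhase_le_two_mul hε t).trans (le_max_left _ _)) (fun t => by
        rw [deriv_slowPhase hε]
        exact (Real.abs_sin_le_one _).trans (le_max_right _ _)) ha.1 ha.2
    rw [WeakOn] at hW
    have e1 : ∀ τ, ∫ z, Q (f τ z.1 z.2) * testFn vbar (slowPhase ε) p (fun _ => 1) τ z ∂phaseMeasure
        = slowPhase ε τ * casimirMom Q vbar f p τ := fun τ => by
      rw [casimirMom, ← integral_const_mul]
      congr 1
      ext z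
      rw [testFn]
      ring
    rw [e1, e1] at hW
    rw [hW]
    refine intervalIntegral.integral_congr fun τ hτ => ?_
    rw [uIcc_of_le ha.2] at hτ
    have hτ0 : 0 ≤ τ := ha.1.le.trans hτ.1
    have i1 : Integrable (fun z : ℝ × ℝ => Q (f τ z.1 z.2) * p (z.1 - vbar * τ)) phaseMeasure :=
      (S.integrable_casimir hε A hQ hτ0).mul_bdd (c := C₀)
        (Continuous.aestronglyMeasurable (by fun_prop)) (Eventually.of_forall fun z => hC0 _)
    have i2 := (S.integrable_casimirFlux hε A h0 hQ hdc hC1 hτ0).1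
    simp only [hΦ, casimirMom, casimirFlux]
    rw [← integral_const_mul, ← integral_const_mul,
      ← integral_add (i1.const_mul _) (i2.const_mul _)]
    congr 1
    ext z
    rw [testFlow, deriv_slowPhase hε, deriv_const]
    ring
  have hcont : ContinuousOn (fun a => ∫ τ in a..t, Φ τ) (Icc 0 t) := by
    have := intervalIntegral.continuousOn_primitive_interval_left (a := 0) (b := t) (f := Φ)
      (μ := volume) (by
        rw [uIcc_of_le ht]
        exact (intervalIntegrable_iff_integrableOn_Icc_of_le ht).1 hi)
    rwa [uIcc_of_le ht] at this
  have hne : (𝓝[Ioc 0 t] (0 : ℝ)).NeBot := by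
    rw [nhdsWithin_Ioc_eq_nhdsGT ht0]
    infer_instance
  have l1 : Tendsto (fun a => ∫ τ in a..t, Φ τ) (𝓝[Ioc 0 t] 0) (𝓝 (∫ τ in (0 : ℝ)..t, Φ τ)) :=
    (hcont 0 ⟨le_rfl, ht⟩).mono_left (nhdsWithin_mono _ Ioc_subset_Icc_self)
  -- Continuity of the moment of Q(f) at time 0 is not available. Boundedness suffices, since
  -- `slowPhase` vanishes there.
  have l2 : Tendsto (fun a => slowPhase ε a * casimirMom Q vbar f p a) (𝓝[Ioc 0 t] 0) (𝓝 0) := by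
    have h1 : Tendsto (slowPhase ε) (𝓝[Ioc 0 t] 0) (𝓝 0) := by
      have := (hθc.tendsto 0).mono_left (nhdsWithin_le_nhds (s := Ioc 0 t))
      rwa [slowPhase_zero] at this
    refine h1.zero_mul_isBoundedUnder_le ⟨C₀ * (casimirBound Q (f 0)).toReal, ?_⟩
    rw [eventually_map]
    filter_upwards [self_mem_nhdsWithin] with a ha
    exact S.abs_casimirMom_le hε A hQ hC0 ha.1.le
  have l3 := l2.const_sub (slowPhase ε t * casimirMom Q vbar f p t)
  rw [sub_zero] at l3
  refine tendsto_nhds_unique l1 (l3.congr' ?_)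
  filter_upwards [self_mem_nhdsWithin] with a ha
  exact (key a ha).symm

end IsStrongSolution

end VlasovPoisson
end
-- Moment bounds and the differential inequality
open scoped ENNReal NNReal
noncomputable section
namespace VlasovPoisson

/-- By Rolle's theorem q' vanishes somewhere in the period, at distance at most 1. Thus the second
derivative of V₀ also controls the first. -/
theorem abs_deriv_le_of_periodic {q : ℝ → ℝ} (hq : ContDiff ℝ 2 q) (hqp : Function.Periodic q 1)
    {C : ℝ} (hC : ∀ x, |deriv (deriv q) x| ≤ C) (x : ℝ) : |deriv q x| ≤ C := by
  obtain ⟨y, hy, e⟩ := (Periodic_deriv hqp).exists_mem_Ico₀ one_pos x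
  obtain ⟨c, hc, h0⟩ := exists_deriv_eq_zero one_pos hq.continuous.continuousOn
    (f := q) (by have := hqp 0; rw [zero_add] at this; exact this.symm)
  have hd : Differentiable ℝ (deriv q) :=
    (((contDiff_succ_iff_deriv (n := 1)).1 hq).2.2).differentiable (by norm_num)
  have h := Convex.norm_image_sub_le_of_norm_deriv_le (s := univ) (f := deriv q) (C := C)
    (fun x _ => hd x) (fun x _ => hC x) convex_univ (mem_univ c) (mem_univ y)
  rw [h0, sub_zero, Real.norm_eq_abs, Real.norm_eq_abs] at h
  rw [e]
  refine h.trans (mul_le_of_le_one_right ((abs_nonneg _).trans (hC 0)) ?_)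
  rw [abs_le]
  constructor <;> linarith [hc.1, hc.2, hy.1, hy.2]

theorem integral_sq_mul_deriv {W : ℝ → ℝ} (hW : ContDiff ℝ 1 W) (hWp : Function.Periodic W 1) :
    ∫ x in (0 : ℝ)..1, W x ^ 2 * deriv W x = 0 := by
  have h := intervalIntegral_deriv_periodic (p := fun x => W x ^ 3 / 3)
    ((hW.pow 3).div_const 3) (fun x => by simp only [hWp x])
  have e : deriv (fun x => W x ^ 3 / 3) = fun x => W x ^ 2 * deriv W x := by
    ext x
    rw [deriv_div_const, deriv_fun_pow (hW.differentiable (by norm_num) x)]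
    simp
    ring
  rwa [e] at h

/-- Young's inequality with a parameter. -/
theorem abs_le_young {δ : ℝ} (hδ : 0 < δ) (w : ℝ) : |w| ≤ 2⁻¹ * (δ * w ^ 2 + 1 / δ) := by
  have h : 2⁻¹ * (δ * w ^ 2 + 1 / δ) - |w| = (δ * |w| - 1) ^ 2 / (2 * δ) := by
    rw [← sq_abs w]
    field_simp
    ring
  have : 0 ≤ (δ * |w| - 1) ^ 2 / (2 * δ) := by positivity
  linarith

namespace IsStrongSolution

variable {ε : ℝ} {f : ℝ → ℝ → ℝ → ℝ} {V : ℝ → ℝ → ℝ} {vbar : ℝ} {μ Q : ℝ → ℝ}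

theorem abs_mom_two_le (S : IsStrongSolution ε f V) (hε : 0 < ε)
    (h0 : Integrable (fun z : ℝ × ℝ => f 0 z.1 z.2 * (z.2 - vbar) ^ 2) phaseMeasure)
    {p : ℝ → ℝ} {C : ℝ} (hC : ∀ x, |p x| ≤ C) {t : ℝ} (ht : 0 ≤ t) :
    |mom 2 vbar f p t| ≤ C * (2 * totalEnergy vbar ε f V 0) := by
  have hC0 : 0 ≤ C := (abs_nonneg _).trans (hC 0)
  have h1 : |mom 2 vbar f p t| ≤ C * mom 2 vbar f (fun _ => 1) t := by
    rw [mom_two_one, ← integral_const_mul, mom, ← Real.norm_eq_abs]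
    refine norm_integral_le_of_norm_le ((S.integrable_sq hε h0 ht).const_mul C)
      (Eventually.of_forall fun z => ?_)
    rw [Real.norm_eq_abs, mul_left_comm, abs_mul,
      abs_of_nonneg (mul_nonneg (S.nonneg t ht _ _) (sq_nonneg (z.2 - vbar)))]
    exact mul_le_mul_of_nonneg_right (hC _) (mul_nonneg (S.nonneg t ht _ _) (sq_nonneg _))
  refine h1.trans (mul_le_mul_of_nonneg_left ?_ hC0)
  linarith [S.mom_add_fld_eq hε h0 ht,
    mul_nonneg (sq_nonneg ε) (fld_two_one_nonneg (vbar := vbar) (V := V) t)]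

/-- Young's inequality against the measure f of mass one. The free parameter δ later makes the
coefficient of the energy small. -/
theorem abs_mom_one_le (S : IsStrongSolution ε f V) (hε : 0 < ε)
    (h0 : Integrable (fun z : ℝ × ℝ => f 0 z.1 z.2 * (z.2 - vbar) ^ 2) phaseMeasure)
    {p : ℝ → ℝ} {C : ℝ} (hC : ∀ x, |p x| ≤ C) {t : ℝ} (ht : 0 ≤ t) {δ : ℝ} (hδ : 0 < δ) :
    |mom 1 vbar f p t| ≤ C * (2⁻¹ * (δ * (2 * totalEnergy vbar ε f V 0) + 1 / δ)) := by
  have hC0 : 0 ≤ C := (abs_nonneg _).trans (hC 0)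
  have i1 := (((S.integrable_sq hε h0 ht).const_mul δ).add
    ((S.integrable t ht).const_mul (1 / δ))).const_mul 2⁻¹
  have h1 : |mom 1 vbar f p t| ≤ C * (2⁻¹ * (δ * mom 2 vbar f (fun _ => 1) t + 1 / δ)) := by
    have e : 2⁻¹ * (δ * mom 2 vbar f (fun _ => 1) t + 1 / δ)
        = ∫ z, 2⁻¹ * (δ * (f t z.1 z.2 * (z.2 - vbar) ^ 2) + 1 / δ * f t z.1 z.2)
          ∂phaseMeasure := by
      rw [integral_const_mul, integral_add ((S.integrable_sq hε h0 ht).const_mul δ)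
        ((S.integrable t ht).const_mul (1 / δ)), integral_const_mul, integral_const_mul,
        S.integral_eq_one hε ht, mom_two_one, mul_one]
    rw [e, ← integral_const_mul, mom, ← Real.norm_eq_abs]
    refine norm_integral_le_of_norm_le (i1.const_mul C) (Eventually.of_forall fun z => ?_)
    have hf := S.nonneg t ht z.1 z.2
    rw [Real.norm_eq_abs, mul_left_comm, abs_mul, abs_mul, abs_of_nonneg hf, pow_one]
    refine mul_le_mul (hC _) ?_ (by positivity) hC0
    have := mul_le_mul_of_nonneg_left (abs_le_young hδ (z.2 - vbar)) hf
    linarith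
  refine h1.trans (mul_le_mul_of_nonneg_left ?_ hC0)
  have h2 : mom 2 vbar f (fun _ => 1) t ≤ 2 * totalEnergy vbar ε f V 0 := by
    linarith [S.mom_add_fld_eq hε h0 ht,
      mul_nonneg (sq_nonneg ε) (fld_two_one_nonneg (vbar := vbar) (V := V) t)]
  gcongr

theorem abs_mom_zero_le (S : IsStrongSolution ε f V) (hε : 0 < ε)
    {p : ℝ → ℝ} {C : ℝ} (hC : ∀ x, |p x| ≤ C) {t : ℝ} (ht : 0 ≤ t) :
    |mom 0 vbar f p t| ≤ C := by
  have e : C = ∫ z, C * f t z.1 z.2 ∂phaseMeasure := by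
    rw [integral_const_mul, S.integral_eq_one hε ht, mul_one]
  rw [e, mom, ← Real.norm_eq_abs]
  refine norm_integral_le_of_norm_le ((S.integrable t ht).const_mul C)
    (Eventually.of_forall fun z => ?_)
  have hf := S.nonneg t ht z.1 z.2
  rw [Real.norm_eq_abs, pow_zero, mul_one, abs_mul, abs_of_nonneg hf, mul_comm]
  exact mul_le_mul_of_nonneg_right (hC _) hf

theorem abs_fld_two_le (S : IsStrongSolution ε f V) (hε : 0 < ε)
    (h0 : Integrable (fun z : ℝ × ℝ => f 0 z.1 z.2 * (z.2 - vbar) ^ 2) phaseMeasure)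
    {p : ℝ → ℝ} {C : ℝ} (hC : ∀ x, |p x| ≤ C) {t : ℝ} (ht : 0 ≤ t) :
    |ε ^ 2 * fld 2 vbar V p t| ≤ C * (2 * totalEnergy vbar ε f V 0) := by
  have hC0 : 0 ≤ C := (abs_nonneg _).trans (hC 0)
  have hF := S.field_continuous_space t
  have h1 : |fld 2 vbar V p t| ≤ C * fld 2 vbar V (fun _ => 1) t := by
    rw [fld_two_one, ← intervalIntegral.integral_const_mul, fld, ← Real.norm_eq_abs]
    refine intervalIntegral.norm_integral_le_of_norm_le zero_le_one
      (Eventually.of_forall fun x _ => ?_) (Continuous.intervalIntegrable (by fun_prop) _ _)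
    rw [Real.norm_eq_abs, abs_mul, abs_of_nonneg (sq_nonneg _), mul_comm]
    exact mul_le_mul_of_nonneg_right (hC _) (sq_nonneg _)
  rw [abs_mul, abs_of_nonneg (sq_nonneg ε)]
  calc ε ^ 2 * |fld 2 vbar V p t| ≤ ε ^ 2 * (C * fld 2 vbar V (fun _ => 1) t) := by gcongr
    _ = C * (ε ^ 2 * fld 2 vbar V (fun _ => 1) t) := by ring
    _ ≤ _ := by
      refine mul_le_mul_of_nonneg_left ?_ hC0
      linarith [S.mom_add_fld_eq hε h0 ht, S.mom_two_one_nonneg (vbar := vbar) ht]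

theorem abs_fld_one_le (S : IsStrongSolution ε f V) (hε : 0 < ε)
    (h0 : Integrable (fun z : ℝ × ℝ => f 0 z.1 z.2 * (z.2 - vbar) ^ 2) phaseMeasure)
    {p : ℝ → ℝ} {C : ℝ} (hC : ∀ x, |p x| ≤ C) {t : ℝ} (ht : 0 ≤ t) {δ : ℝ} (hδ : 0 < δ) :
    |ε * fld 1 vbar V p t| ≤ C * (2⁻¹ * (δ * (2 * totalEnergy vbar ε f V 0) + 1 / δ)) := by
  have hC0 : 0 ≤ C := (abs_nonneg _).trans (hC 0)
  have hF := S.field_continuous_space t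
  have h1 : |ε * fld 1 vbar V p t|
      ≤ C * (2⁻¹ * (δ * (ε ^ 2 * fld 2 vbar V (fun _ => 1) t) + 1 / δ)) := by
    have e : 2⁻¹ * (δ * (ε ^ 2 * fld 2 vbar V (fun _ => 1) t) + 1 / δ)
        = ∫ x in (0 : ℝ)..1, 2⁻¹ * (δ * (ε * field V t x) ^ 2 + 1 / δ) := by
      simp only [mul_pow]
      rw [intervalIntegral.integral_const_mul, intervalIntegral.integral_add,
        intervalIntegral.integral_const_mul, intervalIntegral.integral_const_mul, fld_two_one]
      · simp
      all_goals exact Continuous.intervalIntegrable (by fun_prop) _ _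
    rw [e, ← intervalIntegral.integral_const_mul, fld, ← intervalIntegral.integral_const_mul,
      ← Real.norm_eq_abs]
    refine intervalIntegral.norm_integral_le_of_norm_le zero_le_one
      (Eventually.of_forall fun x _ => ?_) (Continuous.intervalIntegrable (by fun_prop) _ _)
    rw [Real.norm_eq_abs, pow_one, ← mul_assoc, abs_mul, mul_comm]
    exact mul_le_mul (hC _) (abs_le_young hδ _) (abs_nonneg _) hC0
  refine h1.trans (mul_le_mul_of_nonneg_left ?_ hC0)
  have h2 : ε ^ 2 * fld 2 vbar V (fun _ => 1) t ≤ 2 * totalEnergy vbar ε f V 0 := by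
    linarith [S.mom_add_fld_eq hε h0 ht, S.mom_two_one_nonneg (vbar := vbar) ht]
  gcongr

/-- The conserved energy is controlled by the initial modulated energy. -/
theorem totalEnergy_le (S : IsStrongSolution ε f V) (hε : 0 < ε) (A : IsAdmissible μ vbar Q)
    (P : IsSStable μ vbar)
    (h0 : Integrable (fun z : ℝ × ℝ => f 0 z.1 z.2 * (z.2 - vbar) ^ 2) phaseMeasure)
    (hκ : Integrable (fun z : ℝ × ℝ => casimirConst Q μ vbar z.2) phaseMeasure)
    (hQ : casimirBound Q (f 0) < ⊤)
    {V₀ : ℝ → ℝ} (hV : ContDiff ℝ 1 V₀) (hVp : Function.Periodic V₀ 1) {C : ℝ}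
    (hC : ∀ x, |deriv V₀ x| ≤ C) :
    2 * totalEnergy vbar ε f V 0 ≤ 4 * (realEnergy Q μ vbar ε V₀ f V 0
      + (casimirBound Q (f 0)).toReal) + 2 * C ^ 2 := by
  have hW := hV.continuous_deriv le_rfl
  have hWp := Periodic_deriv hVp
  have hF := S.field_continuous_space 0
  have hC0 : 0 ≤ C := (abs_nonneg _).trans (hC 0)
  -- At t = 0 the shear is trivial. Since ∫κ ≥ 0 and ∫Q(f) ≥ -q, the sum L(0) + q bounds half the
  -- second moment plus half of ∫(εF - W)²; then ε²F² ≤ 2(εF - W)² + 2C².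
  have e := S.realEnergy_eq hε A h0 hκ hQ hV hVp le_rfl
  rw [(S.integral_casimirDensity hε A h0 hκ hQ hW hWp _ le_rfl).2] at e
  simp only [zero_div, Real.sin_zero, Real.cos_zero, mul_zero, zero_mul, add_zero, mul_one, sub_zero,
    ne_eq, OfNat.ofNat_ne_zero, not_false_eq_true, zero_pow] at e
  have h1 : -(casimirBound Q (f 0)).toReal ≤ ∫ z, Q (f 0 z.1 z.2) ∂phaseMeasure := by
    have := S.abs_casimirMom_le hε A hQ (p := fun _ => 1) (C := 1) (fun _ => by simp) le_rfl
    simp only [casimirMom, mul_one, one_mul] at this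
    exact (abs_le.1 this).1
  have h2 : 0 ≤ ∫ v, casimirConst Q μ vbar v := integral_nonneg fun v => A.casimirConst_nonneg P v
  have h3 : ε ^ 2 * fld 2 vbar V (fun _ => 1) 0
      ≤ 2 * (∫ x in (0 : ℝ)..1, (ε * field V 0 x - deriv V₀ x) ^ 2) + 2 * C ^ 2 := by
    have e1 : 2 * (∫ x in (0 : ℝ)..1, (ε * field V 0 x - deriv V₀ x) ^ 2) + 2 * C ^ 2
        = ∫ x in (0 : ℝ)..1, (2 * (ε * field V 0 x - deriv V₀ x) ^ 2 + 2 * C ^ 2) := by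
      rw [intervalIntegral.integral_add, intervalIntegral.integral_const_mul]
      · simp
      all_goals exact Continuous.intervalIntegrable (by fun_prop) _ _
    rw [e1, fld_two_one, ← intervalIntegral.integral_const_mul]
    refine intervalIntegral.integral_mono_on zero_le_one
      (Continuous.intervalIntegrable (by fun_prop) _ _)
      (Continuous.intervalIntegrable (by fun_prop) _ _) fun x _ => ?_
    have hx : deriv V₀ x ^ 2 ≤ C ^ 2 := by
      rw [← sq_abs]
      exact pow_le_pow_left₀ (abs_nonneg _) (hC x) 2
    nlinarith [sq_nonneg (ε * field V 0 x - deriv V₀ x - deriv V₀ x)]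
  have h4 := S.mom_two_one_nonneg (vbar := vbar) (le_refl (0 : ℝ))
  have h5 := S.mom_add_fld_eq hε h0 le_rfl
  have h6 := fld_two_one_nonneg (vbar := vbar) (V := V) 0
  have h7 : 0 ≤ ∫ x in (0 : ℝ)..1, (ε * field V 0 x - deriv V₀ x) ^ 2 :=
    intervalIntegral.integral_nonneg zero_le_one fun x _ => sq_nonneg _
  linarith

theorem realEnergy_nonneg (S : IsStrongSolution ε f V) (hε : 0 < ε) (A : IsAdmissible μ vbar Q)
    (P : IsSStable μ vbar)
    (h0 : Integrable (fun z : ℝ × ℝ => f 0 z.1 z.2 * (z.2 - vbar) ^ 2) phaseMeasure)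
    (hκ : Integrable (fun z : ℝ × ℝ => casimirConst Q μ vbar z.2) phaseMeasure)
    (hQ : casimirBound Q (f 0) < ⊤)
    {V₀ : ℝ → ℝ} (hV : ContDiff ℝ 1 V₀) (hVp : Function.Periodic V₀ 1) {t : ℝ} (ht : 0 ≤ t) :
    0 ≤ realEnergy Q μ vbar ε V₀ f V t := by
  rw [S.realEnergy_eq hε A h0 hκ hQ hV hVp ht]
  exact add_nonneg (integral_nonneg (S.casimirDensity_nonneg A P _ ht)) (mul_nonneg (by norm_num)
    (intervalIntegral.integral_nonneg zero_le_one fun x _ => sq_nonneg _))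

/-- The time derivative of the filtered modulated energy. -/
def slope (vbar ε : ℝ) (V₀ : ℝ → ℝ) (f : ℝ → ℝ → ℝ → ℝ) (V : ℝ → ℝ → ℝ) (t : ℝ) : ℝ :=
  Real.sin (t / ε) * (mom 2 vbar f (deriv (deriv V₀)) t
      - ε ^ 2 / 2 * fld 2 vbar V (deriv (deriv V₀)) t)
    + Real.sin (t / ε) ^ 2 * mom 1 vbar f (fun x => deriv V₀ x * deriv (deriv V₀) x) t
    + 2 * Real.sin (t / ε) * Real.cos (t / ε) *
      (ε * fld 1 vbar V (fun x => deriv V₀ x * deriv (deriv V₀) x) t)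

/-- Let I₁ and I₂ be the integrals of the modulated Casimir density and of (εF - Wc)² against W'.
Their terms ∫W'∫κ and c²∫W²W' vanish by periodicity. In s(2I₁ - I₂/2) the quadratic moments are
exactly those of `slope`; the remaining mismatch is s·`rotated`, the moment of Q(f) and the cubic
charge term. -/
theorem slope_le (S : IsStrongSolution ε f V) (hε : 0 < ε) (A : IsAdmissible μ vbar Q)
    (P : IsSStable μ vbar)
    (h0 : Integrable (fun z : ℝ × ℝ => f 0 z.1 z.2 * (z.2 - vbar) ^ 2) phaseMeasure)
    (hκ : Integrable (fun z : ℝ × ℝ => casimirConst Q μ vbar z.2) phaseMeasure)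
    (hQ : casimirBound Q (f 0) < ⊤)
    {V₀ : ℝ → ℝ} (hV : ContDiff ℝ 3 V₀) (hVp : Function.Periodic V₀ 1) {lam : ℝ}
    (hlam : ∀ x, |deriv (deriv V₀) x| ≤ lam) {t : ℝ} (ht : 0 ≤ t) :
    slope vbar ε V₀ f V t ≤ 2 * lam * |Real.sin (t / ε)| * realEnergy Q μ vbar ε V₀ f V t
      - 2 * (Real.sin (t / ε) * casimirMom Q vbar f (deriv (deriv V₀)) t)
      + Real.sin (t / ε) * rotated vbar ε V₀ f V t
      - Real.sin (t / ε) ^ 3 * mom 0 vbar f (fun x => deriv V₀ x ^ 2 * deriv (deriv V₀) x) t := by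
  have hW2 : ContDiff ℝ 2 (deriv V₀) := ((contDiff_succ_iff_deriv (n := 2)).1 hV).2.2
  have hW1 : ContDiff ℝ 1 (deriv V₀) := hW2.of_le (by norm_num)
  have hp : Continuous (deriv (deriv V₀)) := hW1.continuous_deriv le_rfl
  have hW := hW1.continuous
  have hWp := Periodic_deriv hVp
  have hpp := Periodic_deriv hWp
  have hF := S.field_continuous_space t
  have hl0 : 0 ≤ lam := (abs_nonneg _).trans (hlam 0)
  set s := Real.sin (t / ε) with hs
  set c := Real.cos (t / ε) with hc
  have hz1 : ∫ x in (0 : ℝ)..1, deriv (deriv V₀) x = 0 := intervalIntegral_deriv_periodic hW1 hWp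
  have hz2 := integral_sq_mul_deriv hW1 hWp
  have hD := S.integral_casimirDensity_mul hε A h0 hκ hQ hW hWp hp hpp s ht
  have hE := S.integral_field_sub_sq_mul (ε := ε) (vbar := vbar) hW hWp hp hpp c t
  have hDi := (S.integral_casimirDensity hε A h0 hκ hQ hW hWp s ht).1
  have hn := S.casimirDensity_nonneg A P (fun x => deriv V₀ (x - vbar * t) * s) ht
  rw [hz1, zero_mul, add_zero] at hD
  rw [hz2, mul_zero, add_zero] at hE
  set I₁ := ∫ z, casimirDensity Q μ vbar (fun x => deriv V₀ (x - vbar * t) * s) (f t) z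
    * deriv (deriv V₀) (z.1 - vbar * t) ∂phaseMeasure with hI1
  set I₂ := ∫ x in (0 : ℝ)..1, (ε * field V t x - deriv V₀ (x - vbar * t) * c) ^ 2
    * deriv (deriv V₀) (x - vbar * t) with hI2
  have b1 : |I₁| ≤ lam * ∫ z, casimirDensity Q μ vbar (fun x => deriv V₀ (x - vbar * t) * s) (f t) z
      ∂phaseMeasure := by
    rw [hI1, ← integral_const_mul, ← Real.norm_eq_abs]
    refine norm_integral_le_of_norm_le (hDi.const_mul lam) (Eventually.of_forall fun z => ?_)
    rw [Real.norm_eq_abs, abs_mul, abs_of_nonneg (hn z), mul_comm]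
    exact mul_le_mul_of_nonneg_right (hlam _) (hn z)
  have b2 : |I₂| ≤ lam * ∫ x in (0 : ℝ)..1, (ε * field V t x - deriv V₀ (x - vbar * t) * c) ^ 2 := by
    rw [hI2, ← intervalIntegral.integral_const_mul, ← Real.norm_eq_abs]
    refine intervalIntegral.norm_integral_le_of_norm_le zero_le_one
      (Eventually.of_forall fun x _ => ?_) (Continuous.intervalIntegrable (by fun_prop) _ _)
    rw [Real.norm_eq_abs, abs_mul, abs_of_nonneg (sq_nonneg _), mul_comm]
    exact mul_le_mul_of_nonneg_right (hlam _) (sq_nonneg _)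
  have b3 : 0 ≤ ∫ x in (0 : ℝ)..1, (ε * field V t x - deriv V₀ (x - vbar * t) * c) ^ 2 :=
    intervalIntegral.integral_nonneg zero_le_one fun x _ => sq_nonneg _
  have hL := S.realEnergy_eq hε A h0 hκ hQ (hV.of_le (by norm_num)) hVp ht
  rw [← hs, ← hc] at hL
  -- The modulated energy is the Casimir part plus half the field part, so doubling it covers the
  -- weights 2 and 1/2.
  have b4 : s * (2 * I₁ - 2⁻¹ * I₂) ≤ |s| * (2 * lam * realEnergy Q μ vbar ε V₀ f V t) := by
    refine (le_abs_self _).trans ?_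
    rw [abs_mul]
    refine mul_le_mul_of_nonneg_left ?_ (abs_nonneg _)
    rw [hL, abs_le]
    have b5 := mul_nonneg hl0 b3
    obtain ⟨b11, b12⟩ := abs_le.1 b1
    obtain ⟨b21, b22⟩ := abs_le.1 b2
    constructor <;> linarith
  have e : slope vbar ε V₀ f V t = s * (2 * I₁ - 2⁻¹ * I₂)
      - 2 * (s * casimirMom Q vbar f (deriv (deriv V₀)) t) + s * rotated vbar ε V₀ f V t
      - s ^ 3 * mom 0 vbar f (fun x => deriv V₀ x ^ 2 * deriv (deriv V₀) x) t := by
    rw [hD.2, hE, slope, rotated, ← hs, ← hc]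
    ring
  rw [e]
  linarith

end IsStrongSolution

end VlasovPoisson
end
-- Time integrals of the oscillating terms
open scoped ENNReal NNReal
noncomputable section
namespace VlasovPoisson

namespace IsStrongSolution

variable {ε : ℝ} {f : ℝ → ℝ → ℝ → ℝ} {V : ℝ → ℝ → ℝ} {vbar : ℝ} {μ Q : ℝ → ℝ}

theorem realEnergy_continuousOn (S : IsStrongSolution ε f V) (hε : 0 < ε)
    (h0 : Integrable (fun z : ℝ × ℝ => f 0 z.1 z.2 * (z.2 - vbar) ^ 2) phaseMeasure)
    {V₀ : ℝ → ℝ} (hV : ContDiff ℝ 1 V₀) (hVp : Function.Periodic V₀ 1) :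
    ContinuousOn (realEnergy Q μ vbar ε V₀ f V) (Ici 0) := by
  have hW := hV.continuous_deriv le_rfl
  have hWp := Periodic_deriv hVp
  have hWpp : Function.Periodic (fun x => deriv V₀ x ^ 2) 1 := fun x => by simp only [hWp x]
  have c0 : ContinuousOn (totalEnergy vbar ε f V) (Ici 0) :=
    continuousOn_const.congr fun t ht => S.totalEnergy_eq hε h0 ht
  have c1 := S.continuousOn_mom hε h0 hW hWp (k := 1) (by norm_num)
  have c2 := S.continuousOn_mom hε h0 (hW.pow 2) hWpp (k := 0) (by norm_num)
  have c3 := (S.continuous_fld hε (vbar := vbar) hW 1).continuousOn (s := Ici 0)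
  unfold realEnergy expandedEnergy
  fun_prop

theorem slope_continuousOn (S : IsStrongSolution ε f V) (hε : 0 < ε)
    (h0 : Integrable (fun z : ℝ × ℝ => f 0 z.1 z.2 * (z.2 - vbar) ^ 2) phaseMeasure)
    {V₀ : ℝ → ℝ} (hV : ContDiff ℝ 2 V₀) (hVp : Function.Periodic V₀ 1) :
    ContinuousOn (slope vbar ε V₀ f V) (Ici 0) := by
  have hW1 : ContDiff ℝ 1 (deriv V₀) := ((contDiff_succ_iff_deriv (n := 1)).1 hV).2.2
  have hW := hW1.continuous
  have hW' := hW1.continuous_deriv le_rfl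
  have hWp := Periodic_deriv hVp
  have hpp := Periodic_deriv hWp
  have c1 := S.continuousOn_mom hε h0 hW' hpp (k := 2) le_rfl
  have c2 := S.continuousOn_mom hε h0 (hW.mul hW') (hWp.mul hpp) (k := 1) (by norm_num)
  have c3 := (S.continuous_fld hε (vbar := vbar) hW' 2).continuousOn (s := Ici 0)
  have c4 := (S.continuous_fld hε (vbar := vbar) (hW.mul hW') 1).continuousOn (s := Ici 0)
  simp only [Pi.mul_def] at c2 c4
  unfold slope
  fun_prop

theorem rotated_continuousOn (S : IsStrongSolution ε f V) (hε : 0 < ε)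
    (h0 : Integrable (fun z : ℝ × ℝ => f 0 z.1 z.2 * (z.2 - vbar) ^ 2) phaseMeasure)
    {V₀ : ℝ → ℝ} (hV : ContDiff ℝ 2 V₀) (hVp : Function.Periodic V₀ 1) :
    ContinuousOn (rotated vbar ε V₀ f V) (Ici 0) := by
  have hW1 : ContDiff ℝ 1 (deriv V₀) := ((contDiff_succ_iff_deriv (n := 1)).1 hV).2.2
  have hW := hW1.continuous
  have hW' := hW1.continuous_deriv le_rfl
  have hWp := Periodic_deriv hVp
  have hpp := Periodic_deriv hWp
  have c2 := S.continuousOn_mom hε h0 (hW.mul hW') (hWp.mul hpp) (k := 1) (by norm_num)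
  have c4 := (S.continuous_fld hε (vbar := vbar) (hW.mul hW') 1).continuousOn (s := Ici 0)
  simp only [Pi.mul_def] at c2 c4
  unfold rotated
  fun_prop

theorem intervalIntegrable_of_continuousOn_Ici {g : ℝ → ℝ} (hg : ContinuousOn g (Ici 0)) {t : ℝ}
    (ht : 0 ≤ t) : IntervalIntegrable g volume 0 t :=
  (hg.mono fun _ h => h.1).intervalIntegrable_of_Icc ht

theorem realEnergy_sub (S : IsStrongSolution ε f V) (hε : 0 < ε)
    (h0 : Integrable (fun z : ℝ × ℝ => f 0 z.1 z.2 * (z.2 - vbar) ^ 2) phaseMeasure)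
    {V₀ : ℝ → ℝ} (hV : ContDiff ℝ 3 V₀) (hVp : Function.Periodic V₀ 1) {t : ℝ} (ht : 0 ≤ t) :
    realEnergy Q μ vbar ε V₀ f V t - realEnergy Q μ vbar ε V₀ f V 0
      = ∫ τ in (0 : ℝ)..t, slope vbar ε V₀ f V τ := by
  symm
  refine intervalIntegral.integral_eq_sub_of_hasDerivAt_of_le ht
    ((S.realEnergy_continuousOn hε h0 (hV.of_le (by norm_num)) hVp).mono fun _ h => h.1)
    (fun τ hτ => ?_) (intervalIntegrable_of_continuousOn_Ici
      (S.slope_continuousOn hε h0 (hV.of_le (by norm_num)) hVp) ht)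
  exact (S.hasDerivAt_expandedEnergy hε h0 hV hVp hτ.1).const_add _

/-- Integration by parts against `slowPhase` ≤ 2ε, the derivative of `rotated` being at most
(3/2)CM. The boundary term keeps its factor `slowPhase`: it involves L(0) through the energy, and
that part must be bounded by a multiple of t. -/
theorem integral_sin_mul_rotated_le (S : IsStrongSolution ε f V) (hε : 0 < ε)
    (h0 : Integrable (fun z : ℝ × ℝ => f 0 z.1 z.2 * (z.2 - vbar) ^ 2) phaseMeasure)
    {V₀ : ℝ → ℝ} (hV : ContDiff ℝ 3 V₀) (hVp : Function.Periodic V₀ 1) {C : ℝ}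
    (hC : ∀ x, |deriv (fun x => deriv V₀ x * deriv (deriv V₀) x) x| ≤ C) {t : ℝ} (ht : 0 ≤ t) :
    ∫ τ in (0 : ℝ)..t, Real.sin (τ / ε) * rotated vbar ε V₀ f V τ
      ≤ slowPhase ε t * |rotated vbar ε V₀ f V t|
        + ε * t * (3 * C * (2 * totalEnergy vbar ε f V 0)) := by
  have hC0 : 0 ≤ C := (abs_nonneg _).trans (hC 0)
  set M := 2 * totalEnergy vbar ε f V 0 with hM
  have hW2 : ContDiff ℝ 2 (deriv V₀) := ((contDiff_succ_iff_deriv (n := 2)).1 hV).2.2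
  have hW1 : ContDiff ℝ 1 (deriv V₀) := hW2.of_le (by norm_num)
  have hW' : ContDiff ℝ 1 (deriv (deriv V₀)) := ((contDiff_succ_iff_deriv (n := 1)).1 hW2).2.2
  have hWp := Periodic_deriv hVp
  have hG : ContDiff ℝ 1 fun x => deriv V₀ x * deriv (deriv V₀) x := hW1.mul hW'
  have hGp : Function.Periodic (fun x => deriv V₀ x * deriv (deriv V₀) x) 1 :=
    hWp.mul (Periodic_deriv hWp)
  set G' := deriv fun x => deriv V₀ x * deriv (deriv V₀) x with hG'
  have hGc : Continuous G' := hG.continuous_deriv le_rfl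
  have hGpp : Function.Periodic G' 1 := Periodic_deriv hGp
  set b := rotated vbar ε V₀ f V with hb
  set b' : ℝ → ℝ := fun τ => -Real.sin (τ / ε) * (mom 2 vbar f G' τ
    - ε ^ 2 / 2 * fld 2 vbar V G' τ) with hb'
  have hbc : ContinuousOn b (Ici 0) := S.rotated_continuousOn hε h0 (hV.of_le (by norm_num)) hVp
  have hbc' : ContinuousOn b' (Ici 0) := by
    have c1 := S.continuousOn_mom hε h0 hGc hGpp (k := 2) le_rfl
    have c3 := (S.continuous_fld hε (vbar := vbar) hGc 2).continuousOn (s := Ici 0)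
    rw [hb']
    fun_prop
  have hθc : ContinuousOn (slowPhase ε) (Ici 0) := (slowPhase_contDiff ε).continuous.continuousOn
  have hsc : ContinuousOn (fun τ => Real.sin (τ / ε)) (Ici 0) :=
    Continuous.continuousOn (by fun_prop)
  have i1 : IntervalIntegrable (fun τ => Real.sin (τ / ε) * b τ) volume 0 t :=
    intervalIntegrable_of_continuousOn_Ici (hsc.mul hbc) ht
  have i2 : IntervalIntegrable (fun τ => slowPhase ε τ * b' τ) volume 0 t :=
    intervalIntegrable_of_continuousOn_Ici (hθc.mul hbc') ht
  have hF := intervalIntegral.integral_eq_sub_of_hasDerivAt_of_le ht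
    (f := fun τ => slowPhase ε τ * b τ)
    (f' := fun τ => Real.sin (τ / ε) * b τ + slowPhase ε τ * b' τ)
    ((hθc.mul hbc).mono fun _ h => h.1)
    (fun τ hτ => (hasDerivAt_slowPhase hε τ).mul (S.hasDerivAt_rotated hε h0 hV hVp hτ.1))
    (i1.add i2)
  rw [slowPhase_zero, zero_mul, sub_zero, intervalIntegral.integral_add i1 i2] at hF
  have hb1 : ∀ τ, 0 ≤ τ → |b' τ| ≤ 3 / 2 * C * M := fun τ hτ => by
    have h1 := S.abs_mom_two_le hε h0 hC hτ
    have h2 := S.abs_fld_two_le hε h0 hC hτ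
    have h3 : |mom 2 vbar f G' τ - ε ^ 2 / 2 * fld 2 vbar V G' τ| ≤ 3 / 2 * C * M := by
      rw [abs_le] at h1 h2 ⊢
      constructor <;> linarith
    rw [hb', abs_mul, abs_neg]
    exact (mul_le_of_le_one_left (abs_nonneg _) (Real.abs_sin_le_one _)).trans h3
  have h2 : |∫ τ in (0 : ℝ)..t, slowPhase ε τ * b' τ| ≤ 2 * ε * (3 / 2 * C * M) * t := by
    have := intervalIntegral.norm_integral_le_of_norm_le_const (a := 0) (b := t)
      (f := fun τ => slowPhase ε τ * b' τ) (C := 2 * ε * (3 / 2 * C * M)) fun τ hτ => by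
        rw [uIoc_of_le ht] at hτ
        rw [Real.norm_eq_abs, abs_mul, abs_of_nonneg (slowPhase_nonneg hε τ)]
        exact mul_le_mul (slowPhase_le_two_mul hε τ) (hb1 τ hτ.1.le) (abs_nonneg _) (by positivity)
    rwa [sub_zero, abs_of_nonneg ht] at this
  have h3 := mul_le_mul_of_nonneg_left (le_abs_self (b t)) (slowPhase_nonneg hε t)
  have h4 := (abs_le.1 h2).1
  linarith

/-- Here the boundary term involves only the conserved Casimir bound, so `slowPhase` may be replaced
by 2ε at once. -/
theorem integral_neg_sin_mul_casimirMom_le (S : IsStrongSolution ε f V) (hε : 0 < ε)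
    (A : IsAdmissible μ vbar Q)
    (h0 : Integrable (fun z : ℝ × ℝ => f 0 z.1 z.2 * (z.2 - vbar) ^ 2) phaseMeasure)
    (hQ : casimirBound Q (f 0) < ⊤) {p : ℝ → ℝ} (hp : ContDiff ℝ 1 p)
    (hpp : Function.Periodic p 1) {C C' : ℝ} (hC : ∀ x, |p x| ≤ C) (hC' : ∀ x, |deriv p x| ≤ C')
    {t : ℝ} (ht : 0 ≤ t) :
    -∫ τ in (0 : ℝ)..t, Real.sin (τ / ε) * casimirMom Q vbar f p τ
      ≤ 2 * ε * (C * (casimirBound Q (f 0)).toReal)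
        + ε * t * (C' * ((casimirBound Q (f 0)).toReal + 2 * totalEnergy vbar ε f V 0)) := by
  have hpc := hp.continuous
  have hdc : Continuous (deriv p) := hp.continuous_deriv le_rfl
  have hθc : Continuous (slowPhase ε) := (slowPhase_contDiff ε).continuous
  have hsc : Continuous fun τ => Real.sin (τ / ε) := by fun_prop
  have i1 := (S.intervalIntegrable_casimirMom hε A hQ hpc hC ht).continuousOn_mul hsc.continuousOn
  have h1 := S.intervalIntegrable_casimirFlux hε A h0 hQ hdc hC' ht
  have i2 := h1.1.continuousOn_mul hθc.continuousOn
  have e := S.integral_sin_mul_casimirMom hε A h0 hQ hp hpp ht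
  rw [intervalIntegral.integral_add i1 i2] at e
  set D := (casimirBound Q (f 0)).toReal + 2 * totalEnergy vbar ε f V 0 with hD
  have h2 : |∫ τ in (0 : ℝ)..t, slowPhase ε τ * casimirFlux Q vbar f (deriv p) τ|
      ≤ 2 * ε * (C' * (2⁻¹ * D)) * t := by
    have := intervalIntegral.norm_integral_le_of_norm_le_const (a := 0) (b := t)
      (f := fun τ => slowPhase ε τ * casimirFlux Q vbar f (deriv p) τ)
      (C := 2 * ε * (C' * (2⁻¹ * D))) fun τ hτ => by
        rw [uIoc_of_le ht] at hτ
        rw [Real.norm_eq_abs, abs_mul, abs_of_nonneg (slowPhase_nonneg hε τ)]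
        exact mul_le_mul (slowPhase_le_two_mul hε τ) (h1.2 τ hτ.1.le) (abs_nonneg _)
          (by positivity)
    rwa [sub_zero, abs_of_nonneg ht] at this
  have h3 : |slowPhase ε t * casimirMom Q vbar f p t|
      ≤ 2 * ε * (C * (casimirBound Q (f 0)).toReal) := by
    rw [abs_mul, abs_of_nonneg (slowPhase_nonneg hε t)]
    exact mul_le_mul (slowPhase_le_two_mul hε t) (S.abs_casimirMom_le hε A hQ hC ht)
      (abs_nonneg _) (by positivity)
  have h4 := (abs_le.1 h2).2
  have h5 := (abs_le.1 h3).1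
  linarith

theorem abs_rotated_le (S : IsStrongSolution ε f V) (hε : 0 < ε)
    (h0 : Integrable (fun z : ℝ × ℝ => f 0 z.1 z.2 * (z.2 - vbar) ^ 2) phaseMeasure)
    {V₀ : ℝ → ℝ} {C : ℝ} (hC : ∀ x, |deriv V₀ x * deriv (deriv V₀) x| ≤ C) {t : ℝ} (ht : 0 ≤ t)
    {δ : ℝ} (hδ : 0 < δ) : |rotated vbar ε V₀ f V t|
      ≤ C * (δ * (2 * totalEnergy vbar ε f V 0) + 1 / δ) := by
  have h1 := S.abs_mom_one_le hε h0 hC ht hδ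
  have h2 := S.abs_fld_one_le hε h0 (vbar := vbar) hC ht hδ
  rw [rotated]
  refine (abs_sub _ _).trans ?_
  rw [abs_mul (Real.cos _), abs_mul (Real.sin _)]
  have h3 := mul_le_of_le_one_left (abs_nonneg (ε * fld 1 vbar V
    (fun x => deriv V₀ x * deriv (deriv V₀) x) t)) (Real.abs_cos_le_one (t / ε))
  have h4 := mul_le_of_le_one_left (abs_nonneg (mom 1 vbar f
    (fun x => deriv V₀ x * deriv (deriv V₀) x) t)) (Real.abs_sin_le_one (t / ε))
  linarith

end IsStrongSolution

end VlasovPoisson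
end
-- The two integrated energy inequalities
open scoped ENNReal NNReal
noncomputable section
namespace VlasovPoisson

namespace IsStrongSolution

variable {ε : ℝ} {f : ℝ → ℝ → ℝ → ℝ} {V : ℝ → ℝ → ℝ} {vbar : ℝ} {μ Q : ℝ → ℝ}

theorem totalEnergy_nonneg (S : IsStrongSolution ε f V) : 0 ≤ totalEnergy vbar ε f V 0 := by
  rw [totalEnergy]
  have h1 := S.mom_two_one_nonneg (vbar := vbar) (le_refl (0 : ℝ))
  have h2 := fld_two_one_nonneg (vbar := vbar) (V := V) 0
  rw [mom_two_one] at h1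
  rw [fld_two_one] at h2
  positivity

/-- The integrated energy inequality, before the oscillating terms are estimated. -/
theorem realEnergy_le_integral (S : IsStrongSolution ε f V) (hε : 0 < ε) (A : IsAdmissible μ vbar Q)
    (P : IsSStable μ vbar)
    (h0 : Integrable (fun z : ℝ × ℝ => f 0 z.1 z.2 * (z.2 - vbar) ^ 2) phaseMeasure)
    (hκ : Integrable (fun z : ℝ × ℝ => casimirConst Q μ vbar z.2) phaseMeasure)
    (hQ : casimirBound Q (f 0) < ⊤)
    {V₀ : ℝ → ℝ} (hV : ContDiff ℝ 3 V₀) (hVp : Function.Periodic V₀ 1) {lam C : ℝ}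
    (hlam : ∀ x, |deriv (deriv V₀) x| ≤ lam) {t : ℝ} (ht : 0 ≤ t)
    (hC : ∀ τ, 0 ≤ τ →
      |mom 0 vbar f (fun x => deriv V₀ x ^ 2 * deriv (deriv V₀) x) τ| ≤ C) :
    realEnergy Q μ vbar ε V₀ f V t ≤ realEnergy Q μ vbar ε V₀ f V 0
      + (∫ τ in (0 : ℝ)..t, 2 * lam * |Real.sin (τ / ε)| * realEnergy Q μ vbar ε V₀ f V τ)
      - 2 * (∫ τ in (0 : ℝ)..t, Real.sin (τ / ε) * casimirMom Q vbar f (deriv (deriv V₀)) τ)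
      + (∫ τ in (0 : ℝ)..t, Real.sin (τ / ε) * rotated vbar ε V₀ f V τ) + C * t := by
  have hV2 : ContDiff ℝ 2 V₀ := hV.of_le (by norm_num)
  have hW2 : ContDiff ℝ 2 (deriv V₀) := ((contDiff_succ_iff_deriv (n := 2)).1 hV).2.2
  have hp : Continuous (deriv (deriv V₀)) := (hW2.of_le (by norm_num)).continuous_deriv le_rfl
  have hsc : Continuous fun τ => Real.sin (τ / ε) := by fun_prop
  have i1 : IntervalIntegrable (fun τ => 2 * lam * |Real.sin (τ / ε)| *
      realEnergy Q μ vbar ε V₀ f V τ) volume 0 t := by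
    have h1 := S.realEnergy_continuousOn (Q := Q) (μ := μ) hε h0 (hV.of_le (by norm_num)) hVp
    refine intervalIntegrable_of_continuousOn_Ici ?_ ht
    have h2 : ContinuousOn (fun τ => 2 * lam * |Real.sin (τ / ε)|) (Ici 0) :=
      Continuous.continuousOn (by fun_prop)
    exact h2.mul h1
  have i2 : IntervalIntegrable (fun τ => 2 * (Real.sin (τ / ε) *
      casimirMom Q vbar f (deriv (deriv V₀)) τ)) volume 0 t :=
    ((S.intervalIntegrable_casimirMom hε A hQ hp hlam ht).continuousOn_mul
      hsc.continuousOn).const_mul 2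
  have i3 : IntervalIntegrable (fun τ => Real.sin (τ / ε) * rotated vbar ε V₀ f V τ) volume 0 t :=
    intervalIntegrable_of_continuousOn_Ici
      (hsc.continuousOn.mul (S.rotated_continuousOn hε h0 hV2 hVp)) ht
  have i4 : IntervalIntegrable (fun _ => C) volume 0 t := intervalIntegrable_const
  have h := intervalIntegral.integral_mono_on ht (intervalIntegrable_of_continuousOn_Ici
    (S.slope_continuousOn hε h0 hV2 hVp) ht) (((i1.sub i2).add i3).add i4) fun τ hτ => by
      have h1 := S.slope_le hε A P h0 hκ hQ hV hVp hlam hτ.1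
      have h2 : -(Real.sin (τ / ε) ^ 3 * mom 0 vbar f
          (fun x => deriv V₀ x ^ 2 * deriv (deriv V₀) x) τ) ≤ C := by
        refine (neg_le_abs _).trans ?_
        rw [abs_mul, abs_pow]
        exact (mul_le_of_le_one_left (abs_nonneg _)
          (pow_le_one₀ (abs_nonneg _) (Real.abs_sin_le_one _))).trans (hC τ hτ.1)
      show slope vbar ε V₀ f V τ ≤ 2 * lam * |Real.sin (τ / ε)| * realEnergy Q μ vbar ε V₀ f V τ
        - 2 * (Real.sin (τ / ε) * casimirMom Q vbar f (deriv (deriv V₀)) τ)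
        + Real.sin (τ / ε) * rotated vbar ε V₀ f V τ + C
      linarith
  rw [← S.realEnergy_sub (Q := Q) (μ := μ) hε h0 hV hVp ht,
    intervalIntegral.integral_add ((i1.sub i2).add i3) i4,
    intervalIntegral.integral_add (i1.sub i2) i3, intervalIntegral.integral_sub i1 i2,
    intervalIntegral.integral_const_mul, intervalIntegral.integral_const] at h
  simp only [sub_zero, smul_eq_mul] at h
  linarith

theorem abs_deriv_mul_le {V₀ : ℝ → ℝ} (hV : ContDiff ℝ 3 V₀) {lam Lam : ℝ}
    (h1 : ∀ x, |deriv V₀ x| ≤ lam) (h2 : ∀ x, |deriv (deriv V₀) x| ≤ lam)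
    (h3 : ∀ x, |deriv (deriv (deriv V₀)) x| ≤ Lam) (x : ℝ) :
    |deriv (fun x => deriv V₀ x * deriv (deriv V₀) x) x| ≤ lam ^ 2 + lam * Lam ∧
    |deriv (fun x => deriv V₀ x ^ 2 * deriv (deriv V₀) x) x| ≤ 2 * lam ^ 3 + lam ^ 2 * Lam := by
  have hl : 0 ≤ lam := (abs_nonneg _).trans (h1 0)
  have hW2 : ContDiff ℝ 2 (deriv V₀) := ((contDiff_succ_iff_deriv (n := 2)).1 hV).2.2
  have d1 : HasDerivAt (deriv V₀) (deriv (deriv V₀) x) x :=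
    (hW2.differentiable (by norm_num) x).hasDerivAt
  have d2 : HasDerivAt (deriv (deriv V₀)) (deriv (deriv (deriv V₀)) x) x :=
    ((((contDiff_succ_iff_deriv (n := 1)).1 hW2).2.2).differentiable (by norm_num) x).hasDerivAt
  have a1 := h1 x
  have a2 := h2 x
  have a3 := h3 x
  rw [(d1.fun_mul d2).deriv, ((d1.fun_pow 2).fun_mul d2).deriv]
  constructor
  · refine (abs_add_le _ _).trans ?_
    rw [abs_mul, abs_mul, pow_two]
    gcongr
  · refine (abs_add_le _ _).trans ?_
    rw [abs_mul, abs_mul, abs_mul, abs_mul]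
    simp only [abs_pow, Nat.cast_ofNat, Nat.abs_ofNat, Nat.add_one_sub_one, pow_one]
    calc _ ≤ 2 * lam * lam * lam + lam ^ 2 * Lam := by gcongr
      _ = _ := by ring

/-- The integrated energy inequality with errors of order `ε`. -/
theorem realEnergy_le_small (S : IsStrongSolution ε f V) (hε : 0 < ε) (A : IsAdmissible μ vbar Q)
    (P : IsSStable μ vbar)
    (h0 : Integrable (fun z : ℝ × ℝ => f 0 z.1 z.2 * (z.2 - vbar) ^ 2) phaseMeasure)
    (hκ : Integrable (fun z : ℝ × ℝ => casimirConst Q μ vbar z.2) phaseMeasure)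
    (hQ : casimirBound Q (f 0) < ⊤)
    {V₀ : ℝ → ℝ} (hV : ContDiff ℝ 3 V₀) (hVp : Function.Periodic V₀ 1) {lam Lam : ℝ}
    (hlam : ∀ x, |deriv (deriv V₀) x| ≤ lam) (hLam : ∀ x, |deriv (deriv (deriv V₀)) x| ≤ Lam)
    {δ : ℝ} (hδ : 0 < δ) {t : ℝ} (ht : 0 ≤ t) :
    realEnergy Q μ vbar ε V₀ f V t ≤ realEnergy Q μ vbar ε V₀ f V 0
      + (∫ τ in (0 : ℝ)..t, 2 * lam * |Real.sin (τ / ε)| * realEnergy Q μ vbar ε V₀ f V τ)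
      + 4 * ε * lam * (casimirBound Q (f 0)).toReal
      + slowPhase ε t * (lam ^ 2 * (δ * (2 * totalEnergy vbar ε f V 0) + 1 / δ))
      + ε * t * ((2 * Lam + 3 * (lam ^ 2 + lam * Lam) + (2 * lam ^ 3 + lam ^ 2 * Lam)) *
        (1 + (casimirBound Q (f 0)).toReal + 2 * totalEnergy vbar ε f V 0)) := by
  have hV1 : ContDiff ℝ 1 V₀ := hV.of_le (by norm_num)
  have hW2 : ContDiff ℝ 2 (deriv V₀) := ((contDiff_succ_iff_deriv (n := 2)).1 hV).2.2
  have hW1 : ContDiff ℝ 1 (deriv V₀) := hW2.of_le (by norm_num)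
  have hW' : ContDiff ℝ 1 (deriv (deriv V₀)) := ((contDiff_succ_iff_deriv (n := 1)).1 hW2).2.2
  have hWp := Periodic_deriv hVp
  have hpp := Periodic_deriv hWp
  have hW0 := abs_deriv_le_of_periodic (hV.of_le (by norm_num)) hVp hlam
  have hl : 0 ≤ lam := (abs_nonneg _).trans (hlam 0)
  have hL : 0 ≤ Lam := (abs_nonneg _).trans (hLam 0)
  have hd := abs_deriv_mul_le hV hW0 hlam hLam
  set M := 2 * totalEnergy vbar ε f V 0 with hM
  have hM0 : 0 ≤ M := mul_nonneg (by norm_num) S.totalEnergy_nonneg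
  have hP : ContDiff ℝ 1 fun x => deriv V₀ x ^ 2 * deriv (deriv V₀) x := (hW1.pow 2).mul hW'
  have hPp : Function.Periodic (fun x => deriv V₀ x ^ 2 * deriv (deriv V₀) x) 1 := fun x => by
    simp only [hWp x, hpp x]
  have hz := integral_sq_mul_deriv hW1 hWp
  -- As W²W' has mean zero, the Poisson equation turns its charge moment into ε² times a field
  -- moment; Young's inequality with δ = 1 bounds the latter, and one factor ε remains.
  have h1 := S.realEnergy_le_integral hε A P h0 hκ hQ hV hVp hlam ht
    (C := ε * ((2 * lam ^ 3 + lam ^ 2 * Lam) * (2⁻¹ * (1 * M + 1 / 1)))) fun τ hτ => by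
      rw [S.mom_zero_eq hε hP hPp hτ, hz, zero_add, pow_two, mul_assoc, abs_mul, abs_of_pos hε]
      exact mul_le_mul_of_nonneg_left
        (S.abs_fld_one_le hε h0 (fun x => (hd x).2) hτ one_pos) hε.le
  have h2 := S.integral_neg_sin_mul_casimirMom_le hε A h0 hQ hW' hpp hlam hLam ht
  have h3 := S.integral_sin_mul_rotated_le hε h0 hV hVp (fun x => (hd x).1) ht
  have h4 := mul_le_mul_of_nonneg_left (S.abs_rotated_le hε h0 (V₀ := V₀) (C := lam ^ 2) (fun x => by
    rw [abs_mul, pow_two]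
    exact mul_le_mul (hW0 x) (hlam x) (abs_nonneg _) hl) ht hδ) (slowPhase_nonneg hε t)
  set q := (casimirBound Q (f 0)).toReal with hq
  have hq0 : 0 ≤ q := ENNReal.toReal_nonneg
  rw [← hM] at h2 h3 h4
  have c1 : 0 ≤ lam ^ 2 + lam * Lam := by positivity
  have c2 : 0 ≤ 2 * lam ^ 3 + lam ^ 2 * Lam := by positivity
  have hεt : 0 ≤ ε * t := mul_nonneg hε.le ht
  -- The announced coefficient equals the sum of the errors proportional to εt plus a nonnegative
  -- rest.
  have e : ε * t * ((2 * Lam + 3 * (lam ^ 2 + lam * Lam) + (2 * lam ^ 3 + lam ^ 2 * Lam)) *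
        (1 + q + M)) = 2 * (ε * t * (Lam * (q + M))) + ε * t * (3 * (lam ^ 2 + lam * Lam) * M)
        + ε * ((2 * lam ^ 3 + lam ^ 2 * Lam) * (2⁻¹ * (1 * M + 1 / 1))) * t
        + ε * t * (2 * Lam + 3 * (lam ^ 2 + lam * Lam) * (1 + q)
          + (2 * lam ^ 3 + lam ^ 2 * Lam) * (2⁻¹ + q + 2⁻¹ * M)) := by
    ring
  have h5 : 0 ≤ ε * t * (2 * Lam + 3 * (lam ^ 2 + lam * Lam) * (1 + q)
          + (2 * lam ^ 3 + lam ^ 2 * Lam) * (2⁻¹ + q + 2⁻¹ * M)) := by positivity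
  rw [e]
  linarith

/-- The integrated energy inequality without integration by parts. -/
theorem realEnergy_le_large (S : IsStrongSolution ε f V) (hε : 0 < ε) (A : IsAdmissible μ vbar Q)
    (P : IsSStable μ vbar)
    (h0 : Integrable (fun z : ℝ × ℝ => f 0 z.1 z.2 * (z.2 - vbar) ^ 2) phaseMeasure)
    (hκ : Integrable (fun z : ℝ × ℝ => casimirConst Q μ vbar z.2) phaseMeasure)
    (hQ : casimirBound Q (f 0) < ⊤)
    {V₀ : ℝ → ℝ} (hV : ContDiff ℝ 3 V₀) (hVp : Function.Periodic V₀ 1) {lam : ℝ}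
    (hlam : ∀ x, |deriv (deriv V₀) x| ≤ lam) {δ : ℝ} (hδ : 0 < δ) {t : ℝ} (ht : 0 ≤ t) :
    realEnergy Q μ vbar ε V₀ f V t ≤ realEnergy Q μ vbar ε V₀ f V 0
      + (∫ τ in (0 : ℝ)..t, 2 * lam * |Real.sin (τ / ε)| * realEnergy Q μ vbar ε V₀ f V τ)
      + t * (2 * lam * (casimirBound Q (f 0)).toReal
        + lam ^ 2 * (δ * (2 * totalEnergy vbar ε f V 0) + 1 / δ) + lam ^ 3) := by
  have hW0 := abs_deriv_le_of_periodic (hV.of_le (by norm_num)) hVp hlam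
  have hl : 0 ≤ lam := (abs_nonneg _).trans (hlam 0)
  have h1 := S.realEnergy_le_integral hε A P h0 hκ hQ hV hVp hlam ht (C := lam ^ 3) fun τ hτ =>
    S.abs_mom_zero_le hε (fun x => by
      rw [abs_mul, abs_pow, pow_succ lam 2]
      exact mul_le_mul (pow_le_pow_left₀ (abs_nonneg _) (hW0 x) 2) (hlam x) (abs_nonneg _)
        (by positivity)) hτ
  have aux : ∀ {g : ℝ → ℝ} {C : ℝ}, (∀ τ, 0 ≤ τ → |g τ| ≤ C) →
      |∫ τ in (0 : ℝ)..t, Real.sin (τ / ε) * g τ| ≤ C * t := fun {g C} hg => by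
    have := intervalIntegral.norm_integral_le_of_norm_le_const (a := 0) (b := t)
      (f := fun τ => Real.sin (τ / ε) * g τ) (C := C) fun τ hτ => by
        rw [uIoc_of_le ht] at hτ
        rw [Real.norm_eq_abs, abs_mul]
        exact (mul_le_of_le_one_left (abs_nonneg _) (Real.abs_sin_le_one _)).trans (hg τ hτ.1.le)
    rwa [sub_zero, abs_of_nonneg ht] at this
  have h2 := (abs_le.1 (aux fun τ hτ => S.abs_casimirMom_le hε A hQ hlam hτ)).1
  have h3 := (abs_le.1 (aux fun τ hτ => S.abs_rotated_le hε h0 (V₀ := V₀) (C := lam ^ 2) (fun x => by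
    rw [abs_mul, pow_two]
    exact mul_le_mul (hW0 x) (hlam x) (abs_nonneg _) hl) hτ hδ)).2
  linarith

end IsStrongSolution

end VlasovPoisson
end
-- Averaged Grönwall estimate and absorption of the errors
open scoped ENNReal NNReal
noncomputable section
namespace VlasovPoisson

/-- The right side is (1 + sin²x)/2. It has an elementary primitive and mean 3/4, and the gap
between 3/4 and 1 is the source of the spare exponential. -/
theorem abs_sin_le (x : ℝ) : |Real.sin x| ≤ 3 / 4 - Real.cos (2 * x) / 4 := by
  rw [Real.cos_two_mul]
  have h1 := Real.sin_sq_add_cos_sq x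
  rw [← sq_abs (Real.sin x)] at h1
  nlinarith [sq_nonneg (|Real.sin x| - 1)]

/-- Up to π the sine is nonnegative; beyond π one has 3x/5 > 1. The bound has no additive constant,
so the Grönwall factor carries no prefactor that would spoil the coefficient of L(0). -/
theorem neg_sin_le {x : ℝ} (hx : 0 ≤ x) : -Real.sin x ≤ 3 / 5 * x := by
  rcases le_total x Real.pi with h | h
  · linarith [Real.sin_nonneg_of_nonneg_of_le_pi hx h]
  · linarith [Real.neg_one_le_sin x, Real.pi_gt_three]

/-- The Gronwall estimate with the averaged rate `1.8 λ`. -/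
theorem gronwall_sin {L : ℝ → ℝ} (hL : ContinuousOn L (Ici 0)) (hL0 : ∀ t, 0 ≤ t → 0 ≤ L t)
    {ε lam A D : ℝ} (hε : 0 < ε) (hlam : 0 ≤ lam) (hA : 0 ≤ A) (hD : 0 ≤ D)
    (h : ∀ t, 0 ≤ t → L t ≤ A + D * t
      + ∫ τ in (0 : ℝ)..t, 2 * lam * |Real.sin (τ / ε)| * L τ) {t : ℝ} (ht : 0 ≤ t) :
    L t ≤ (A + D * t) * Real.exp (9 / 5 * lam * t) := by
  set k : ℝ → ℝ := fun τ => 2 * lam * (3 / 4 - Real.cos (2 * (τ / ε)) / 4) with hk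
  set κ : ℝ → ℝ := fun τ => 2 * lam * (3 / 4 * τ - ε / 8 * Real.sin (2 * (τ / ε))) with hκ
  have hkc : Continuous k := by fun_prop
  have hkκ : ∀ τ, HasDerivAt κ (k τ) τ := fun τ => by
    have h1 : HasDerivAt (fun τ => Real.sin (2 * (τ / ε))) (Real.cos (2 * (τ / ε)) * (2 * (1 / ε))) τ :=
      (((hasDerivAt_id τ).div_const ε).const_mul 2).sin
    refine ((((hasDerivAt_id τ).const_mul (3 / 4)).sub (h1.const_mul (ε / 8))).const_mul
      (2 * lam)).congr_deriv ?_
    simp only [hk]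
    field_simp
    ring
  have hg := gronwall_integral hL hkc (fun τ => mul_nonneg (by positivity)
    (by linarith [Real.cos_le_one (2 * (τ / ε))])) hkκ (by simp [hκ]) hD (A := A) (fun t ht => ?_) ht
  · refine hg.trans (mul_le_mul_of_nonneg_left (Real.exp_le_exp.2 ?_) (by positivity))
    -- The oscillating part of κ adds at most 3/20 to the mean 3/4, and 2λ · 9/10 = (9/5)λ.
    have h1 := neg_sin_le (x := 2 * (t / ε)) (by positivity)
    have h2 : ε / 8 * -Real.sin (2 * (t / ε)) ≤ ε / 8 * (3 / 5 * (2 * (t / ε))) := by gcongr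
    have h3 : ε / 8 * (3 / 5 * (2 * (t / ε))) = 3 / 20 * t := by field_simp; ring
    have h4 : 3 / 4 * t - ε / 8 * Real.sin (2 * (t / ε)) ≤ 9 / 10 * t := by linarith
    calc κ t ≤ 2 * lam * (9 / 10 * t) := mul_le_mul_of_nonneg_left h4 (by positivity)
      _ = _ := by ring
  · have hc : ContinuousOn (fun τ => k τ * L τ) (Ici 0) := hkc.continuousOn.mul hL
    have hc' : ContinuousOn (fun τ => 2 * lam * |Real.sin (τ / ε)| * L τ) (Ici 0) := by
      have : ContinuousOn (fun τ => 2 * lam * |Real.sin (τ / ε)|) (Ici 0) :=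
        Continuous.continuousOn (by fun_prop)
      exact this.mul hL
    have i1 := IsStrongSolution.intervalIntegrable_of_continuousOn_Ici hc ht
    have i2 := IsStrongSolution.intervalIntegrable_of_continuousOn_Ici hc' ht
    rw [intervalIntegral.integral_add i1 intervalIntegrable_const, intervalIntegral.integral_const,
      sub_zero, smul_eq_mul]
    have h1 := intervalIntegral.integral_mono_on ht i2 i1 fun τ hτ =>
      mul_le_mul_of_nonneg_right (mul_le_mul_of_nonneg_left (abs_sin_le (τ / ε))
        (show 0 ≤ 2 * lam by positivity)) (hL0 τ hτ.1)
    linarith [h t ht]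

/-- The constant of the stability estimate. -/
def stabilityConst (lam Lam : ℝ) : ℝ :=
  let δ := 1 / (80 * lam)
  let C₁ := 2 * Lam + 3 * (lam ^ 2 + lam * Lam) + (2 * lam ^ 3 + lam ^ 2 * Lam)
  let C₄ := 2 * lam + lam ^ 2 * (δ * (4 + 2 * lam ^ 2) + 1 / δ) + lam ^ 3
  max 1 ((2 * C₄ + C₁ * (5 + 2 * lam ^ 2) + C₄ * (80 * C₁ / lam)) * (1 + 5 / lam))

/-- Both inequalities lead to the same form: the constant is L(0) + εC(1+q) and the coefficient of t
is λL(0)/10 + εC(1+q). The averaged Grönwall estimate then leaves exp(λt/5), which absorbs the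
polynomial growth in t without increasing the coefficient of L(0). -/
theorem le_of_energy_inequalities {L : ℝ → ℝ} (hL : ContinuousOn L (Ici 0))
    (hL0 : ∀ t, 0 ≤ t → 0 ≤ L t) {ε lam Lam q M : ℝ} (hε : 0 < ε) (hlam : 0 < lam) (hLam : 0 ≤ Lam)
    (hq : 0 ≤ q) (hM : M ≤ 4 * (L 0 + q) + 2 * lam ^ 2)
    (h1 : ∀ δ, 0 < δ → ∀ t, 0 ≤ t → L t ≤ L 0
      + (∫ τ in (0 : ℝ)..t, 2 * lam * |Real.sin (τ / ε)| * L τ) + 4 * ε * lam * q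
      + slowPhase ε t * (lam ^ 2 * (δ * M + 1 / δ))
      + ε * t * ((2 * Lam + 3 * (lam ^ 2 + lam * Lam) + (2 * lam ^ 3 + lam ^ 2 * Lam)) *
        (1 + q + M)))
    (h2 : ∀ δ, 0 < δ → ∀ t, 0 ≤ t → L t ≤ L 0
      + (∫ τ in (0 : ℝ)..t, 2 * lam * |Real.sin (τ / ε)| * L τ)
      + t * (2 * lam * q + lam ^ 2 * (δ * M + 1 / δ) + lam ^ 3)) {t : ℝ} (ht : 0 ≤ t) :
    L t ≤ Real.exp (2 * lam * t) * (L 0 + stabilityConst lam Lam * ε * (1 + q)) := by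
  -- With M ≤ 4L(0) + ..., this choice makes the L(0) part of λ²δM equal to λL(0)/20, half of the
  -- allowance λL(0)/10.
  set δ := 1 / (80 * lam) with hδ
  set C₁ := 2 * Lam + 3 * (lam ^ 2 + lam * Lam) + (2 * lam ^ 3 + lam ^ 2 * Lam) with hC₁
  set C₄ := 2 * lam + lam ^ 2 * (δ * (4 + 2 * lam ^ 2) + 1 / δ) + lam ^ 3 with hC₄
  set C := 2 * C₄ + C₁ * (5 + 2 * lam ^ 2) + C₄ * (80 * C₁ / lam) with hC
  have hδ0 : 0 < δ := by positivity
  have hC₁0 : 0 ≤ C₁ := by positivity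
  have hC₄0 : 0 ≤ C₄ := by positivity
  have hC0 : 0 ≤ C := by positivity
  have hl0 := hL0 0 le_rfl
  have hδl : lam ^ 2 * (δ * (4 * L 0)) = lam / 20 * L 0 := by
    rw [hδ]; field_simp; ring
  have hKC : C * (1 + 5 / lam) ≤ stabilityConst lam Lam := le_max_right _ _
  have hδM : lam ^ 2 * (δ * M + 1 / δ) ≤ lam / 20 * L 0
      + (lam ^ 2 * (δ * (4 + 2 * lam ^ 2) + 1 / δ)) * (1 + q) := by
    have e1 : lam ^ 2 * (δ * M + 1 / δ) ≤ lam ^ 2 * (δ * (4 * (L 0 + q) + 2 * lam ^ 2) + 1 / δ) := by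
      gcongr
    have e2 : 0 ≤ lam ^ 2 * (δ * (4 + 2 * lam ^ 2 * q) + 1 / δ * q) := by positivity
    have e3 : (lam ^ 2 * (δ * (4 + 2 * lam ^ 2) + 1 / δ)) * (1 + q)
        = lam ^ 2 * (δ * (4 * q + 2 * lam ^ 2) + 1 / δ)
          + lam ^ 2 * (δ * (4 + 2 * lam ^ 2 * q) + 1 / δ * q) := by ring
    have e4 : lam ^ 2 * (δ * (4 * (L 0 + q) + 2 * lam ^ 2) + 1 / δ)
        = lam ^ 2 * (δ * (4 * L 0)) + lam ^ 2 * (δ * (4 * q + 2 * lam ^ 2) + 1 / δ) := by ring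
    linarith
  have hδM' : 2 * lam * q + lam ^ 2 * (δ * M + 1 / δ) + lam ^ 3
      ≤ lam / 20 * L 0 + C₄ * (1 + q) := by
    have e1 : 0 ≤ 2 * lam + lam ^ 3 * q := by positivity
    have e2 : C₄ * (1 + q) = 2 * lam * q + (lam ^ 2 * (δ * (4 + 2 * lam ^ 2) + 1 / δ)) * (1 + q)
        + lam ^ 3 + (2 * lam + lam ^ 3 * q) := by rw [hC₄]; ring
    linarith
  have key : ∀ t, 0 ≤ t → L t ≤ (L 0 + ε * C * (1 + q)) + (lam / 10 * L 0 + ε * C * (1 + q)) * t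
      + ∫ τ in (0 : ℝ)..t, 2 * lam * |Real.sin (τ / ε)| * L τ := by
    intro t ht
    -- For small ε, the term 4C₁εtL(0) fits into the other half λtL(0)/20 of the allowance. For
    -- large ε no smallness has to be gained.
    rcases le_total (80 * C₁ / lam * ε) 1 with hs | hs
    · have g := h1 δ hδ0 t ht
      have hs' : ε * (4 * C₁) ≤ lam / 20 := by
        have : 80 * C₁ / lam * ε = 80 * C₁ * ε / lam := by ring
        rw [this, div_le_one hlam] at hs
        linarith
      -- The part with L(0) is paid with `slowPhase` ≤ t, the rest with `slowPhase` ≤ 2ε.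
      have a1 : slowPhase ε t * (lam ^ 2 * (δ * M + 1 / δ)) ≤ t * (lam / 20 * L 0)
          + 2 * ε * ((lam ^ 2 * (δ * (4 + 2 * lam ^ 2) + 1 / δ)) * (1 + q)) := by
        refine (mul_le_mul_of_nonneg_left hδM (slowPhase_nonneg hε t)).trans ?_
        rw [mul_add]
        have p1 : 0 ≤ lam / 20 * L 0 := by positivity
        exact add_le_add (mul_le_mul_of_nonneg_right (slowPhase_le_self hε ht) p1)
          (mul_le_mul_of_nonneg_right (slowPhase_le_two_mul hε t) (by positivity))
      have a2 : ε * t * (C₁ * (1 + q + M)) ≤ lam / 20 * L 0 * t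
          + ε * (C₁ * (5 + 2 * lam ^ 2)) * (1 + q) * t := by
        have p1 : ε * t * (C₁ * (1 + q + M))
            ≤ ε * t * (C₁ * (1 + q + (4 * (L 0 + q) + 2 * lam ^ 2))) := by gcongr
        have p2 := mul_le_mul_of_nonneg_right hs' (mul_nonneg hl0 ht)
        have p3 : 0 ≤ ε * t * (C₁ * (4 + 2 * lam ^ 2 * q)) := by positivity
        have p4 : ε * t * (C₁ * (1 + q + (4 * (L 0 + q) + 2 * lam ^ 2)))
            = ε * (4 * C₁) * (L 0 * t) + (ε * (C₁ * (5 + 2 * lam ^ 2)) * (1 + q) * t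
              - ε * t * (C₁ * (4 + 2 * lam ^ 2 * q))) := by ring
        linarith
      have a3 : 4 * ε * lam * q + 2 * ε * ((lam ^ 2 * (δ * (4 + 2 * lam ^ 2) + 1 / δ)) * (1 + q))
          ≤ ε * C * (1 + q) := by
        have p1 : 0 ≤ ε * (4 * lam) + ε * (2 * lam ^ 3 + (C₁ * (5 + 2 * lam ^ 2)
          + C₄ * (80 * C₁ / lam))) * (1 + q) := by positivity
        have p2 : ε * C * (1 + q) = 4 * ε * lam * q
            + 2 * ε * ((lam ^ 2 * (δ * (4 + 2 * lam ^ 2) + 1 / δ)) * (1 + q))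
            + (ε * (4 * lam) + ε * (2 * lam ^ 3 + (C₁ * (5 + 2 * lam ^ 2)
          + C₄ * (80 * C₁ / lam))) * (1 + q)) := by rw [hC, hC₄]; ring
        linarith
      have a4 : ε * (C₁ * (5 + 2 * lam ^ 2)) * (1 + q) * t ≤ ε * C * (1 + q) * t := by
        have : C₁ * (5 + 2 * lam ^ 2) ≤ C := by
          have : 0 ≤ 2 * C₄ + C₄ * (80 * C₁ / lam) := by positivity
          linarith
        gcongr
      linarith
    · have g := h2 δ hδ0 t ht
      have a1 := mul_le_mul_of_nonneg_left hδM' ht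
      -- For large ε a constant is at most a multiple of ε; the summand C₄·80C₁/λ of C is included
      -- for this purpose.
      have a2 : C₄ ≤ ε * C := by
        have p1 := mul_le_mul_of_nonneg_left hs hC₄0
        have p2 : 0 ≤ ε * (2 * C₄ + C₁ * (5 + 2 * lam ^ 2)) := by positivity
        have p3 : ε * C = C₄ * (80 * C₁ / lam * ε) + ε * (2 * C₄ + C₁ * (5 + 2 * lam ^ 2)) := by
          rw [hC]; ring
        linarith
      have a3 : t * (C₄ * (1 + q)) ≤ t * (ε * C * (1 + q)) := by gcongr
      have a4 : 0 ≤ ε * C * (1 + q) := by positivity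
      have a5 : 0 ≤ lam / 20 * L 0 * t := by positivity
      linarith
  have hg := gronwall_sin hL hL0 hε hlam.le (by positivity) (by positivity) key ht
  refine hg.trans ?_
  have hx : 1 + lam / 10 * t ≤ Real.exp (1 / 5 * lam * t) := by
    have := Real.add_one_le_exp (1 / 5 * lam * t)
    have : 0 ≤ lam * t := by positivity
    linarith
  -- The spare exponential dominates t at the price 5/λ, whence the factor 1 + 5/λ in
  -- `stabilityConst`.
  have hy : 1 + t ≤ (1 + 5 / lam) * Real.exp (1 / 5 * lam * t) := by
    have p1 := Real.add_one_le_exp (1 / 5 * lam * t)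
    have p2 := mul_le_mul_of_nonneg_left p1 (show 0 ≤ 1 + 5 / lam by positivity)
    have p3 : (1 + 5 / lam) * (1 / 5 * lam * t + 1) = 1 + t + (1 / 5 * lam * t + 5 / lam) := by
      field_simp
      ring
    have p4 : 0 ≤ 1 / 5 * lam * t + 5 / lam := by positivity
    linarith
  have e : L 0 + ε * C * (1 + q) + (lam / 10 * L 0 + ε * C * (1 + q)) * t
      = L 0 * (1 + lam / 10 * t) + ε * C * (1 + q) * (1 + t) := by ring
  rw [e]
  have hexp : Real.exp (2 * lam * t)
      = Real.exp (1 / 5 * lam * t) * Real.exp (9 / 5 * lam * t) := by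
    rw [← Real.exp_add]; congr 1; ring
  rw [hexp, mul_right_comm (Real.exp _)]
  refine mul_le_mul_of_nonneg_right ?_ (Real.exp_pos _).le
  calc L 0 * (1 + lam / 10 * t) + ε * C * (1 + q) * (1 + t)
      ≤ L 0 * Real.exp (1 / 5 * lam * t)
        + ε * C * (1 + q) * ((1 + 5 / lam) * Real.exp (1 / 5 * lam * t)) := by gcongr
    _ = Real.exp (1 / 5 * lam * t) * (L 0 + C * (1 + 5 / lam) * ε * (1 + q)) := by ring
    _ ≤ _ := by gcongr

theorem abs_le_supNorm {g : ℝ → ℝ} (hg : Continuous g) (hgp : Function.Periodic g 1) (x : ℝ) :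
    |g x| ≤ supNorm g := by
  obtain ⟨C, -, hC⟩ := exists_bound_of_periodic hg hgp
  exact le_ciSup (f := fun x => |g x|) ⟨C, by rintro _ ⟨y, rfl⟩; exact hC y⟩ x

theorem IsStrongSolution.realEnergy_le {ε : ℝ} {f : ℝ → ℝ → ℝ → ℝ} {V : ℝ → ℝ → ℝ} {vbar : ℝ}
    {μ Q : ℝ → ℝ} (S : IsStrongSolution ε f V) (hε : 0 < ε) (A : IsAdmissible μ vbar Q)
    (P : IsSStable μ vbar)
    (h0 : Integrable (fun z : ℝ × ℝ => f 0 z.1 z.2 * (z.2 - vbar) ^ 2) phaseMeasure)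
    (hκ : Integrable (fun z : ℝ × ℝ => casimirConst Q μ vbar z.2) phaseMeasure)
    (hQ : casimirBound Q (f 0) < ⊤)
    {V₀ : ℝ → ℝ} (hV : ContDiff ℝ 3 V₀) (hVp : Function.Periodic V₀ 1) {t : ℝ} (ht : 0 ≤ t) :
    realEnergy Q μ vbar ε V₀ f V t ≤ Real.exp (2 * supNorm (iteratedDeriv 2 V₀) * t) *
      (realEnergy Q μ vbar ε V₀ f V 0
        + stabilityConst (supNorm (iteratedDeriv 2 V₀)) (supNorm (iteratedDeriv 3 V₀)) * ε *
          (1 + (casimirBound Q (f 0)).toReal)) := by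
  have hV1 : ContDiff ℝ 1 V₀ := hV.of_le (by norm_num)
  have hW2 : ContDiff ℝ 2 (deriv V₀) := ((contDiff_succ_iff_deriv (n := 2)).1 hV).2.2
  have hW1 : ContDiff ℝ 1 (deriv V₀) := hW2.of_le (by norm_num)
  have hW' : ContDiff ℝ 1 (deriv (deriv V₀)) := ((contDiff_succ_iff_deriv (n := 1)).1 hW2).2.2
  have hpp := Periodic_deriv (Periodic_deriv hVp)
  have e2 : iteratedDeriv 2 V₀ = deriv (deriv V₀) := by
    rw [iteratedDeriv_succ, iteratedDeriv_one]
  have e3 : iteratedDeriv 3 V₀ = deriv (deriv (deriv V₀)) := by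
    rw [iteratedDeriv_succ, e2]
  rw [e2, e3]
  have hlam := abs_le_supNorm hW'.continuous hpp
  have hLam := abs_le_supNorm (hW'.continuous_deriv le_rfl) (Periodic_deriv hpp)
  set lam := supNorm (deriv (deriv V₀)) with hl
  set Lam := supNorm (deriv (deriv (deriv V₀))) with hL
  have hl0 : 0 ≤ lam := (abs_nonneg _).trans (hlam 0)
  have hL0 : 0 ≤ Lam := (abs_nonneg _).trans (hLam 0)
  have hn : ∀ τ, 0 ≤ τ → 0 ≤ realEnergy Q μ vbar ε V₀ f V τ := fun τ hτ =>
    S.realEnergy_nonneg hε A P h0 hκ hQ hV1 hVp hτ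
  have hq : 0 ≤ (casimirBound Q (f 0)).toReal := ENNReal.toReal_nonneg
  have hK : 0 ≤ stabilityConst lam Lam := zero_le_one.trans (le_max_left _ _)
  -- The constants divide by λ, so λ = 0 is separate. Then V₀'' = 0, all error terms vanish, and
  -- L(t) ≤ L(0).
  rcases hl0.eq_or_lt with hz | hp
  · have hlam0 : ∀ x, |deriv (deriv V₀) x| ≤ 0 := fun x => (hlam x).trans hz.symm.le
    have hd : deriv (deriv V₀) = fun _ => 0 := funext fun x => abs_nonpos_iff.1 (hlam0 x)
    have h := S.realEnergy_le_small hε A P h0 hκ hQ hV hVp (lam := 0) (Lam := 0) hlam0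
      (fun x => by rw [hd]; simp) one_pos ht
    simp only [mul_zero, zero_mul, add_zero, intervalIntegral.integral_zero, ne_eq,
      OfNat.ofNat_ne_zero, not_false_eq_true, zero_pow] at h
    rw [← hz, mul_zero, zero_mul, Real.exp_zero, one_mul]
    rw [← hz] at hK
    have : 0 ≤ stabilityConst 0 Lam * ε * (1 + (casimirBound Q (f 0)).toReal) := by positivity
    linarith
  · exact le_of_energy_inequalities (S.realEnergy_continuousOn hε h0 hV1 hVp) hn hε hp hL0 hq
      (S.totalEnergy_le hε A P h0 hκ hQ hV1 hVp
        (abs_deriv_le_of_periodic (hV.of_le (by norm_num)) hVp hlam))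
      (fun δ hδ t ht => S.realEnergy_le_small hε A P h0 hκ hQ hV hVp hlam hLam hδ ht)
      (fun δ hδ t ht => S.realEnergy_le_large hε A P h0 hκ hQ hV hVp hlam hδ ht) ht

end VlasovPoisson
end

/-! ### The stability estimate with values in [0, ∞] -/

theorem mainTheorem2 :
    ∃ K : ℝ → ℝ → ℝ, (∀ a b, 0 < K a b) ∧
      ∀ (μ : ℝ → ℝ) (vbar : ℝ), VlasovPoisson.IsSStable μ vbar →
      ∀ η : ℝ, 0 < η → Integrable (fun v : ℝ => μ v * (1 + |v| ^ (2 + η))) →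
      ∀ Q : ℝ → ℝ, VlasovPoisson.IsAdmissible μ vbar Q →
      ∀ V₀ : ℝ → ℝ, ContDiff ℝ 3 V₀ → Function.Periodic V₀ 1 →
      ∀ ε : ℝ, 0 < ε →
      ∀ (f : ℝ → ℝ → ℝ → ℝ) (V : ℝ → ℝ → ℝ), VlasovPoisson.IsStrongSolution ε f V →
      ∀ t : ℝ, 0 ≤ t →
        VlasovPoisson.filteredEnergy Q μ vbar V₀ ε f V t ≤
          ENNReal.ofReal (Real.exp (2 * VlasovPoisson.supNorm (iteratedDeriv 2 V₀) * t)) *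
            (VlasovPoisson.filteredEnergy Q μ vbar V₀ ε f V 0 +
              ENNReal.ofReal (K (VlasovPoisson.supNorm (iteratedDeriv 2 V₀))
                  (VlasovPoisson.supNorm (iteratedDeriv 3 V₀)) * ε) *
                (1 + VlasovPoisson.energy ε (f 0) (V 0) + VlasovPoisson.casimirBound Q (f 0))) := by
  refine ⟨VlasovPoisson.stabilityConst, fun a b => zero_lt_one.trans_le (le_max_left _ _), ?_⟩
  intro μ vbar P η _ _ Q A V₀ hV hVp ε hε f V S t ht
  have hV1 : ContDiff ℝ 1 V₀ := hV.of_le (by norm_num)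
  set lam := VlasovPoisson.supNorm (iteratedDeriv 2 V₀) with hlam
  set Lam := VlasovPoisson.supNorm (iteratedDeriv 3 V₀) with hLam
  have hexp : ENNReal.ofReal (Real.exp (2 * lam * t)) ≠ 0 := by
    simpa using Real.exp_pos (2 * lam * t)
  have hK : 0 < VlasovPoisson.stabilityConst lam Lam := zero_lt_one.trans_le (le_max_left _ _)
  have hKε : ENNReal.ofReal (VlasovPoisson.stabilityConst lam Lam * ε) ≠ 0 := by
    simpa using mul_pos hK hε
  -- If the Casimir bound or the initial modulated energy is infinite, so is the right side, its
  -- factors being nonzero. Otherwise all quantities are real and finite.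
  rcases eq_top_or_lt_top (VlasovPoisson.casimirBound Q (f 0)) with hQ | hQ
  · rw [hQ, add_top, ENNReal.mul_top hKε, add_top, ENNReal.mul_top hexp]
    exact le_top
  rcases eq_top_or_lt_top (VlasovPoisson.filteredEnergy Q μ vbar V₀ ε f V 0) with hL | hL
  · rw [hL, top_add, ENNReal.mul_top hexp]
    exact le_top
  -- At t = 0 the filter does not shift v, so the Casimir functional of the datum is part of the
  -- finite modulated energy; this yields the second moment of the datum and the integrability of κ.
  have hC : VlasovPoisson.casimir Q μ (f 0) < ⊤ := by
    refine lt_of_le_of_lt ?_ hL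
    rw [VlasovPoisson.filteredEnergy]
    simp only [zero_div, Real.sin_zero, mul_zero, sub_zero]
    exact le_self_add
  obtain ⟨h0, hκ⟩ := S.finite_of_casimir hε A P hQ hC
  have hn0 := S.realEnergy_nonneg hε A P h0 hκ hQ hV1 hVp le_rfl
  have hq : 0 ≤ (VlasovPoisson.casimirBound Q (f 0)).toReal := ENNReal.toReal_nonneg
  rw [S.filteredEnergy_eq hε A P h0 hκ hQ hV1 hVp ht,
    S.filteredEnergy_eq hε A P h0 hκ hQ hV1 hVp le_rfl]
  refine (ENNReal.ofReal_le_ofReal (S.realEnergy_le hε A P h0 hκ hQ hV hVp ht)).trans ?_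
  rw [ENNReal.ofReal_mul (Real.exp_pos _).le, ENNReal.ofReal_add hn0 (by positivity),
    ENNReal.ofReal_mul (by positivity), ENNReal.ofReal_add zero_le_one hq, ENNReal.ofReal_one,
    ENNReal.ofReal_toReal hQ.ne]
  gcongr
  -- Only 1 ≤ 1 + (initial energy) is left, the conserved energy having been estimated through L(0)
  -- and q.
  exact le_self_add
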